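/- Let $F$ be an algebraically closed field of characteristic $0$. Algebras are associative, not necessarily unital; $F\langle X\rangle$ is the free algebra without unit on $X=\{x_0,x_1,\dots\}$; $\langle f\rangle$ is the $T$-ideal generated by $f$, i.e. the smallest two-sided ideal containing $f$ and stable under all endomorphisms of $F\langle X\rangle$; $\mathrm{Id}(A)$ is the $T$-ideal of identities of $A$. For a finite-dimensional algebra $A$ let $J(A)$ be its Jacobson radical, $d(A)=\dim_F A/J(A)$, $n_A\ge 1$ the nilpotency index of $J(A)$, and $\mathrm{Par}(A)=(d(A),n_A-1)$, ordered lexicographically. $A$ is basic if $\mathrm{Id}(A)\ne\mathrm{Id}(B_1\times\dots\times B_r)$ for all $r\ge 1$ and all finite-dimensional algebras $B_i$ with $\mathrm{Par}(B_i)<\mathrm{Par}(A)$. A $T$-ideal $\Gamma$ has Kemer index $(d,s)$ if for all large $\nu$ the following maxima exist (with the convention $\max\emptyset=0$) and equal $d$ and $s$, respectively: the maximal $r$ such that some multilinear $f\notin\Gamma$ alternates on $\nu$ disjoint sets of $r$ variables; the maximal $j$ such that some multilinear $f\notin\Gamma$ alternates on $\nu$ sets of $d$ variables and $j$ sets of $d+1$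 variables, all disjoint. Let $\mu\ge 1$ be any integer from which on both maxima have these values. A Kemer polynomial of $\Gamma$ (with respect to $\mu$) is a multilinear $f\notin\Gamma$ that alternates on at least $\mu$ small sets (of cardinality $d$) and on exactly $s$ big sets (of cardinality $d+1$), all disjoint. A property $P$ of polynomials is $\Gamma$-Phoenix if for every multilinear $f\notin\Gamma$ with $P$ and every $f'\in\langle f\rangle\setminus\Gamma$ there is a multilinear $f''\in\langle f'\rangle\setminus\Gamma$ with $P$; it is strictly $\Gamma$-Phoenix if for every multilinear $f\notin\Gamma$ with $P$ every multilinear $f'\in\langle f\rangle\setminus\Gamma$ has $P$. Let $A=A_1\oplus\dots\oplus A_q\oplus J(A)$ be a Wedderburn--Malcev decomposition (the $A_i$ are simple subalgebras with $A_iA_j=0$ for $i\neq j$). Evaluations of polynomials on $A$ take values in $A_1\cup\dots\cup A_q$ (semisimple values) or $J(A)$ (radical values). $A$ is full with respect to $f$ if in every nonzero evaluation of $f$ each $A_i$ contains the value of some variable of $f$; $A$ has property $K$ with respect to $f$ if $f$ vanishes on every evaluation in which fewer than $n_A-1$ of its variables have radical values. **Theorem.** Let $A$ be a basic finite-dimensional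 $F$-algebra, and let $\Gamma=\mathrm{Id}(A)$. Then $\Gamma$ has Kemer index $\mathrm{Par}(A)$, and for every $\mu$ as above: 1. Being a Kemer polynomial of $\Gamma$ is $\Gamma$-Phoenix. 2. For every Wedderburn--Malcev decomposition of $A$, the property of $f$ that $A$ is full with respect to $f$, and the property of $f$ that $A$ has property $K$ with respect to $f$, are both strictly $\Gamma$-Phoenix, and every Kemer polynomial of $\Gamma$ has both of these properties. 3. If $f\notin\Gamma$ is multilinear and $A$ is full and has property $K$ with respect to $f$ (for some Wedderburn--Malcev decomposition of $A$), then $\langle f\rangle$ contains a Kemer polynomial of $\Gamma$. -/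

import Mathlib

universe u v

namespace PIAlg

/-! Algebras are associative and not necessarily unital. -/

/-- The free associative algebra without unit on the countable set of variables `x 0, x 1, …`:
its monomials are the nonempty words in the variables. -/
abbrev FreeAlg (F : Type u) [Field F] : Type u := MonoidAlgebra F (FreeSemigroup ℕ)

/-- The word, as a list of variables, that underlies a monomial. -/
def letters (w : FreeSemigroup ℕ) : List ℕ := w.head :: w.tail

section Polynomials

variable {F : Type u} [Field F]

/-- The `i`-th variable. -/
noncomputable def X (i : ℕ) : FreeAlg F := MonoidAlgebra.single (FreeSemigroup.of i) 1

/-- The monomials that occur in `f`. -/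
def monomials (f : FreeAlg F) : Finset (FreeSemigroup ℕ) := f.coeff.support

/-- The variables that occur in `f`. -/
def vars (f : FreeAlg F) : Finset ℕ := (monomials f).biUnion fun w => (letters w).toFinset

/-- `f` is multilinear on the set `S` of variables: each of them occurs exactly once in each
monomial of `f`. -/
def IsMultilinearOn (S : Finset ℕ) (f : FreeAlg F) : Prop :=
  ∀ w ∈ monomials f, ∀ x ∈ S, (letters w).count x = 1

/-- `f` is multilinear: it is multilinear on the set of all of its variables. -/
def IsMultilinear (f : FreeAlg F) : Prop := IsMultilinearOn (vars f) f

/-- Evaluation of polynomials at `x i ↦ e i`, for elements `e i` of an algebra. -/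
noncomputable def eval {A : Type v} [NonUnitalRing A] [Module F A] [IsScalarTower F A A]
    [SMulCommClass F A A] (e : ℕ → A) : FreeAlg F →ₙₐ[F] A :=
  MonoidAlgebra.liftMagma F (FreeSemigroup.lift e)

/-- `f` is alternating on the set `S` of variables:
`f = ∑ σ, sign σ • h (x (σ 1), …, x (σ n), Y)` for some `h` multilinear on `S`. -/
def IsAlternatingOn (S : Finset ℕ) (f : FreeAlg F) : Prop :=
  IsMultilinearOn S f ∧ ∃ h : FreeAlg F, IsMultilinearOn S h ∧
    f = ∑ σ : Equiv.Perm {x // x ∈ S},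
      ((Equiv.Perm.sign σ : ℤ) : F) • eval (fun x => X (Equiv.Perm.ofSubtype σ x)) h

/-- `f` alternates on each of `m` sets of cardinality `a` and `k` sets of cardinality `b`,
all of them pairwise disjoint. -/
def HasAlternatingSets (f : FreeAlg F) (m a k b : ℕ) : Prop :=
  ∃ S : Fin m ⊕ Fin k → Finset ℕ,
    Pairwise (fun i j => Disjoint (S i) (S j)) ∧
    (∀ i, (S (Sum.inl i)).card = a) ∧ (∀ j, (S (Sum.inr j)).card = b) ∧
    ∀ t, IsAlternatingOn (S t) f

/-- A `T`-ideal: a two-sided ideal of the free algebra that is stable under all of its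
endomorphisms. -/
structure IsTIdeal (I : Submodule F (FreeAlg F)) : Prop where
  mul_left : ∀ g, ∀ f ∈ I, g * f ∈ I
  mul_right : ∀ g, ∀ f ∈ I, f * g ∈ I
  map_mem : ∀ φ : FreeAlg F →ₙₐ[F] FreeAlg F, ∀ f ∈ I, φ f ∈ I

/-- The `T`-ideal generated by `f`. -/
noncomputable def tIdealSpan (f : FreeAlg F) : Submodule F (FreeAlg F) :=
  sInf {I | IsTIdeal I ∧ f ∈ I}

/-! ### The index of a `T`-ideal and Kemer polynomials -/

/-- The set of all `r` such that some multilinear polynomial outside `Γ` alternates on `ν` disjoint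
sets of cardinality `r`. -/
def smallSizes (Γ : Submodule F (FreeAlg F)) (ν : ℕ) : Set ℕ :=
  {r | ∃ f : FreeAlg F, IsMultilinear f ∧ f ∉ Γ ∧ HasAlternatingSets f ν r 0 0}

/-- The set of all `j` such that some multilinear polynomial outside `Γ` alternates on `ν` disjoint
sets of cardinality `d` and on `j` further disjoint sets of cardinality `d + 1`. -/
def bigCounts (Γ : Submodule F (FreeAlg F)) (d ν : ℕ) : Set ℕ :=
  {j | ∃ f : FreeAlg F, IsMultilinear f ∧ f ∉ Γ ∧ HasAlternatingSets f ν d j (d + 1)}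

/-- From `μ` on, both sequences `d_ν = max (smallSizes Γ ν)` and `s_ν = max (bigCounts Γ d ν)` are
well defined and have reached their limits, which are `d` and `s`. (If `Γ` is the whole free
algebra then both limits are `0`, since `sSup ∅ = 0`.) -/
structure IsKemerStage (Γ : Submodule F (FreeAlg F)) (d s μ : ℕ) : Prop where
  one_le : 1 ≤ μ
  bddAbove_small : ∀ ν ≥ μ, BddAbove (smallSizes Γ ν)
  small_eq : ∀ ν ≥ μ, sSup (smallSizes Γ ν) = d
  bddAbove_big : ∀ ν ≥ μ, BddAbove (bigCounts Γ d ν)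
  big_eq : ∀ ν ≥ μ, sSup (bigCounts Γ d ν) = s

/-- The Kemer index of `Γ` exists and equals `(d, s)`. -/
def HasKemerIndex (Γ : Submodule F (FreeAlg F)) (d s : ℕ) : Prop :=
  ∃ μ, IsKemerStage Γ d s μ

/-- `f` is a Kemer polynomial of `Γ`, where `(d, s)` is the index of `Γ` and `μ` is a stage at
which the two sequences have stabilized: `f` is multilinear, outside `Γ`, and alternates on at least
`μ` small sets (of cardinality `d`) and on `s` big sets (of cardinality `d + 1`), all disjoint.
By the choice of `μ`, no such `f` admits more than `s` big sets. -/
def IsKemerPolynomial (Γ : Submodule F (FreeAlg F)) (d s μ : ℕ) (f : FreeAlg F) : Prop :=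
  IsMultilinear f ∧ f ∉ Γ ∧ ∃ ν ≥ μ, HasAlternatingSets f ν d s (d + 1)

/-- The property `P` of polynomials is `Γ`-Phoenix. -/
def IsPhoenix (Γ : Submodule F (FreeAlg F)) (P : FreeAlg F → Prop) : Prop :=
  ∀ f, IsMultilinear f → P f → f ∉ Γ → ∀ f' ∈ tIdealSpan f, f' ∉ Γ →
    ∃ f'' ∈ tIdealSpan f', IsMultilinear f'' ∧ f'' ∉ Γ ∧ P f''

/-- The property `P` of polynomials is strictly `Γ`-Phoenix. -/
def IsStrictlyPhoenix (Γ : Submodule F (FreeAlg F)) (P : FreeAlg F → Prop) : Prop :=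
  ∀ f, IsMultilinear f → P f → f ∉ Γ →
    ∀ f' ∈ tIdealSpan f, IsMultilinear f' → f' ∉ Γ → P f'

end Polynomials

section Algebras

variable (F : Type u) [Field F] (A : Type v) [NonUnitalRing A] [Module F A]
  [IsScalarTower F A A] [SMulCommClass F A A]

/-- `Id(A)`, the polynomial identities of `A`. -/
noncomputable def identities : Submodule F (FreeAlg F) where
  carrier := {f | ∀ e : ℕ → A, eval e f = 0}
  zero_mem' := fun e => map_zero (eval e)
  add_mem' := fun {f g} hf hg e => by rw [map_add, hf e, hg e, add_zero]
  smul_mem' := fun c f hf e => by rw [map_smul, hf e, smul_zero]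

/-- The Jacobson radical of the (possibly nonunital) algebra `A`: the intersection of `A` with the
Jacobson radical of the algebra obtained from `A` by adjoining a unit. -/
noncomputable def radical : Submodule F A :=
  ((Ring.jacobson (Unitization F A)).restrictScalars F).comap (Unitization.inrHom F F A)

/-- The nilpotency index `n_A` of the radical of `A`: the least `n` such that all products of `n`
elements of the radical vanish. (`n = 0` never qualifies: the empty product is the adjoined unit.
So `n_A ≥ 1`, with equality exactly if the radical is zero.) -/
noncomputable def nilpotencyIndex : ℕ :=
  sInf {n | ∀ l : List A, l.length = n → (∀ a ∈ l, a ∈ radical F A) →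
    (l.map (Unitization.inr : A → Unitization F A)).prod = 0}

/-- `d(A)`, the dimension of the semisimple part `A / J(A)`. -/
noncomputable def semisimpleDim : ℕ := Module.finrank F (A ⧸ radical F A)

/-- `Par(A) = (d(A), n_A - 1)`, with the lexicographic order. -/
noncomputable def par : ℕ ×ₗ ℕ := toLex (semisimpleDim F A, nilpotencyIndex F A - 1)

/-- `A` is basic: it is not PI equivalent to a product `B 1 × ⋯ × B r`, `r ≥ 1`, of finite
dimensional algebras with `Par (B i) < Par A` for all `i`. -/
def IsBasic : Prop :=
  ∀ (r : ℕ) (B : Fin r → Type u) [∀ i, NonUnitalRing (B i)] [∀ i, Module F (B i)]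
    [∀ i, IsScalarTower F (B i) (B i)] [∀ i, SMulCommClass F (B i) (B i)]
    [∀ i, FiniteDimensional F (B i)],
    1 ≤ r → (∀ i, par F (B i) < par F A) → identities F A ≠ identities F (∀ i, B i)

/-- A Wedderburn-Malcev decomposition `A = A 1 ⊕ ⋯ ⊕ A q ⊕ J(A)`: a direct sum of vector spaces,
where the `A i` are simple subalgebras that annihilate one another. So `A 1 × ⋯ × A q` is a
semisimple subalgebra that complements the radical, and the `A i` are its simple components. -/
structure WedderburnDecomposition where
  q : ℕ
  component : Fin q → NonUnitalSubalgebra F A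
  simple : ∀ i, IsSimpleRing (component i)
  orthogonal : ∀ i j, i ≠ j → ∀ a ∈ component i, ∀ b ∈ component j, a * b = 0
  isInternal : DirectSum.IsInternal fun o : Option (Fin q) =>
    o.elim (radical F A) fun i => (component i).toSubmodule

variable {F A}

/-- Every variable is evaluated semisimply (in a simple component) or radically (in `J(A)`). -/
def WedderburnDecomposition.IsPure (W : WedderburnDecomposition F A) (e : ℕ → A) : Prop :=
  ∀ x, e x ∈ radical F A ∨ ∃ i, e x ∈ W.component i

/-- `A` is full with respect to every nonzero evaluation of `f`: in each of them, every simple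
component occurs among the semisimple values of the variables of `f`. -/
def WedderburnDecomposition.IsFullFor (W : WedderburnDecomposition F A) (f : FreeAlg F) : Prop :=
  ∀ e : ℕ → A, W.IsPure e → eval e f ≠ 0 → ∀ i, ∃ x ∈ vars f, e x ∈ W.component i

/-- Property `K` with respect to `f`: `f` vanishes on every evaluation with less than `n_A - 1`
radical substitutions. -/
def WedderburnDecomposition.HasPropertyK (W : WedderburnDecomposition F A) (f : FreeAlg F) : Prop :=
  ∀ e : ℕ → A, W.IsPure e →
    Set.ncard {x | x ∈ vars f ∧ e x ∈ radical F A} < nilpotencyIndex F A - 1 → eval e f = 0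

end Algebras

end PIAlg

/-! Write `J` for the radical, `C` for a span of matrix units complementing it, `d = dim C`, `n =
n_A` and `s = n - 1`.

Fullness and property `K` are conditions of membership in `T`-ideals. A multilinear `f` is full iff
it is an identity of each subalgebra spanned by `J` and all simple components but the `i`-th
(`MatrixUnits.without`, `isFullFor_iff`). It has property `K` iff it is an identity of `C ⊗ 1 + J ⊗
(t)` inside `A ⊗ F[t]/(t ^ s)` (`MatrixUnits.trunc`, `hasPropertyK_iff`): a value with `k` radical
entries picks up a factor `t ^ k`, which is nonzero exactly for `k < s`. Hence both conditions are
inherited by the multilinear elements of `⟨f⟩`, which is the strict Phoenix property.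

These auxiliary algebras satisfy the identities of `A`. Dropping a component lowers the semisimple
dimension; for `s ≥ 1`, truncating lowers the dimension or the nilpotency index. So if `A` is basic
and nonzero, some nonidentity of `A` is an identity of all of them, and in characteristic zero it
may be taken multilinear (`exists_multilinear_notMem`, `IsBasic.exists_full_propertyK`).

A counting argument (`IsNilpotentIdeal.eval_eq_zero_of_alternating`) bounds the index from above and
shows that Kemer polynomials are full with property `K`. Modulo a nilpotent ideal spanned by `c`
elements, a set of more than `c` alternating variables must contain a variable with value in the
ideal, and too many such variables kill the polynomial.

It remains to regenerate a Kemer polynomial from a full `f` with property `K` (`exists_framing`,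
`exists_hasAlternatingSets`). A nonzero evaluation on matrix units and homogeneous radical elements
has exactly `s` radical values. For each component, either some radical value enters it from
outside, or its identity element fixes the value of `f` from the left. At that place one inserts a
product of factors `E β a * E a b * E b β`, one for each matrix unit of the component and each of `ν
+ s` blocks. The middle variables of a block form a small set; in `s` of the blocks, one radical
variable of `f` is added to make a big set. Upon alternation only the identity permutation
contributes: permuting matrix units kills one of the inserted factors, and moving a radical variable
leaves fewer than `s` radical values, so that property `K` applies. A correction term in the
substitution ensures that a semisimple value at an entering variable gives zero. -/

set_option linter.unusedSectionVars false

universe w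

namespace PIAlg

open MonoidAlgebra

/-! ### Evaluation of polynomials, word by word in the unitization -/

section Words

variable {F : Type u} [Field F] {A : Type v} [NonUnitalRing A] [Module F A]
  [IsScalarTower F A A] [SMulCommClass F A A]

lemma letters_mul (v w : FreeSemigroup ℕ) : letters (v * w) = letters v ++ letters w := by
  simp [letters]

lemma letters_of (x : ℕ) : letters (FreeSemigroup.of x) = [x] := rfl

variable (F) in
/-- The product of the values of a list of variables, in the unitization. -/
noncomputable def wordVal (e : ℕ → A) (l : List ℕ) : Unitization F A :=
  (l.map fun x => (Unitization.inr (e x) : Unitization F A)).prod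

lemma wordVal_append (e : ℕ → A) (l l' : List ℕ) :
    wordVal F e (l ++ l') = wordVal F e l * wordVal F e l' := by simp [wordVal]

lemma wordVal_cons (e : ℕ → A) (x : ℕ) (l : List ℕ) :
    wordVal F e (x :: l) = Unitization.inr (e x) * wordVal F e l := by simp [wordVal]

lemma eval_single (e : ℕ → A) (w : FreeSemigroup ℕ) (c : F) :
    eval e (single w c : FreeAlg F) = c • FreeSemigroup.lift e w := by
  simp [eval]

lemma eval_X (e : ℕ → A) (x : ℕ) : eval e (X x : FreeAlg F) = e x := by
  simp [X, eval_single]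

lemma inr_lift (e : ℕ → A) (w : FreeSemigroup ℕ) :
    (Unitization.inr (FreeSemigroup.lift e w) : Unitization F A) = wordVal F e (letters w) := by
  induction w using FreeSemigroup.recOnMul with
  | ih1 x => simp [letters_of, wordVal]
  | ih2 x y hx hy => rw [map_mul, Unitization.inr_mul, hx, hy, letters_mul, wordVal_append]

lemma inr_eval_single (e : ℕ → A) (w : FreeSemigroup ℕ) (c : F) :
    (Unitization.inr (eval e (single w c : FreeAlg F)) : Unitization F A) =
      c • wordVal F e (letters w) := by
  rw [eval_single, Unitization.inr_smul, inr_lift]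

lemma eq_sum_single (f : FreeAlg F) : f = ∑ w ∈ monomials f, single w (f.coeff w) := by
  conv_lhs => rw [← MonoidAlgebra.sum_coeff_single f]
  rfl

lemma inr_eval (e : ℕ → A) (f : FreeAlg F) :
    (Unitization.inr (eval e f) : Unitization F A) =
      ∑ w ∈ monomials f, f.coeff w • wordVal F e (letters w) := by
  conv_lhs => rw [eq_sum_single f]
  rw [map_sum, ← Unitization.inrHom_apply F, map_sum]
  simp only [Unitization.inrHom_apply, inr_eval_single]

lemma mem_monomials {f : FreeAlg F} {w : FreeSemigroup ℕ} : w ∈ monomials f ↔ f.coeff w ≠ 0 := by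
  simp [monomials]

lemma mem_vars {f : FreeAlg F} {x : ℕ} : x ∈ vars f ↔ ∃ w ∈ monomials f, x ∈ letters w := by
  simp [vars]

lemma eval_congr {e e' : ℕ → A} {f : FreeAlg F} (h : ∀ x ∈ vars f, e x = e' x) :
    eval e f = eval e' f := by
  apply Unitization.inr_injective (R := F)
  rw [inr_eval, inr_eval]
  refine Finset.sum_congr rfl fun w hw => ?_
  congr 1
  unfold wordVal
  congr 1
  exact List.map_congr_left fun x hx => by rw [h x (mem_vars.2 ⟨w, hw, hx⟩)]

lemma algHom_eq_eval (φ : FreeAlg F →ₙₐ[F] A) : φ = eval fun x => φ (X x) := by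
  apply MonoidAlgebra.nonUnitalAlgHom_ext
  intro w
  induction w using FreeSemigroup.recOnMul with
  | ih1 x => simp [eval_single, X]
  | ih2 x y hx hy =>
    have : (single (FreeSemigroup.of x * y) 1 : FreeAlg F) =
      single (FreeSemigroup.of x) 1 * single y 1 := by simp
    rw [this, map_mul, map_mul, hx, hy]

lemma algHom_eval {B : Type w} [NonUnitalRing B] [Module F B] [IsScalarTower F B B]
    [SMulCommClass F B B] (φ : A →ₙₐ[F] B) (e : ℕ → A) (f : FreeAlg F) :
    φ (eval e f) = eval (fun x => φ (e x)) f := by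
  have := algHom_eq_eval (φ.comp (eval e))
  have h := DFunLike.congr_fun this f
  simpa [eval_X] using h

lemma eval_eval (e : ℕ → A) (p : ℕ → FreeAlg F) (f : FreeAlg F) :
    eval e (eval p f) = eval (fun x => eval e (p x)) f := algHom_eval _ _ _

lemma eval_X_self (f : FreeAlg F) : eval X f = f := by
  have := algHom_eq_eval (NonUnitalAlgHom.id F (FreeAlg F))
  exact (DFunLike.congr_fun this f).symm

end Words

/-! ### Multihomogeneous and multilinear polynomials -/

section Homogeneous

variable {F : Type u} [Field F] {A : Type v} [NonUnitalRing A] [Module F A]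
  [IsScalarTower F A A] [SMulCommClass F A A]

variable (F) in
/-- The polynomials all of whose monomials have the given multiset of letters. -/
def multihomogeneous (μ : Multiset ℕ) : Submodule F (FreeAlg F) where
  carrier := {f | ∀ w, (letters w : Multiset ℕ) ≠ μ → f.coeff w = 0}
  zero_mem' := by simp
  add_mem' := fun {f g} hf hg w hw => by simp [hf w hw, hg w hw]
  smul_mem' := fun c f hf w hw => by simp [hf w hw]

lemma mem_multihomogeneous {μ : Multiset ℕ} {f : FreeAlg F} :
    f ∈ multihomogeneous F μ ↔ ∀ w ∈ monomials f, (letters w : Multiset ℕ) = μ := by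
  simp only [mem_monomials]
  exact ⟨fun h w => not_imp_comm.1 (h w), fun h w => not_imp_comm.1 (h w)⟩

lemma single_mem_multihomogeneous {μ : Multiset ℕ} {w : FreeSemigroup ℕ} (c : F)
    (h : (letters w : Multiset ℕ) = μ) : (single w c : FreeAlg F) ∈ multihomogeneous F μ := by
  intro v hv
  rw [MonoidAlgebra.coeff_single, Finsupp.single_apply, if_neg]
  rintro rfl
  exact hv h

lemma IsMultilinear.mem_multihomogeneous {f : FreeAlg F} (hf : IsMultilinear f) :
    f ∈ multihomogeneous F (vars f).val := by
  rw [PIAlg.mem_multihomogeneous]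
  intro w hw
  ext x
  by_cases hx : x ∈ vars f
  · rw [Multiset.coe_count, hf w hw x hx]
    exact (Multiset.count_eq_one_of_mem (vars f).nodup hx).symm
  · rw [Multiset.coe_count, List.count_eq_zero.2 fun h => hx (mem_vars.2 ⟨w, hw, h⟩)]
    exact (Multiset.count_eq_zero.2 hx).symm

lemma isMultilinearOn_of_mem {μ : Multiset ℕ} (hμ : μ.Nodup) {f : FreeAlg F}
    (hf : f ∈ multihomogeneous F μ) {S : Finset ℕ} (hS : ∀ x ∈ S, x ∈ μ) :
    IsMultilinearOn S f := by
  intro w hw x hx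
  rw [← Multiset.coe_count, mem_multihomogeneous.1 hf w hw]
  exact Multiset.count_eq_one_of_mem hμ (hS x hx)

lemma isMultilinear_of_mem {μ : Multiset ℕ} (hμ : μ.Nodup) {f : FreeAlg F}
    (hf : f ∈ multihomogeneous F μ) : IsMultilinear f := by
  refine isMultilinearOn_of_mem hμ hf fun x hx => ?_
  obtain ⟨w, hw, hx⟩ := mem_vars.1 hx
  rw [← mem_multihomogeneous.1 hf w hw]
  exact hx

lemma IsMultilinear.count_letters {f : FreeAlg F} (hf : IsMultilinear f) {w : FreeSemigroup ℕ}
    (hw : w ∈ monomials f) {x : ℕ} (hx : x ∈ vars f) : (letters w).count x = 1 := hf w hw x hx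

lemma wordVal_update_notMem (e : ℕ → A) {l : List ℕ} {x : ℕ} (hx : x ∉ l) (a : A) :
    wordVal F (Function.update e x a) l = wordVal F e l := by
  unfold wordVal
  congr 1
  refine List.map_congr_left fun y hy => ?_
  rw [Function.update_of_ne]
  rintro rfl
  exact hx hy

lemma wordVal_update (e : ℕ → A) {l : List ℕ} {x : ℕ} (hx : l.count x = 1) :
    ∃ p q : Unitization F A, ∀ a, wordVal F (Function.update e x a) l = p * Unitization.inr a * q := by
  obtain ⟨l₁, l₂, rfl⟩ := List.append_of_mem (List.count_pos_iff.1 (by omega : 0 < l.count x))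
  simp only [List.count_append, List.count_cons_self] at hx
  have h₁ : x ∉ l₁ := List.count_eq_zero.1 (by omega)
  have h₂ : x ∉ l₂ := List.count_eq_zero.1 (by omega)
  refine ⟨wordVal F e l₁, wordVal F e l₂, fun a => ?_⟩
  rw [wordVal_append, wordVal_cons, wordVal_update_notMem e h₁, wordVal_update_notMem e h₂,
    Function.update_self, mul_assoc]

/-- Evaluation of a multilinear polynomial is linear in the value of each of its variables. -/
lemma isLinearMap_eval_update {f : FreeAlg F} (hf : IsMultilinear f) {x : ℕ} (hx : x ∈ vars f)
    (e : ℕ → A) : IsLinearMap F fun a => eval (Function.update e x a) f := by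
  have key : ∃ L : A →ₗ[F] Unitization F A,
      ∀ a, (Unitization.inr (eval (Function.update e x a) f) : Unitization F A) = L a := by
    choose p q hpq using fun w : {w // w ∈ monomials f} =>
      wordVal_update (F := F) e (hf.count_letters w.2 hx)
    refine ⟨∑ w : {w // w ∈ monomials f}, f.coeff w.1 •
      (LinearMap.mulRight F (q w) ∘ₗ LinearMap.mulLeft F (p w) ∘ₗ Unitization.inrHom F F A),
      fun a => ?_⟩
    rw [inr_eval, ← Finset.sum_coe_sort]
    simp [hpq]
  obtain ⟨L, hL⟩ := key
  constructor
  · intro a b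
    apply Unitization.inr_injective (R := F)
    simp [hL]
  · intro c a
    apply Unitization.inr_injective (R := F)
    simp [hL]

/-- A function that is linear in each of finitely many arguments is nonzero at some tuple from
given sets if it is nonzero at some tuple from their spans. -/
lemma exists_ne_zero_of_mem_span {V W : Type*} [AddCommGroup V] [Module F V] [AddCommGroup W]
    [Module F W] {Ψ : (ℕ → V) → W} (S : Finset ℕ)
    (hΨ : ∀ x ∈ S, ∀ Q, IsLinearMap F fun a => Ψ (Function.update Q x a)) (T : ℕ → Set V)
    {Q : ℕ → V} (hQ : ∀ x ∈ S, Q x ∈ Submodule.span F (T x)) (h : Ψ Q ≠ 0) :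
    ∃ Q', (∀ x ∈ S, Q' x ∈ T x) ∧ (∀ x ∉ S, Q' x = Q x) ∧ Ψ Q' ≠ 0 := by
  induction S using Finset.induction_on generalizing Q with
  | empty => exact ⟨Q, by simp, by simp, h⟩
  | insert x S hxS ih =>
    obtain ⟨Q₁, h₁, h₁', hne⟩ := ih (fun y hy => hΨ y (Finset.mem_insert_of_mem hy))
      (fun y hy => hQ y (Finset.mem_insert_of_mem hy)) h
    have lin := hΨ x (Finset.mem_insert_self x S) Q₁
    have hx := hQ x (Finset.mem_insert_self x S)
    rw [← h₁' x hxS] at hx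
    by_contra! hall
    have hz : ∀ a ∈ T x, Ψ (Function.update Q₁ x a) = 0 := by
      intro a ha
      refine hall _ ?_ ?_
      · intro y hy
        rcases Finset.mem_insert.1 hy with rfl | hy
        · simpa using ha
        · rw [Function.update_of_ne (ne_of_mem_of_not_mem hy hxS)]
          exact h₁ y hy
      · intro y hy
        rw [Finset.mem_insert, not_or] at hy
        rw [Function.update_of_ne hy.1]
        exact h₁' y hy.2
    have : ∀ a ∈ Submodule.span F (T x), Ψ (Function.update Q₁ x a) = 0 := by
      intro a ha
      have hle : Submodule.span F (T x) ≤ LinearMap.ker lin.mk' :=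
        Submodule.span_le.2 fun b hb => hz b hb
      exact hle ha
    apply hne
    have := this _ hx
    rwa [Function.update_eq_self] at this

/-- A multilinear polynomial that does not vanish on the span of a set does not vanish on the
set. -/
lemma IsMultilinear.exists_eval_ne_zero {f : FreeAlg F} (hf : IsMultilinear f) {T : Set A}
    {e : ℕ → A} (he : ∀ x, e x ∈ Submodule.span F T) (h : eval e f ≠ 0) :
    ∃ e' : ℕ → A, (∀ x ∈ vars f, e' x ∈ T) ∧ (∀ x ∉ vars f, e' x = 0) ∧ eval e' f ≠ 0 := by
  obtain ⟨Q, hQ, hQ', hne⟩ := exists_ne_zero_of_mem_span (F := F) (Ψ := fun e => eval e f) (vars f)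
    (fun x hx Q => isLinearMap_eval_update hf hx Q) (fun _ => T)
    -- Variables that do not occur in `f` get the value zero, so that the whole new evaluation is
    -- under control.
    (Q := fun x => if x ∈ vars f then e x else 0) (fun x hx => by simpa [hx] using he x)
    (by rwa [eval_congr (e' := e) (fun x hx => by simp [hx])])
  exact ⟨Q, hQ, fun x hx => by rw [hQ' x hx, if_neg hx], hne⟩

lemma IsMultilinear.eval_eq_zero_of_eq_zero {f : FreeAlg F} (hf : IsMultilinear f) {e : ℕ → A}
    {x : ℕ} (hx : x ∈ vars f) (h : e x = 0) : eval e f = 0 := by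
  have := (isLinearMap_eval_update hf hx e).map_zero
  have he : Function.update e x 0 = e := by rw [← h, Function.update_eq_self]
  rwa [he] at this

end Homogeneous

/-! ### `T`-ideals and identities -/

section TIdeals

variable {F : Type u} [Field F] {A : Type v} [NonUnitalRing A] [Module F A]
  [IsScalarTower F A A] [SMulCommClass F A A]

lemma mem_identities {f : FreeAlg F} : f ∈ identities F A ↔ ∀ e : ℕ → A, eval e f = 0 := Iff.rfl

lemma isTIdeal_identities : IsTIdeal (identities F A) where
  mul_left g f hf e := by rw [map_mul, hf e, mul_zero]
  mul_right g f hf e := by rw [map_mul, hf e, zero_mul]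
  map_mem φ f hf e := by rw [algHom_eq_eval φ, eval_eval]; exact hf _

lemma isTIdeal_tIdealSpan (f : FreeAlg F) : IsTIdeal (tIdealSpan f) where
  mul_left g h hh := by
    simp only [tIdealSpan, Submodule.mem_sInf] at hh ⊢
    exact fun I hI => hI.1.mul_left g h (hh I hI)
  mul_right g h hh := by
    simp only [tIdealSpan, Submodule.mem_sInf] at hh ⊢
    exact fun I hI => hI.1.mul_right g h (hh I hI)
  map_mem φ h hh := by
    simp only [tIdealSpan, Submodule.mem_sInf] at hh ⊢
    exact fun I hI => hI.1.map_mem φ h (hh I hI)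

lemma mem_tIdealSpan_self (f : FreeAlg F) : f ∈ tIdealSpan f := by
  simp only [tIdealSpan, Submodule.mem_sInf]
  exact fun I hI => hI.2

lemma tIdealSpan_le {f : FreeAlg F} {I : Submodule F (FreeAlg F)} (hI : IsTIdeal I) (hf : f ∈ I) :
    tIdealSpan f ≤ I := sInf_le ⟨hI, hf⟩

lemma mem_identities_subalgebra {P : NonUnitalSubalgebra F A} {f : FreeAlg F} :
    f ∈ identities F P ↔ ∀ e : ℕ → A, (∀ x, e x ∈ P) → eval e f = 0 := by
  rw [mem_identities]
  have key : ∀ e : ℕ → P, ((eval e f : P) : A) = eval (fun x => (e x : A)) f := fun e =>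
    algHom_eval (NonUnitalSubalgebraClass.subtype P) e f
  constructor
  · intro h e he
    have := congrArg (Subtype.val) (h fun x => ⟨e x, he x⟩)
    rwa [key] at this
  · intro h e
    apply Subtype.ext
    rw [key]
    exact h _ fun x => (e x).2

end TIdeals

end PIAlg

namespace PIAlg

open MonoidAlgebra

/-! ### Multilinearization in characteristic zero -/

section Linearization

variable {F : Type u} [Field F]

/-- The coefficients of a polynomial function with values in a vector space over an infinite field
belong to every subspace that contains all of its values. -/
lemma mem_of_forall_sum_pow_smul_mem [Infinite F] {M : Type*} [AddCommGroup M] [Module F M]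
    (I : Submodule F M) (N : ℕ) (v : ℕ → M)
    (h : ∀ c : F, ∑ k ∈ Finset.range N, c ^ k • v k ∈ I) {k : ℕ} (hk : k < N) : v k ∈ I := by
  rw [← Submodule.Quotient.mk_eq_zero, ← Module.forall_dual_apply_eq_zero_iff F]
  intro φ
  set p : Polynomial F :=
    ∑ j ∈ Finset.range N, Polynomial.monomial j (φ (Submodule.Quotient.mk (v j))) with hp
  have h0 : p = 0 := by
    apply Polynomial.funext
    intro c
    have hc := h c
    rw [← Submodule.Quotient.mk_eq_zero] at hc
    have := congrArg φ hc
    rw [← Submodule.mkQ_apply, map_sum, map_sum, map_zero] at this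
    simp only [hp, Polynomial.eval_finsetSum, Polynomial.eval_monomial, Polynomial.eval_zero]
    rw [← this]
    refine Finset.sum_congr rfl fun j _ => ?_
    simp [mul_comm]
  have := congrArg (fun q => Polynomial.coeff q k) h0
  simpa [hp, Polynomial.finsetSum_coeff, Polynomial.coeff_monomial, hk] using this

variable (F) in
/-- The polynomials all of whose monomials belong to the given set. -/
def supported (s : Set (FreeSemigroup ℕ)) : Submodule F (FreeAlg F) where
  carrier := {f | ∀ w ∉ s, f.coeff w = 0}
  zero_mem' := by simp
  add_mem' := fun {f g} hf hg w hw => by simp [hf w hw, hg w hw]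
  smul_mem' := fun c f hf w hw => by simp [hf w hw]

lemma mem_supported {s : Set (FreeSemigroup ℕ)} {f : FreeAlg F} :
    f ∈ supported F s ↔ ∀ w ∈ monomials f, w ∈ s := by
  simp only [mem_monomials]
  exact ⟨fun h w => not_imp_comm.1 (h w), fun h w => not_imp_comm.1 (h w)⟩

lemma single_mem_supported {s : Set (FreeSemigroup ℕ)} {w : FreeSemigroup ℕ} (c : F)
    (h : w ∈ s) : (single w c : FreeAlg F) ∈ supported F s := by
  intro v hv
  rw [MonoidAlgebra.coeff_single, Finsupp.single_apply, if_neg]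
  rintro rfl
  exact hv h

lemma mul_mem_supported {s t r : Set (FreeSemigroup ℕ)} {f g : FreeAlg F}
    (hf : f ∈ supported F s) (hg : g ∈ supported F t) (h : ∀ v ∈ s, ∀ w ∈ t, v * w ∈ r) :
    f * g ∈ supported F r := by
  rw [eq_sum_single f, eq_sum_single g, Finset.sum_mul_sum]
  refine Submodule.sum_mem _ fun v hv => Submodule.sum_mem _ fun w hw => ?_
  rw [MonoidAlgebra.single_mul_single]
  exact single_mem_supported _ (h v (mem_supported.1 hf v hv) w (mem_supported.1 hg w hw))

/-- The part of `f` of degree `k` in the variable `x`. -/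
noncomputable def component (x k : ℕ) (f : FreeAlg F) : FreeAlg F :=
  ofCoeff (f.coeff.filter fun w => (letters w).count x = k)

lemma coeff_component (x k : ℕ) (f : FreeAlg F) (w : FreeSemigroup ℕ) :
    (component x k f).coeff w = if (letters w).count x = k then f.coeff w else 0 := by
  simp [component, Finsupp.filter_apply]

lemma mem_monomials_component {x k : ℕ} {f : FreeAlg F} {w : FreeSemigroup ℕ} :
    w ∈ monomials (component x k f) ↔ w ∈ monomials f ∧ (letters w).count x = k := by
  rw [mem_monomials, mem_monomials, coeff_component]
  split_ifs with h <;> simp [h]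

/-- The substitution `x ↦ c x`. -/
noncomputable def scale (x : ℕ) (c : F) : FreeAlg F →ₙₐ[F] FreeAlg F :=
  eval (Function.update X x (c • X x))

lemma scale_single (x : ℕ) (c : F) (w : FreeSemigroup ℕ) (a : F) :
    scale x c (single w a) = c ^ (letters w).count x • (single w a : FreeAlg F) := by
  induction w using FreeSemigroup.recOnMul generalizing a with
  | ih1 y =>
    rw [scale, eval_single, FreeSemigroup.lift_of, letters_of]
    by_cases h : y = x
    · subst h
      simp [X, mul_comm]
    · simp [X, h]
  | ih2 y w hy hw =>
    have : (single (FreeSemigroup.of y * w) a : FreeAlg F) =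
      single (FreeSemigroup.of y) a * single w 1 := by simp
    rw [this, map_mul, hy, hw, letters_mul, List.count_append, pow_add, smul_mul_smul_comm]

lemma coeff_scale (x : ℕ) (c : F) (f : FreeAlg F) (w : FreeSemigroup ℕ) :
    (scale x c f).coeff w = c ^ (letters w).count x * f.coeff w := by
  induction f using MonoidAlgebra.induction_linear with
  | zero => simp
  | add f g hf hg => rw [map_add, coeff_add, coeff_add, Finsupp.add_apply, hf, hg,
      Finsupp.add_apply, mul_add]
  | single v a =>
    rw [scale_single, coeff_smul, coeff_single, Finsupp.smul_apply, Finsupp.single_apply]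
    split_ifs with h
    · rw [h, smul_eq_mul]
    · simp

lemma exists_scale_eq_sum (x : ℕ) (f : FreeAlg F) (M : ℕ) :
    ∃ N ≥ M, ∀ c : F, scale x c f = ∑ k ∈ Finset.range N, c ^ k • component x k f := by
  refine ⟨M + ((monomials f).sup fun w => (letters w).count x) + 1, by omega, fun c => ?_⟩
  ext w
  rw [coeff_scale, coeff_sum, Finsupp.finsetSum_apply]
  simp only [coeff_smul_apply, coeff_component, smul_eq_mul, mul_ite, mul_zero]
  rw [Finset.sum_ite_eq]
  split_ifs with h
  · rfl
  · have : w ∉ monomials f := fun hw => h <| Finset.mem_range.2 <| by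
      have : (letters w).count x ≤ _ := Finset.le_sup (f := fun w => (letters w).count x) hw
      omega
    rw [mem_monomials, not_not] at this
    rw [this, mul_zero]

variable [Infinite F]

/-- Scaling `x` by `c` maps `f` to a polynomial in `c` whose coefficients are the components. All
its values lie in `I`, and over an infinite field so do its coefficients. -/
lemma component_mem {I : Submodule F (FreeAlg F)} (hI : IsTIdeal I) {f : FreeAlg F} (hf : f ∈ I)
    (x k : ℕ) : component x k f ∈ I := by
  obtain ⟨N, hN, h⟩ := exists_scale_eq_sum x f (k + 1)
  exact mem_of_forall_sum_pow_smul_mem I N (fun k => component x k f)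
    (fun c => by rw [← h]; exact hI.map_mem _ f hf) (by omega)

/-- The part of `f (x + y)` that is linear in `y`. -/
noncomputable def linearize (x y : ℕ) (f : FreeAlg F) : FreeAlg F :=
  component y 1 (eval (Function.update X x (X x + X y)) f)

lemma linearize_mem {I : Submodule F (FreeAlg F)} (hI : IsTIdeal I) {f : FreeAlg F} (hf : f ∈ I)
    (x y : ℕ) : linearize x y f ∈ I :=
  component_mem hI (hI.map_mem _ f hf) _ _

/-- Euler's identity. In characteristic zero it makes `f` recoverable from its linearization when `k
≠ 0`. -/
lemma eval_linearize {x y k : ℕ} {f : FreeAlg F} (hy : y ∉ vars f) (hxy : x ≠ y)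
    (hk : ∀ w ∈ monomials f, (letters w).count x = k) :
    eval (Function.update X y (X x)) (linearize x y f) = k • f := by
  set φ : FreeAlg F →ₙₐ[F] FreeAlg F := eval (Function.update X x (X x + X y))
  set κ : FreeAlg F →ₙₐ[F] FreeAlg F := eval (Function.update X y (X x))
  obtain ⟨N, hN, h⟩ := exists_scale_eq_sum y (φ f) (k + 2)
  have h₁ : ∀ c : F, κ (scale y c (φ f)) = scale x (1 + c) f := by
    intro c
    simp only [κ, φ, scale, eval_eval]
    refine eval_congr fun z hz => ?_
    have hzy : z ≠ y := ne_of_mem_of_not_mem hz hy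
    by_cases hzx : z = x
    · subst hzx
      simp [eval_X, hzy, add_smul]
    · simp [eval_X, hzx, hzy]
  have h₂ : ∀ c : F, scale x c f = c ^ k • f := by
    intro c
    ext w
    rw [coeff_scale, coeff_smul_apply, smul_eq_mul]
    by_cases hw : w ∈ monomials f
    · rw [hk w hw]
    · rw [mem_monomials, not_not] at hw
      rw [hw, mul_zero, mul_zero]
  -- Comparison of the coefficients of `c ^ j` in `f ((1 + c) x) = (1 + c) ^ k f`; the case `j = 1`
  -- is the claim.
  have h₃ := mem_of_forall_sum_pow_smul_mem (⊥ : Submodule F (FreeAlg F)) N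
    (fun j => κ (component y j (φ f)) - (k.choose j : F) • f) (fun c => by
      rw [Submodule.mem_bot]
      simp only [smul_sub, Finset.sum_sub_distrib, ← map_smul, ← map_sum]
      rw [← h c, h₁, h₂]
      simp only [smul_smul, ← Finset.sum_smul]
      rw [sub_eq_zero, add_comm, add_pow]
      congr 1
      simp only [one_pow, mul_one]
      refine Finset.sum_subset (Finset.range_subset_range.2 (by omega : k + 1 ≤ N)) fun j _ hj => ?_
      rw [Nat.choose_eq_zero_of_lt (by simpa using hj), Nat.cast_zero, mul_zero]) (k := 1) (by omega)
  rw [Submodule.mem_bot, sub_eq_zero, Nat.choose_one_right] at h₃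
  rw [linearize, h₃, Nat.cast_smul_eq_nsmul]

lemma eval_add_single_mem_supported (x y : ℕ) (w : FreeSemigroup ℕ) (c : F) :
    eval (Function.update X x (X x + X y)) (single w c : FreeAlg F) ∈
      supported F {v | (letters v).map (fun z => if z = y then x else z) =
        (letters w).map (fun z => if z = y then x else z)} := by
  induction w using FreeSemigroup.recOnMul generalizing c with
  | ih1 z =>
    rw [eval_single, FreeSemigroup.lift_of]
    refine Submodule.smul_mem _ _ ?_
    by_cases h : z = x
    · subst h
      rw [Function.update_self]
      refine Submodule.add_mem _ (single_mem_supported _ rfl) (single_mem_supported _ ?_)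
      simp [letters_of]
    · rw [Function.update_of_ne h]
      exact single_mem_supported _ rfl
  | ih2 z w hz hw =>
    have : (single (FreeSemigroup.of z * w) c : FreeAlg F) =
      single (FreeSemigroup.of z) c * single w 1 := by simp
    rw [this, map_mul]
    refine mul_mem_supported (hz c) (hw 1) fun v hv w' hw' => ?_
    simp only [Set.mem_ofPred_eq, letters_mul, List.map_append] at hv hw' ⊢
    rw [hv, hw']

/-- The number of repetitions of letters in a word. -/
def defect (w : FreeSemigroup ℕ) : ℕ := (letters w).length - (letters w).toFinset.card

/-- Exactly one occurrence of `x` becomes the new letter `y`, and as `k ≥ 2` another occurrence of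
`x` survives. The length stays the same while the number of distinct letters grows by one. -/
lemma defect_lt_of_mem_linearize {x y k : ℕ} {f : FreeAlg F} (hy : y ∉ vars f) (hxy : x ≠ y)
    (hk : ∀ w ∈ monomials f, (letters w).count x = k) (hk2 : 2 ≤ k) {v : FreeSemigroup ℕ}
    (hv : v ∈ monomials (linearize x y f)) : ∃ w ∈ monomials f, defect v < defect w := by
  obtain ⟨hv, hvy⟩ := mem_monomials_component.1 hv
  have : eval (Function.update X x (X x + X y)) f ∈ supported F {v | ∃ w ∈ monomials f,
      (letters v).map (fun z => if z = y then x else z) = letters w} := by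
    rw [eq_sum_single f, map_sum]
    refine Submodule.sum_mem _ fun w hw => ?_
    intro v hv
    refine eval_add_single_mem_supported x y w _ v fun h => hv ⟨w, ?_, ?_⟩
    · rwa [← eq_sum_single f]
    · rw [h]
      refine (List.map_congr_left fun z hz => if_neg ?_).trans (List.map_id _)
      rintro rfl
      exact hy (mem_vars.2 ⟨w, hw, hz⟩)
  obtain ⟨w, hw, hvw⟩ := mem_supported.1 this v hv
  refine ⟨w, hw, ?_⟩
  have hcount : ∀ l : List ℕ, (l.map fun z => if z = y then x else z).count x =
      l.count x + l.count y := by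
    intro l
    induction l with
    | nil => simp
    | cons a l ih =>
      simp only [List.map_cons, List.count_cons, ih, beq_iff_eq]
      split_ifs <;> omega
  have hx : x ∈ letters v := by
    have := hcount (letters v)
    rw [hvw, hk w hw, hvy] at this
    exact List.count_pos_iff.1 (by omega)
  have hyw : y ∉ (letters w).toFinset := fun h => hy (mem_vars.2 ⟨w, hw, List.mem_toFinset.1 h⟩)
  have hset : (letters v).toFinset = insert y (letters w).toFinset := by
    ext a
    rw [Finset.mem_insert, List.mem_toFinset, List.mem_toFinset, ← hvw, List.mem_map]
    constructor
    · intro ha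
      by_cases hay : a = y
      · exact Or.inl hay
      · exact Or.inr ⟨a, ha, if_neg hay⟩
    · rintro (rfl | ⟨b, hb, rfl⟩)
      · exact List.count_pos_iff.1 (by omega)
      · split_ifs
        · exact hx
        · exact hb
  have hcard : (letters v).toFinset.card = (letters w).toFinset.card + 1 := by
    rw [hset, Finset.card_insert_of_notMem hyw]
  have hlen : (letters v).length = (letters w).length := by rw [← hvw, List.length_map]
  have := List.toFinset_card_le (letters v)
  unfold defect
  omega

/-- A polynomial is the sum of its components, which stay in `J`; if all of them were in `Γ`, so
would be their sum. -/
lemma exists_homogeneous_in {Γ J : Submodule F (FreeAlg F)} (hJ : IsTIdeal J) {f : FreeAlg F}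
    (hf : f ∈ J) (hfΓ : f ∉ Γ) (S : Finset ℕ) :
    ∃ g ∈ J, g ∉ Γ ∧ monomials g ⊆ monomials f ∧
      ∀ x ∈ S, ∃ k, ∀ w ∈ monomials g, (letters w).count x = k := by
  induction S using Finset.induction_on with
  | empty => exact ⟨f, hf, hfΓ, subset_rfl, by simp⟩
  | insert x S hxS ih =>
    obtain ⟨g, hg, hgΓ, hsub, hS⟩ := ih
    obtain ⟨N, -, hN⟩ := exists_scale_eq_sum x g 0
    have hsum := hN 1
    have h1 : scale x 1 g = g := by
      ext w
      rw [coeff_scale, one_pow, one_mul]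
    rw [h1] at hsum
    obtain ⟨k, hk⟩ : ∃ k, component x k g ∉ Γ := by
      by_contra! hall
      apply hgΓ
      rw [hsum]
      exact Submodule.sum_mem _ fun k _ => Submodule.smul_mem _ _ (hall k)
    refine ⟨component x k g, component_mem hJ hg x k, hk,
      fun w hw => hsub (mem_monomials_component.1 hw).1, fun y hy => ?_⟩
    rcases Finset.mem_insert.1 hy with rfl | hy
    · exact ⟨k, fun w hw => (mem_monomials_component.1 hw).2⟩
    · obtain ⟨j, hj⟩ := hS y hy
      exact ⟨j, fun w hw => hj w (mem_monomials_component.1 hw).1⟩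

/-- In characteristic zero, a polynomial outside a `T`-ideal has a multilinear consequence outside
it. -/
theorem exists_multilinear_notMem [CharZero F] {Γ J : Submodule F (FreeAlg F)} (hΓ : IsTIdeal Γ)
    (hJ : IsTIdeal J) {f : FreeAlg F} (hf : f ∈ J) (hfΓ : f ∉ Γ) :
    ∃ g ∈ J, IsMultilinear g ∧ g ∉ Γ := by
  obtain ⟨N, hN⟩ : ∃ N, ∀ w ∈ monomials f, defect w ≤ N :=
    ⟨(monomials f).sup defect, fun w hw => Finset.le_sup hw⟩
  induction N using Nat.strong_induction_on generalizing f with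
  | _ N ih =>
    obtain ⟨g, hg, hgΓ, hsub, hS⟩ := exists_homogeneous_in hJ hf hfΓ (vars f)
    by_cases hmult : IsMultilinear g
    · exact ⟨g, hg, hmult, hgΓ⟩
    have : ∃ w ∈ monomials g, ∃ x ∈ vars g, (letters w).count x ≠ 1 := by
      by_contra! h
      exact hmult h
    obtain ⟨w, hw, x, hx, hne⟩ := this
    obtain ⟨w', hw', hxw'⟩ := mem_vars.1 hx
    obtain ⟨k, hk⟩ := hS x (mem_vars.2 ⟨w', hsub hw', hxw'⟩)
    have hk2 : 2 ≤ k := by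
      have h1 := hk w' hw'
      have h2 := List.count_pos_iff.2 hxw'
      have h3 := hk w hw
      omega
    obtain ⟨y, hy⟩ := Infinite.exists_notMem_finset (vars g)
    have hxy : x ≠ y := ne_of_mem_of_not_mem hx hy
    have hd : ∀ v ∈ monomials (linearize x y g), ∃ w ∈ monomials g, defect v < defect w :=
      fun v hv => defect_lt_of_mem_linearize hy hxy hk hk2 hv
    -- Without repetitions the linearization would have no monomials, so Euler's identity would give
    -- `k • g = 0`, contradicting `g ∉ Γ`.
    have hpos : 0 < N := by
      by_contra hN0
      have hl : linearize x y g ≠ 0 := by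
        intro h0
        have := eval_linearize hy hxy hk
        rw [h0, map_zero, ← Nat.cast_smul_eq_nsmul F] at this
        refine hgΓ ?_
        rw [(smul_eq_zero.1 this.symm).resolve_left (by norm_cast; omega)]
        exact Γ.zero_mem
      obtain ⟨v, hv⟩ : (monomials (linearize x y g)).Nonempty := by
        rw [monomials, Finsupp.support_nonempty_iff]
        simpa using hl
      obtain ⟨w, hw, hlt⟩ := hd v hv
      have := hN w (hsub hw)
      omega
    -- The linearization is outside `Γ`, since identifying `y` with `x` gives back `k • g` with `k ≠
    -- 0`.
    refine ih (N - 1) (by omega) (linearize_mem hJ hg x y) (fun hmem => hgΓ ?_) fun v hv => ?_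
    · have := hΓ.map_mem (eval (Function.update X y (X x))) _ hmem
      rw [eval_linearize hy hxy hk, ← Nat.cast_smul_eq_nsmul F] at this
      exact (Submodule.smul_mem_iff _ (by norm_cast; omega)).1 this
    · obtain ⟨w, hw, hlt⟩ := hd v hv
      have := hN w (hsub hw)
      omega

end Linearization

end PIAlg

namespace PIAlg

open MonoidAlgebra

/-! ### Alternating polynomials and alternation within blocks -/

section Alternation

variable {F : Type u} [Field F] {A : Type v} [NonUnitalRing A] [Module F A]
  [IsScalarTower F A A] [SMulCommClass F A A]

/-- The terms of `σ` and `τ * σ`, for `τ` the transposition of `x` and `y`, have equal values and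
opposite signs. -/
lemma IsAlternatingOn.eval_eq_zero {S : Finset ℕ} {f : FreeAlg F} (hf : IsAlternatingOn S f)
    {e : ℕ → A} {x y : ℕ} (hx : x ∈ S) (hy : y ∈ S) (hxy : x ≠ y) (h : e x = e y) :
    eval e f = 0 := by
  obtain ⟨-, g, -, hg⟩ := hf
  rw [hg, map_sum]
  set τ : Equiv.Perm {x // x ∈ S} := Equiv.swap ⟨x, hx⟩ ⟨y, hy⟩ with hτ
  have hne : (⟨x, hx⟩ : {x // x ∈ S}) ≠ ⟨y, hy⟩ := fun h => hxy (congrArg Subtype.val h)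
  have heτ : ∀ z, e (Equiv.Perm.ofSubtype τ z) = e z := by
    intro z
    rw [hτ, Equiv.Perm.ofSubtype_swap_eq]
    rcases Equiv.swap_apply_eq_iff.1 (rfl : Equiv.swap x y z = _) with -
    by_cases hzx : z = x
    · rw [hzx, Equiv.swap_apply_left, h]
    · by_cases hzy : z = y
      · rw [hzy, Equiv.swap_apply_right, h]
      · rw [Equiv.swap_apply_of_ne_of_ne hzx hzy]
  refine Finset.sum_involution (fun σ _ => τ * σ) ?_ ?_ ?_ ?_
  · intro σ _
    simp only [map_smul, eval_eval, eval_X, map_mul, Equiv.Perm.coe_mul, Function.comp_apply, heτ]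
    rw [hτ, Equiv.Perm.sign_swap hne]
    simp
  · intro σ _ _ h
    have : τ = 1 := by simpa using h
    exact hne (Equiv.swap_eq_one_iff.1 this)
  · simp
  · intro σ _
    simp [hτ, ← mul_assoc]

/-- Since transpositions generate the symmetric group, each `σ` multiplies `f` by its sign. Thus `f`
is the alternating sum of `f / |S|!`, where characteristic zero is needed. -/
lemma isAlternatingOn_of_swap [CharZero F] {S : Finset ℕ} {f : FreeAlg F}
    (hf : IsMultilinearOn S f) (h : ∀ x ∈ S, ∀ y ∈ S, x ≠ y →
      eval (fun z => X (Equiv.swap x y z)) f = -f) : IsAlternatingOn S f := by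
  have key : ∀ σ : Equiv.Perm {x // x ∈ S},
      eval (fun z => X (Equiv.Perm.ofSubtype σ z)) f = ((Equiv.Perm.sign σ : ℤ) : F) • f := by
    intro σ
    induction σ using Equiv.Perm.swap_induction_on with
    | one => simp [eval_X_self]
    | swap_mul σ x y hxy ih =>
      have : eval (fun z => (X (Equiv.Perm.ofSubtype (Equiv.swap x y * σ) z) : FreeAlg F)) f =
          eval (fun z => X (Equiv.swap (x : ℕ) y z))
            (eval (fun z => (X (Equiv.Perm.ofSubtype σ z) : FreeAlg F)) f) := by
        rw [eval_eval]
        simp [eval_X, Equiv.Perm.ofSubtype_swap_eq]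
      rw [this, ih, map_smul, h x x.2 y y.2 fun h => hxy (Subtype.ext h), Equiv.Perm.sign_mul,
        Equiv.Perm.sign_swap hxy]
      simp
  refine ⟨hf, ((Fintype.card (Equiv.Perm {x // x ∈ S}) : F)⁻¹) • f, ?_, ?_⟩
  · intro w hw
    refine hf w ?_
    rw [mem_monomials] at hw ⊢
    intro h0
    simp [h0] at hw
  · have hone : ∀ σ : Equiv.Perm {x // x ∈ S},
        ((Equiv.Perm.sign σ : ℤ) : F) * ((Equiv.Perm.sign σ : ℤ) : F) = 1 := by
      intro σ
      rw [← Int.cast_mul, ← Units.val_mul, Int.units_mul_self]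
      simp
    simp only [map_smul, key]
    rw [Finset.sum_congr rfl fun σ _ => by
      rw [smul_comm, smul_smul, smul_smul, mul_assoc, hone, mul_one], Finset.sum_const, Finset.card_univ]
    rw [← Nat.cast_smul_eq_nsmul F, smul_smul, mul_inv_cancel₀, one_smul]
    exact Nat.cast_ne_zero.2 Fintype.card_ne_zero

lemma eval_single_one_mem_multihomogeneous (θ : ℕ → FreeSemigroup ℕ) {μ : Multiset ℕ}
    {f : FreeAlg F} (hf : f ∈ multihomogeneous F μ) :
    eval (fun x => (single (θ x) 1 : FreeAlg F)) f ∈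
      multihomogeneous F (μ.bind fun x => (letters (θ x) : Multiset ℕ)) := by
  have key : ∀ w : FreeSemigroup ℕ, (letters (FreeSemigroup.lift θ w) : Multiset ℕ) =
      (letters w : Multiset ℕ).bind fun x => (letters (θ x) : Multiset ℕ) := by
    intro w
    induction w using FreeSemigroup.recOnMul with
    | ih1 x => simp [letters_of]
    | ih2 x y hx hy =>
      rw [map_mul, letters_mul, letters_mul, ← Multiset.coe_add, ← Multiset.coe_add,
        Multiset.add_bind, hx, hy]
  have hlift : ∀ w : FreeSemigroup ℕ, FreeSemigroup.lift (fun x => (single (θ x) 1 : FreeAlg F)) w =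
      single (FreeSemigroup.lift θ w) 1 := by
    intro w
    induction w using FreeSemigroup.recOnMul with
    | ih1 x => simp
    | ih2 x y hx hy => rw [map_mul, map_mul, hx, hy, single_mul_single, one_mul]
  rw [eq_sum_single f, map_sum]
  refine Submodule.sum_mem _ fun w hw => ?_
  rw [eval_single, hlift]
  refine Submodule.smul_mem _ _ (single_mem_multihomogeneous _ ?_)
  rw [key, mem_multihomogeneous.1 hf w hw]

lemma rename_mem_multihomogeneous {V : Finset ℕ} (τ : Equiv.Perm ℕ) (hτ : ∀ x ∈ V, τ x ∈ V)
    {f : FreeAlg F} (hf : f ∈ multihomogeneous F V.val) :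
    eval (fun x => (X (τ x) : FreeAlg F)) f ∈ multihomogeneous F V.val := by
  have := eval_single_one_mem_multihomogeneous (fun x => FreeSemigroup.of (τ x)) hf
  change eval (fun x => (single (FreeSemigroup.of (τ x)) 1 : FreeAlg F)) f ∈ _
  convert this using 2
  have hV : V.map τ.toEmbedding = V := by
    refine Finset.eq_of_subset_of_card_le ?_ (by simp)
    intro x hx
    obtain ⟨y, hy, rfl⟩ := Finset.mem_map.1 hx
    exact hτ y hy
  conv_lhs => rw [← hV]
  rw [Finset.map_val]
  simp only [letters_of]
  exact (Multiset.bind_singleton V.val τ).symm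

variable {Pos T : Type*} [Fintype Pos] [DecidableEq Pos] [DecidableEq T]

/-- The permutations that preserve the fibres of `blk`. -/
def blockPerms (blk : Pos → T) : Finset (Equiv.Perm Pos) :=
  Finset.univ.filter fun σ => ∀ a, blk (σ a) = blk a

lemma mem_blockPerms {blk : Pos → T} {σ : Equiv.Perm Pos} :
    σ ∈ blockPerms blk ↔ ∀ a, blk (σ a) = blk a := by simp [blockPerms]

/-- The alternating sum of `f` over all permutations, within each block, of the variables at given
positions. -/
noncomputable def alternator (blk : Pos → T) (p : Pos ↪ ℕ) (f : FreeAlg F) : FreeAlg F :=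
  ∑ σ ∈ blockPerms blk,
    ((Equiv.Perm.sign σ : ℤ) : F) • eval (fun x => X (σ.viaFintypeEmbedding p x)) f

lemma eval_alternator (blk : Pos → T) (p : Pos ↪ ℕ) (f : FreeAlg F) (e : ℕ → A) :
    eval e (alternator blk p f) = ∑ σ ∈ blockPerms blk,
      ((Equiv.Perm.sign σ : ℤ) : F) • eval (fun x => e (σ.viaFintypeEmbedding p x)) f := by
  simp [alternator, eval_eval, eval_X]

lemma alternator_mem {blk : Pos → T} {p : Pos ↪ ℕ} {f : FreeAlg F} {I : Submodule F (FreeAlg F)}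
    (hI : IsTIdeal I) (hf : f ∈ I) : alternator blk p f ∈ I :=
  Submodule.sum_mem _ fun _ _ => Submodule.smul_mem _ _ (hI.map_mem _ _ hf)

lemma alternator_mem_multihomogeneous {blk : Pos → T} {p : Pos ↪ ℕ} {f : FreeAlg F}
    {V : Finset ℕ} (hf : f ∈ multihomogeneous F V.val) (hp : ∀ a, p a ∈ V) :
    alternator blk p f ∈ multihomogeneous F V.val := by
  refine Submodule.sum_mem _ fun σ _ => Submodule.smul_mem _ _
    (rename_mem_multihomogeneous _ (fun x hx => ?_) hf)
  by_cases h : x ∈ Set.range p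
  · obtain ⟨a, rfl⟩ := h
    rw [Equiv.Perm.viaFintypeEmbedding_apply_image]
    exact hp _
  · rwa [Equiv.Perm.viaFintypeEmbedding_apply_notMem_range _ _ h]

lemma viaFintypeEmbedding_swap_mul (p : Pos ↪ ℕ) (a b : Pos) (σ : Equiv.Perm Pos) (x : ℕ) :
    (Equiv.swap a b * σ).viaFintypeEmbedding p x =
      Equiv.swap (p a) (p b) (σ.viaFintypeEmbedding p x) := by
  by_cases h : x ∈ Set.range p
  · obtain ⟨c, rfl⟩ := h
    rw [Equiv.Perm.viaFintypeEmbedding_apply_image, Equiv.Perm.viaFintypeEmbedding_apply_image,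
      Equiv.Perm.mul_apply, p.injective.map_swap]
  · rw [Equiv.Perm.viaFintypeEmbedding_apply_notMem_range _ _ h,
      Equiv.Perm.viaFintypeEmbedding_apply_notMem_range _ _ h, Equiv.swap_apply_of_ne_of_ne]
    · rintro rfl
      exact h ⟨a, rfl⟩
    · rintro rfl
      exact h ⟨b, rfl⟩

/-- Left multiplication by the transposition permutes `blockPerms blk`, because both positions lie
in one block, and it reverses the signs. -/
lemma eval_swap_alternator (blk : Pos → T) (p : Pos ↪ ℕ) (f : FreeAlg F) {a b : Pos} (hab : a ≠ b)
    (h : blk a = blk b) :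
    eval (fun x => X (Equiv.swap (p a) (p b) x)) (alternator blk p f) = -alternator blk p f := by
  rw [eval_alternator, alternator, ← Finset.sum_neg_distrib]
  refine Finset.sum_equiv (Equiv.mulLeft (Equiv.swap a b)) (fun σ => ?_) fun σ _ => ?_
  · rw [mem_blockPerms, mem_blockPerms]
    have : ∀ c, blk (Equiv.swap a b c) = blk c := by
      intro c
      by_cases hca : c = a
      · rw [hca, Equiv.swap_apply_left, h]
      · by_cases hcb : c = b
        · rw [hcb, Equiv.swap_apply_right, h]
        · rw [Equiv.swap_apply_of_ne_of_ne hca hcb]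
    simp [this]
  · simp only [Equiv.coe_mulLeft, viaFintypeEmbedding_swap_mul, Equiv.Perm.sign_mul,
      Equiv.Perm.sign_swap hab]
    simp

lemma isAlternatingOn_alternator [CharZero F] {blk : Pos → T} {p : Pos ↪ ℕ} {f : FreeAlg F}
    {V : Finset ℕ} (hf : f ∈ multihomogeneous F V.val) (hp : ∀ a, p a ∈ V) (t : T) :
    IsAlternatingOn ((Finset.univ.filter fun a => blk a = t).map p) (alternator blk p f) := by
  refine isAlternatingOn_of_swap (isMultilinearOn_of_mem V.nodup
    (alternator_mem_multihomogeneous hf hp) ?_) ?_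
  · intro x hx
    obtain ⟨a, -, rfl⟩ := Finset.mem_map.1 hx
    exact hp a
  · intro x hx y hy hxy
    obtain ⟨a, ha, rfl⟩ := Finset.mem_map.1 hx
    obtain ⟨b, hb, rfl⟩ := Finset.mem_map.1 hy
    rw [Finset.mem_filter] at ha hb
    exact eval_swap_alternator blk p f (fun h => hxy (by rw [h])) (ha.2.trans hb.2.symm)

end Alternation

/-! ### Nilpotent ideals and the counting argument -/

section Counting

variable {F : Type u} [Field F] {A : Type v} [NonUnitalRing A] [Module F A]
  [IsScalarTower F A A] [SMulCommClass F A A]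

/-- `I` is an ideal of the subalgebra `P` all of whose products of length `m` vanish. -/
structure IsNilpotentIdeal (P : NonUnitalSubalgebra F A) (I : Submodule F A) (m : ℕ) : Prop where
  le : ∀ a ∈ I, a ∈ P
  mul_left : ∀ b ∈ P, ∀ a ∈ I, b * a ∈ I
  mul_right : ∀ b ∈ P, ∀ a ∈ I, a * b ∈ I
  prod_eq_zero : ∀ l : List A, l.length = m → (∀ a ∈ l, a ∈ I) →
    (l.map (Unitization.inr : A → Unitization F A)).prod = 0

-- Factors outside `I` are absorbed into the next factor from `I` on their right, and what follows
-- the `k`-th such factor goes into `u`. The unitization accommodates an empty remainder.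
open Classical in
lemma IsNilpotentIdeal.exists_prod_eq {P : NonUnitalSubalgebra F A} {I : Submodule F A} {m : ℕ}
    (h : IsNilpotentIdeal P I m) (k : ℕ) (l : List A) (hl : ∀ a ∈ l, a ∈ P)
    (hk : k ≤ l.countP fun a => a ∈ I) :
    ∃ (l' : List A) (u : Unitization F A), l'.length = k ∧ (∀ a ∈ l', a ∈ I) ∧
      (l.map (Unitization.inr : A → Unitization F A)).prod =
        (l'.map (Unitization.inr : A → Unitization F A)).prod * u := by
  induction l generalizing k with
  | nil =>
    simp only [List.countP_nil, Nat.le_zero] at hk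
    exact ⟨[], 1, by simp [hk]⟩
  | cons a l ih =>
    have hl' : ∀ b ∈ l, b ∈ P := fun b hb => hl b (List.mem_cons_of_mem _ hb)
    cases k with
    | zero => exact ⟨[], _, rfl, by simp, by simp; rfl⟩
    | succ k =>
      rw [List.countP_cons] at hk
      by_cases ha : a ∈ I
      · obtain ⟨l', u, h₁, h₂, h₃⟩ := ih k hl' (by simpa [ha] using hk)
        refine ⟨a :: l', u, by simp [h₁], ?_, by simp [h₃, mul_assoc]⟩
        simpa [ha] using h₂
      · obtain ⟨l', u, h₁, h₂, h₃⟩ := ih (k + 1) hl' (by simpa [ha] using hk)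
        cases l' with
        | nil => simp at h₁
        | cons b l' =>
          refine ⟨(a * b) :: l', u, by simpa using h₁, ?_, by simp [h₃, mul_assoc]⟩
          intro c hc
          rcases List.mem_cons.1 hc with rfl | hc
          · exact h.mul_left a (hl a (by simp)) b (h₂ b (by simp))
          · exact h₂ c (by simp [hc])

/-- A polynomial that is multilinear vanishes if sufficiently many of its variables take values
in a nilpotent ideal. -/
lemma IsNilpotentIdeal.eval_eq_zero {P : NonUnitalSubalgebra F A} {I : Submodule F A} {m : ℕ}
    (h : IsNilpotentIdeal P I m) {f : FreeAlg F} (hf : IsMultilinear f) {e : ℕ → A}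
    (he : ∀ x ∈ vars f, e x ∈ P) {R : Finset ℕ} (hR : R ⊆ vars f) (hm : m ≤ R.card)
    (hRI : ∀ x ∈ R, e x ∈ I) : eval e f = 0 := by
  classical
  apply Unitization.inr_injective (R := F)
  rw [inr_eval, Unitization.inr_zero]
  refine Finset.sum_eq_zero fun w hw => ?_
  have hwl : ∀ x ∈ letters w, x ∈ vars f := fun x hx => mem_vars.2 ⟨w, hw, hx⟩
  have hcount : m ≤ ((letters w).map e).countP fun a => a ∈ I := by
    rw [List.countP_map, List.countP_eq_length_filter]
    refine hm.trans (le_trans (Finset.card_le_card fun x hx => ?_) (List.toFinset_card_le _))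
    rw [List.mem_toFinset, List.mem_filter]
    refine ⟨?_, by simpa using hRI x hx⟩
    exact List.count_pos_iff.1 (by rw [hf w hw x (hR hx)]; exact one_pos)
  obtain ⟨l', u, h₁, h₂, h₃⟩ := h.exists_prod_eq m ((letters w).map e) (by
    intro a ha
    obtain ⟨x, hx, rfl⟩ := List.mem_map.1 ha
    exact he x (hwl x hx)) hcount
  rw [List.map_map, h.prod_eq_zero l' h₁ h₂, zero_mul] at h₃
  rw [wordVal]
  erw [h₃]
  rw [smul_zero]

/-- A polynomial with sufficiently many alternating sets that are larger than a semisimple part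
vanishes. -/
lemma IsNilpotentIdeal.eval_eq_zero_of_alternating {P : NonUnitalSubalgebra F A}
    {I : Submodule F A} {m : ℕ} (h : IsNilpotentIdeal P I m) {C : Finset A}
    (hP : P.toSubmodule ≤ Submodule.span F (C : Set A) ⊔ I) (hCP : ∀ a ∈ C, a ∈ P)
    {f : FreeAlg F} (hf : IsMultilinear f) {T : Type*} [Fintype T] (hm : m ≤ Fintype.card T)
    {S : T → Finset ℕ} (hdisj : Pairwise fun i j => Disjoint (S i) (S j))
    (hcard : ∀ t, C.card < (S t).card) (halt : ∀ t, IsAlternatingOn (S t) f) {e : ℕ → A}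
    (he : ∀ x, e x ∈ P) : eval e f = 0 := by
  classical
  by_contra hne
  have hspan : ∀ x, e x ∈ Submodule.span F ((C : Set A) ∪ I) := by
    intro x
    rw [Submodule.span_union, Submodule.span_eq]
    exact hP (he x)
  obtain ⟨e', he', -, hne'⟩ := hf.exists_eval_ne_zero hspan hne
  have hf0 : (monomials f).Nonempty := by
    rw [Finset.nonempty_iff_ne_empty]
    intro h0
    rw [eq_sum_single f, h0, Finset.sum_empty, map_zero] at hne'
    exact hne' rfl
  obtain ⟨w, hw⟩ := hf0
  have hS : ∀ t, ∀ x ∈ S t, x ∈ vars f := fun t x hx => mem_vars.2 ⟨w, hw,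
    List.count_pos_iff.1 (by rw [(halt t).1 w hw x hx]; exact one_pos)⟩
  -- Otherwise the values on `S t` all lie in `C`, which is smaller than `S t`, and two of them
  -- coincide.
  have hex : ∀ t, ∃ x ∈ S t, e' x ∈ I := by
    intro t
    by_contra! hall
    have hmaps : ∀ x ∈ S t, e' x ∈ C := fun x hx =>
      (he' x (hS t x hx)).resolve_right (hall x hx)
    obtain ⟨x, hx, y, hy, hxy, hexy⟩ :=
      Finset.exists_ne_map_eq_of_card_lt_of_maps_to (hcard t) hmaps
    exact hne' ((halt t).eval_eq_zero hx hy hxy hexy)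
  choose x hxS hxI using hex
  -- Disjointness of the alternating sets makes the chosen variables distinct, so at least `m`
  -- variables have values in `I`.
  have hinj : Function.Injective x := by
    intro s t hst
    by_contra hne
    exact Finset.disjoint_left.1 (hdisj hne) (hxS s) (hst ▸ hxS t)
  refine hne' (h.eval_eq_zero hf (fun y hy => ?_) (R := Finset.univ.image x) ?_ ?_ ?_)
  · rcases he' y hy with hy | hy
    · exact hCP _ hy
    · exact h.le _ hy
  · intro y hy
    obtain ⟨t, -, rfl⟩ := Finset.mem_image.1 hy
    exact hS t _ (hxS t)
  · rwa [Finset.card_image_of_injective _ hinj, Finset.card_univ]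
  · intro y hy
    obtain ⟨t, -, rfl⟩ := Finset.mem_image.1 hy
    exact hxI t

end Counting

end PIAlg

namespace PIAlg

/-! ### The radical of a nonunital finite-dimensional algebra -/

section Radical

variable {F : Type u} [Field F] {A : Type v} [NonUnitalRing A] [Module F A]
  [IsScalarTower F A A] [SMulCommClass F A A]

lemma mem_radical {a : A} :
    a ∈ radical F A ↔ (Unitization.inr a : Unitization F A) ∈ Ring.jacobson (Unitization F A) :=
  Iff.rfl

lemma unitization_mul_inr (x : Unitization F A) (a : A) :
    x * Unitization.inr a = Unitization.inr (x.fst • a + x.snd * a) := by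
  conv_lhs => rw [← Unitization.inl_fst_add_inr_snd_eq x]
  rw [add_mul, Unitization.inl_mul_inr, ← Unitization.inr_mul, ← Unitization.inr_add]

lemma unitization_inr_mul (x : Unitization F A) (a : A) :
    Unitization.inr a * x = Unitization.inr (x.fst • a + a * x.snd) := by
  conv_lhs => rw [← Unitization.inl_fst_add_inr_snd_eq x]
  rw [mul_add, Unitization.inr_mul_inl, ← Unitization.inr_mul, ← Unitization.inr_add]

lemma mul_mem_radical (b : A) {a : A} (ha : a ∈ radical F A) : b * a ∈ radical F A := by
  rw [mem_radical, Unitization.inr_mul]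
  exact Ideal.mul_mem_left _ _ ha

lemma radical_mul_mem (b : A) {a : A} (ha : a ∈ radical F A) : a * b ∈ radical F A := by
  rw [mem_radical, Unitization.inr_mul]
  exact Ideal.mul_mem_right _ _ ha

instance [FiniteDimensional F A] : FiniteDimensional F (Unitization F A) :=
  Module.Finite.equiv (Unitization.linearEquiv F F A).symm

lemma exists_jacobson_pow_eq_bot [FiniteDimensional F A] :
    ∃ n, Ring.jacobson (Unitization F A) ^ n = ⊥ := by
  have := IsArtinianRing.of_finite F (Unitization F A)
  exact IsSemiprimaryRing.isNilpotent (R := Unitization F A)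

lemma isNilpotent_of_mem_jacobson [FiniteDimensional F A] {x : Unitization F A}
    (hx : x ∈ Ring.jacobson (Unitization F A)) : IsNilpotent x := by
  obtain ⟨n, hn⟩ := exists_jacobson_pow_eq_bot (F := F) (A := A)
  exact ⟨n, by simpa [hn] using Ideal.pow_mem_pow hx n⟩

/-- An element of the radical is nilpotent, and so is its image in `F` under the augmentation; that
image is therefore zero. -/
lemma exists_eq_inr_of_mem_jacobson [FiniteDimensional F A] {x : Unitization F A}
    (hx : x ∈ Ring.jacobson (Unitization F A)) : ∃ a ∈ radical F A, Unitization.inr a = x := by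
  have h : IsNilpotent (Unitization.fstHom F A x) := (isNilpotent_of_mem_jacobson hx).map _
  have h0 : x.fst = 0 := h.eq_zero
  have : Unitization.inr x.snd = x := by
    conv_rhs => rw [← Unitization.inl_fst_add_inr_snd_eq x, h0]
    simp
  exact ⟨x.snd, by rwa [mem_radical, this], this⟩

lemma list_prod_mem_jacobson_pow (l : List A) (h : ∀ a ∈ l, a ∈ radical F A) :
    (l.map (Unitization.inr : A → Unitization F A)).prod ∈
      Ring.jacobson (Unitization F A) ^ l.length := by
  induction l with
  | nil => simp [Submodule.pow_zero, Ideal.one_eq_top]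
  | cons a l ih =>
    rw [List.map_cons, List.prod_cons, List.length_cons, Ideal.IsTwoSided.pow_succ]
    exact Ideal.mul_mem_mul (h a (by simp)) (ih fun b hb => h b (by simp [hb]))

variable (F A) in
lemma isNilpotentIdeal_radical [FiniteDimensional F A] :
    IsNilpotentIdeal (⊤ : NonUnitalSubalgebra F A) (radical F A) (nilpotencyIndex F A) where
  le := by simp
  mul_left b _ _ ha := mul_mem_radical b ha
  mul_right b _ _ ha := radical_mul_mem b ha
  prod_eq_zero := by
    obtain ⟨n, hn⟩ := exists_jacobson_pow_eq_bot (F := F) (A := A)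
    refine Nat.sInf_mem (s := {n | ∀ l : List A, l.length = n → (∀ a ∈ l, a ∈ radical F A) →
        (l.map (Unitization.inr : A → Unitization F A)).prod = 0}) ⟨n, fun l hl hr => ?_⟩
    have := list_prod_mem_jacobson_pow l hr
    rwa [hl, hn] at this

lemma one_le_nilpotencyIndex [FiniteDimensional F A] : 1 ≤ nilpotencyIndex F A := by
  by_contra h
  have h0 : nilpotencyIndex F A = 0 := by omega
  have := (isNilpotentIdeal_radical F A).prod_eq_zero [] (by simp [h0]) (by simp)
  simp at this

/-- For `a ∈ I`, every multiple `y * a` by an element of the unitization is again a nilpotent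
element of `I`, so `y * a + 1` is invertible. -/
lemma IsNilpotentIdeal.le_radical {I : Submodule F A} {m : ℕ}
    (h : IsNilpotentIdeal (⊤ : NonUnitalSubalgebra F A) I m) : I ≤ radical F A := by
  intro a ha
  rw [mem_radical, ← Ideal.jacobson_bot, Ideal.mem_jacobson_iff]
  intro y
  have hya : ∃ b ∈ I, y * Unitization.inr a = Unitization.inr b := by
    rw [unitization_mul_inr]
    exact ⟨_, I.add_mem (I.smul_mem _ ha) (h.mul_left _ trivial a ha), rfl⟩
  obtain ⟨b, hb, hyb⟩ := hya
  have hnil : IsNilpotent (Unitization.inr b : Unitization F A) := by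
    refine ⟨m, ?_⟩
    have := h.prod_eq_zero (List.replicate m b) (by simp) fun c hc => by
      rwa [List.eq_of_mem_replicate hc]
    simpa using this
  obtain ⟨z, hz⟩ := hnil.isUnit_add_one.exists_left_inv
  refine ⟨z, ?_⟩
  rw [Ideal.mem_bot, mul_assoc, hyb, ← hz]
  noncomm_ring

/-- An algebra spanned by `d` elements and a nilpotent ideal `I` has semisimple dimension at most
`d`, with equality only if `I` is the radical. -/
lemma IsNilpotentIdeal.semisimpleDim_le [FiniteDimensional F A] {I : Submodule F A} {m : ℕ}
    (h : IsNilpotentIdeal (⊤ : NonUnitalSubalgebra F A) I m) {C : Finset A}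
    (hC : (⊤ : Submodule F A) ≤ Submodule.span F (C : Set A) ⊔ I) :
    semisimpleDim F A ≤ C.card ∧ (semisimpleDim F A = C.card → nilpotencyIndex F A ≤ m) := by
  have h₁ := h.le_radical
  have h₂ : Module.finrank F (Submodule.span F (C : Set A)) ≤ C.card :=
    finrank_span_finset_le_card C
  have h₃ : Module.finrank F A ≤
      Module.finrank F (Submodule.span F (C : Set A)) + Module.finrank F I := by
    rw [← finrank_top F A]
    exact (Submodule.finrank_mono hC).trans (Submodule.finrank_add_le_finrank_add_finrank _ _)
  have h₄ := Submodule.finrank_quotient_add_finrank (radical F A)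
  have h₅ := Submodule.finrank_mono h₁
  unfold semisimpleDim
  refine ⟨by omega, fun heq => ?_⟩
  -- From `dim A ≤ |C| + dim I` and `dim I ≤ dim J`, equality `dim A - dim J = |C|` forces `dim I =
  -- dim J`.
  have : I = radical F A := Submodule.eq_of_le_of_finrank_eq h₁ (by omega)
  subst this
  exact Nat.sInf_le h.prod_eq_zero

end Radical

/-! ### Reduction modulo the radical and lifting of matrix units -/

section Reduction

/-- The standard matrix units in a product of matrix algebras. -/
def stdUnit (F : Type u) [Field F] {r : ℕ} (d : Fin r → ℕ) (j : Fin r) (a b : Fin (d j)) :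
    Π i, Matrix (Fin (d i)) (Fin (d i)) F :=
  Pi.single j (Matrix.single a b 1)

variable {F : Type u} [Field F] {A : Type v} [NonUnitalRing A] [Module F A]
  [IsScalarTower F A A] [SMulCommClass F A A] {r : ℕ} {d : Fin r → ℕ}

lemma stdUnit_mul_same (j : Fin r) (a b c : Fin (d j)) :
    stdUnit F d j a b * stdUnit F d j b c = stdUnit F d j a c := by
  simp [stdUnit, ← Pi.single_mul]

lemma stdUnit_mul_ne (j : Fin r) (a : Fin (d j)) {b c : Fin (d j)} (h : b ≠ c) (e : Fin (d j)) :
    stdUnit F d j a b * stdUnit F d j c e = 0 := by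
  simp [stdUnit, ← Pi.single_mul, h]

lemma stdUnit_mul_orth {i j : Fin r} (h : i ≠ j) (a b : Fin (d i)) (c e : Fin (d j)) :
    stdUnit F d i a b * stdUnit F d j c e = 0 := by
  ext l : 1
  by_cases hl : l = i
  · subst hl
    simp [stdUnit, Pi.single_eq_of_ne h]
  · simp [stdUnit, Pi.single_eq_of_ne hl]

lemma stdUnit_ne_zero (j : Fin r) (a b : Fin (d j)) : stdUnit F d j a b ≠ 0 := by
  intro h
  have := congrFun (congrFun (congrFun h j) a) b
  simp [stdUnit] at this

lemma eq_sum_stdUnit (s : Π i, Matrix (Fin (d i)) (Fin (d i)) F) :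
    s = ∑ j, ∑ a, ∑ b, s j a b • stdUnit F d j a b := by
  have : ∀ j, ∑ a, ∑ b, s j a b • stdUnit F d j a b = Pi.single j (s j) := by
    intro j
    conv_rhs => rw [Matrix.matrix_eq_sum_single (s j)]
    rw [← AddMonoidHom.single_apply, map_sum]
    refine Finset.sum_congr rfl fun a _ => ?_
    rw [map_sum]
    refine Finset.sum_congr rfl fun b _ => ?_
    rw [AddMonoidHom.single_apply, stdUnit, ← Pi.single_smul, Matrix.smul_single]
    simp
  rw [Finset.sum_congr rfl fun j _ => this j]
  exact (Finset.univ_sum_single s).symm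

lemma stdUnit_mul_mul_stdUnit (s : Π i, Matrix (Fin (d i)) (Fin (d i)) F) (j : Fin r)
    (a b c e : Fin (d j)) :
    stdUnit F d j a b * s * stdUnit F d j c e = s j b c • stdUnit F d j a e := by
  ext l : 1
  by_cases hl : l = j
  · subst hl
    simp [stdUnit]
  · simp [stdUnit, Pi.single_eq_of_ne hl]

-- Wedderburn–Artin for the unitization modulo its radical; over an algebraically closed field only
-- matrix algebras over `F` occur.
variable (F A) in
lemma exists_reduction [IsAlgClosed F] [FiniteDimensional F A] :
    ∃ (r : ℕ) (d : Fin r → ℕ) (ρ : Unitization F A →ₐ[F] Π i, Matrix (Fin (d i)) (Fin (d i)) F),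
      (∀ i, NeZero (d i)) ∧ Function.Surjective ρ ∧
        ∀ x, ρ x = 0 ↔ x ∈ Ring.jacobson (Unitization F A) := by
  have := IsArtinianRing.of_finite F (Unitization F A)
  have : FiniteDimensional F (Unitization F A ⧸ Ring.jacobson (Unitization F A)) :=
    Module.Finite.of_surjective
      (Ideal.Quotient.mkₐ F (Ring.jacobson (Unitization F A))).toLinearMap
      (Ideal.Quotient.mkₐ_surjective F _)
  obtain ⟨r, d, hd, ⟨φ⟩⟩ := IsSemisimpleRing.exists_algEquiv_pi_matrix_of_isAlgClosed F
    (Unitization F A ⧸ Ring.jacobson (Unitization F A))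
  refine ⟨r, d, φ.toAlgHom.comp (Ideal.Quotient.mkₐ F _), hd,
    φ.surjective.comp (Ideal.Quotient.mkₐ_surjective F _), fun x => ?_⟩
  change φ (Ideal.Quotient.mk _ x) = 0 ↔ _
  rw [map_eq_zero_iff φ φ.injective, Ideal.Quotient.eq_zero_iff_mem]

/-- Matrix units lift along a surjection with nil kernel. -/
lemma exists_lift_stdUnit {U : Type*} [Ring U] [Algebra F U] [∀ i, NeZero (d i)]
    (ρ : U →ₐ[F] Π i, Matrix (Fin (d i)) (Fin (d i)) F) (hρ : Function.Surjective ρ)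
    (hnil : ∀ x, ρ x = 0 → IsNilpotent x) :
    ∃ E : (j : Fin r) → Fin (d j) → Fin (d j) → U,
      (∀ j a b, ρ (E j a b) = stdUnit F d j a b) ∧
      (∀ j a b c, E j a b * E j b c = E j a c) ∧
      (∀ j a b c e, b ≠ c → E j a b * E j c e = 0) ∧
      (∀ i j, i ≠ j → ∀ a b c e, E i a b * E j c e = 0) := by
  have horth : OrthogonalIdempotents fun x : Σ j, Fin (d j) => stdUnit F d x.1 x.2 x.2 := by
    constructor
    · rintro ⟨j, a⟩
      exact stdUnit_mul_same j a a a
    · rintro ⟨i, a⟩ ⟨j, b⟩ h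
      by_cases hij : i = j
      · subst hij
        exact stdUnit_mul_ne i a (fun hab => h (congrArg (Sigma.mk i) hab)) b
      · exact stdUnit_mul_orth hij a a b b
  obtain ⟨P, hP, hPρ⟩ := OrthogonalIdempotents.lift_of_isNilpotent_ker ρ.toRingHom
    (fun x hx => hnil x hx) horth fun x => hρ _
  replace hPρ : ∀ j a, ρ (P ⟨j, a⟩) = stdUnit F d j a a := fun j a => congrFun hPρ ⟨j, a⟩
  have hPP : ∀ x, P x * P x = P x := fun x => hP.idem x
  have key : ∀ j : Fin r, ∃ (u v : Fin (d j) → U), (∀ a, ρ (u a) = stdUnit F d j a 0) ∧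
      (∀ a, ρ (v a) = stdUnit F d j 0 a) ∧ (∀ a, P ⟨j, a⟩ * u a = u a) ∧
      (∀ a, u a * P ⟨j, 0⟩ = u a) ∧ (∀ a, v a * P ⟨j, a⟩ = v a) ∧
      (∀ a, v a * u a = P ⟨j, 0⟩) := by
    intro j
    set p := P ⟨j, 0⟩ with hp
    have hpp : p * p = p := hPP _
    have : ∀ a, ∃ u v : U, ρ u = stdUnit F d j a 0 ∧ ρ v = stdUnit F d j 0 a ∧
        P ⟨j, a⟩ * u = u ∧ u * p = u ∧ v * P ⟨j, a⟩ = v ∧ v * u = p := by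
      intro a
      obtain ⟨u₀, hu₀⟩ := hρ (stdUnit F d j a 0)
      obtain ⟨v₀, hv₀⟩ := hρ (stdUnit F d j 0 a)
      set u := P ⟨j, a⟩ * u₀ * p with hu
      set v := p * v₀ * P ⟨j, a⟩ with hv
      have hρu : ρ u = stdUnit F d j a 0 := by
        simp [hu, hu₀, hPρ, hp, stdUnit_mul_same]
      have hρv : ρ v = stdUnit F d j 0 a := by
        simp [hv, hv₀, hPρ, hp, stdUnit_mul_same]
      -- The product `v * u` lifts `p` only up to the nilpotent error `n`. Since `v * u = (1 - n) *
      -- p`, replacing `v` by `g * v`, with `g` inverse to `1 - n`, makes the product exactly `p`.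
      set n := p - v * u with hn
      have hpn : p * n = n := by
        rw [hn, mul_sub, hpp, hv]
        simp only [← mul_assoc, hpp]
      have hnp : n * p = n := by
        rw [hn, sub_mul, hpp, hu]
        simp only [mul_assoc, hpp]
      have hnn : IsNilpotent n := hnil n (by
        rw [hn, map_sub, map_mul, hρu, hρv, hp, hPρ, stdUnit_mul_same, sub_self])
      obtain ⟨g, hg⟩ := hnn.isUnit_one_sub.exists_left_inv
      have hgp : g * (1 - n) * p = p := by rw [hg, one_mul]
      have hvu : v * u = (1 - n) * p := by
        rw [sub_mul, one_mul, hnp, hn]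
        abel
      have hρg : ρ g = 1 := by
        have hρn : ρ n = 0 := by
          rw [hn, map_sub, map_mul, hρu, hρv, hp, hPρ, stdUnit_mul_same, sub_self]
        have := congrArg ρ hg
        simpa [hρn] using this
      refine ⟨u, g * v, hρu, by rw [map_mul, hρg, one_mul, hρv], ?_, ?_, ?_, ?_⟩
      · rw [hu]
        simp only [← mul_assoc, hPP]
      · rw [hu]
        simp only [mul_assoc, hpp]
      · rw [hv]
        simp only [mul_assoc, hPP]
      · rw [mul_assoc, hvu, ← mul_assoc, hgp]
    choose u v h using this
    exact ⟨u, v, fun a => (h a).1, fun a => (h a).2.1, fun a => (h a).2.2.1,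
      fun a => (h a).2.2.2.1, fun a => (h a).2.2.2.2.1, fun a => (h a).2.2.2.2.2⟩
  choose u v hu hv hPu huP hvP hvu using key
  have hvu0 : ∀ i j (a : Fin (d i)) (b : Fin (d j)), (⟨i, a⟩ : Σ j, Fin (d j)) ≠ ⟨j, b⟩ →
      v i a * u j b = 0 := by
    intro i j a b h
    rw [← hvP, ← hPu, mul_assoc, ← mul_assoc (P _), hP.ortho h, zero_mul, mul_zero]
  -- The matrix units factor through the corner at index `0`, so their multiplication table reduces
  -- to the products `v * u`.
  refine ⟨fun j a b => u j a * v j b, fun j a b => ?_, fun j a b c => ?_, fun j a b c e h => ?_,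
    fun i j h a b c e => ?_⟩
  · rw [map_mul, hu, hv, stdUnit_mul_same]
  · rw [mul_assoc, ← mul_assoc (v j b), hvu, ← mul_assoc, huP]
  · rw [mul_assoc, ← mul_assoc (v j b), hvu0 _ _ _ _ (by simpa using h), zero_mul, mul_zero]
  · rw [mul_assoc, ← mul_assoc (v i b), hvu0 _ _ _ _ (by simp [h]), zero_mul, mul_zero]

end Reduction

end PIAlg

namespace PIAlg

/-! ### Matrix units spanning a complement of the radical -/

section MatrixUnits

/-- A family of matrix units: the multiplication table of a product of matrix algebras. -/
structure IsMatrixUnits {B : Type v} [NonUnitalRing B] {q : ℕ} {k : Fin q → ℕ}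
    (E : (i : Fin q) → Fin (k i) → Fin (k i) → B) : Prop where
  mul_same : ∀ i a b c, E i a b * E i b c = E i a c
  mul_ne : ∀ i a b c e, b ≠ c → E i a b * E i c e = 0
  mul_orth : ∀ i j, i ≠ j → ∀ a b c e, E i a b * E j c e = 0
  ne_zero : ∀ i a b, E i a b ≠ 0

/-- The positions of matrix units. -/
abbrev UnitIndex {q : ℕ} (k : Fin q → ℕ) : Type := Σ i, Fin (k i) × Fin (k i)

namespace IsMatrixUnits

variable {B : Type v} [NonUnitalRing B] {q : ℕ} {k : Fin q → ℕ}
  {E : (i : Fin q) → Fin (k i) → Fin (k i) → B}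

lemma mul_mul_same (h : IsMatrixUnits E) (i : Fin q) (a b c e : Fin (k i)) :
    E i a b * E i b c * E i c e = E i a e := by
  rw [h.mul_same, h.mul_same]

lemma mul_mul_ne (h : IsMatrixUnits E) (i : Fin q) (a b c e : Fin (k i)) (m : UnitIndex k)
    (hm : m ≠ ⟨i, b, c⟩) : E i a b * E m.1 m.2.1 m.2.2 * E i c e = 0 := by
  obtain ⟨j, x, y⟩ := m
  by_cases hij : i = j
  · subst hij
    by_cases hb : b = x
    · subst hb
      have hy : y ≠ c := fun hy => hm (by rw [hy])
      rw [h.mul_same, h.mul_ne _ _ _ _ _ hy]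
    · rw [h.mul_ne _ _ _ _ _ hb, zero_mul]
  · rw [h.mul_orth _ _ hij, zero_mul]

/-- Multiplication by `E i a a` and `E i b b` isolates a single coefficient. -/
lemma linearIndependent (F : Type u) [Field F] [Module F B] [IsScalarTower F B B]
    [SMulCommClass F B B] (h : IsMatrixUnits E) :
    LinearIndependent F fun m : UnitIndex k => E m.1 m.2.1 m.2.2 := by
  rw [Fintype.linearIndependent_iff]
  rintro g hg ⟨i, a, b⟩
  have : E i a a * (∑ m : UnitIndex k, g m • E m.1 m.2.1 m.2.2) * E i b b =
      g ⟨i, a, b⟩ • E i a b := by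
    rw [Finset.mul_sum, Finset.sum_mul, Finset.sum_eq_single ⟨i, a, b⟩]
    · rw [mul_smul_comm, smul_mul_assoc, h.mul_mul_same]
    · intro m _ hm
      rw [mul_smul_comm, smul_mul_assoc, h.mul_mul_ne _ _ _ _ _ _ hm, smul_zero]
    · simp
  rw [hg, mul_zero, zero_mul] at this
  exact (smul_eq_zero.1 this.symm).resolve_right (h.ne_zero i a b)

end IsMatrixUnits

variable (F : Type u) [Field F] (A : Type v) [NonUnitalRing A] [Module F A]
  [IsScalarTower F A A] [SMulCommClass F A A]

/-- Matrix units that span a complement of the radical. -/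
structure MatrixUnits (q : ℕ) where
  k : Fin q → ℕ
  neZero : ∀ i, NeZero (k i)
  E : (i : Fin q) → Fin (k i) → Fin (k i) → A
  isMatrixUnits : IsMatrixUnits E
  isCompl : IsCompl (Submodule.span F (Set.range fun m : UnitIndex k => E m.1 m.2.1 m.2.2))
    (radical F A)

variable {F A} {r : ℕ} {d : Fin r → ℕ}

lemma isMatrixUnits_stdUnit {q : ℕ} (j : Fin q → Fin r) (hj : Function.Injective j) :
    IsMatrixUnits fun i a b => stdUnit F d (j i) a b where
  mul_same _ _ _ _ := stdUnit_mul_same _ _ _ _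
  mul_ne _ _ _ _ _ h := stdUnit_mul_ne _ _ h _
  mul_orth _ _ h _ _ _ _ := stdUnit_mul_orth (hj.ne h) _ _ _ _
  ne_zero _ _ _ := stdUnit_ne_zero _ _ _

/-- The map `L` has kernel the radical, and its image is spanned by the standard units in the blocks
met by `A`. The `E i a b` lift these units, so their span maps isomorphically onto the image. -/
lemma isCompl_of_reduction {L : A →ₗ[F] Π i, Matrix (Fin (d i)) (Fin (d i)) F}
    (hL : ∀ a, L a = 0 ↔ a ∈ radical F A) {q : ℕ} {j : Fin q → Fin r} (hj : Function.Injective j)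
    {E : (i : Fin q) → Fin (d (j i)) → Fin (d (j i)) → A}
    (hE : ∀ i a b, L (E i a b) = stdUnit F d (j i) a b)
    (hsupp : ∀ a l, L a l ≠ 0 → l ∈ Set.range j) :
    IsCompl (Submodule.span F (Set.range fun m : UnitIndex (fun i => d (j i)) =>
      E m.1 m.2.1 m.2.2)) (radical F A) := by
  constructor
  · rw [Submodule.disjoint_def]
    intro x hx hxr
    obtain ⟨c, rfl⟩ := (Submodule.mem_span_range_iff_exists_fun F).1 hx
    rw [← hL, map_sum] at hxr
    simp only [map_smul, hE] at hxr
    have hc := Fintype.linearIndependent_iff.1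
      ((isMatrixUnits_stdUnit (F := F) (d := d) j hj).linearIndependent F) c hxr
    simp [hc]
  · rw [codisjoint_iff, eq_top_iff]
    intro x _
    have hx : L x ∈ (Submodule.span F (Set.range fun m : UnitIndex (fun i => d (j i)) =>
        E m.1 m.2.1 m.2.2)).map L := by
      rw [eq_sum_stdUnit (L x)]
      refine Submodule.sum_mem _ fun l _ => ?_
      by_cases hl : L x l = 0
      · simp [hl]
      · obtain ⟨i, rfl⟩ := hsupp x l hl
        refine Submodule.sum_mem _ fun a _ => Submodule.sum_mem _ fun b _ =>
          Submodule.smul_mem _ _ ⟨E i a b, Submodule.subset_span ⟨⟨i, a, b⟩, rfl⟩, hE i a b⟩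
    obtain ⟨y, hy, hxy⟩ := hx
    rw [← add_sub_cancel y x]
    refine Submodule.add_mem_sup hy ?_
    rw [← hL, map_sub, hxy, sub_self]

variable (F A) in
/-- Existence of a semisimple complement of the radical. -/
theorem exists_matrixUnits [IsAlgClosed F] [FiniteDimensional F A] :
    ∃ q, Nonempty (MatrixUnits F A q) := by
  classical
  obtain ⟨r, d, ρ, hd, hρ, hker⟩ := exists_reduction F A
  obtain ⟨E, hE, h₁, h₂, h₃⟩ := exists_lift_stdUnit ρ hρ fun x hx =>
    isNilpotent_of_mem_jacobson ((hker x).1 hx)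
  -- Only the blocks met by the image of `A` are kept: a further block can come from the adjoined
  -- unit.
  let Q := {j : Fin r // ∃ a : A, ρ (Unitization.inr a) j ≠ 0}
  obtain ⟨q, ⟨ε⟩⟩ := Finite.exists_equiv_fin Q
  have hex : ∀ (l : Q) (a b : Fin (d l)), ∃ y : A, Unitization.inr y = E l a b := by
    rintro ⟨l, x, hx⟩ a b
    dsimp only
    obtain ⟨b₀, c₀, hbc⟩ : ∃ b₀ c₀, ρ (Unitization.inr x) l b₀ c₀ ≠ 0 := by
      by_contra! h
      exact hx (by ext b c; exact h b c)
    have hy : ∃ y : A, (Unitization.inr y : Unitization F A) =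
        E l a b₀ * Unitization.inr x * E l c₀ b := by
      rw [unitization_mul_inr, unitization_inr_mul]
      exact ⟨_, rfl⟩
    -- Up to a nonzero scalar, `y` has the same reduction as `E l a b`. The difference lies in the
    -- radical of the unitization, which is contained in `A`, so the lifted unit itself belongs to
    -- `A`.
    obtain ⟨y, hy⟩ := hy
    have hdiff : E l a b - (ρ (Unitization.inr x) l b₀ c₀)⁻¹ • Unitization.inr y ∈
        Ring.jacobson (Unitization F A) := by
      rw [← hker, map_sub, map_smul, hy, map_mul, map_mul, hE, hE, hE, stdUnit_mul_mul_stdUnit,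
        smul_smul, inv_mul_cancel₀ hbc, one_smul, sub_self]
    obtain ⟨z, -, hz⟩ := exists_eq_inr_of_mem_jacobson hdiff
    refine ⟨z + (ρ (Unitization.inr x) l b₀ c₀)⁻¹ • y, ?_⟩
    rw [Unitization.inr_add, hz, Unitization.inr_smul, sub_add_cancel]
  choose E' hE' using hex
  have hcompl := isCompl_of_reduction (L := ρ.toLinearMap ∘ₗ Unitization.inrHom F F A)
    (j := fun i => (ε.symm i).1) (E := fun i => E' (ε.symm i)) (fun a => hker _)
    (Subtype.val_injective.comp ε.symm.injective)
    (fun i a b => (congrArg ρ (hE' (ε.symm i) a b)).trans (hE _ a b))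
    (fun a l hl => ⟨ε ⟨l, a, fun h => hl h⟩, by simp⟩)
  refine ⟨q, ⟨⟨fun i => d (ε.symm i).1, fun i => hd _, fun i => E' (ε.symm i), ?_, hcompl⟩⟩⟩
  · constructor
    · intro i a b c
      apply Unitization.inr_injective (R := F)
      rw [Unitization.inr_mul, hE', hE', hE', h₁]
    · intro i a b c e h
      apply Unitization.inr_injective (R := F)
      rw [Unitization.inr_mul, hE', hE', h₂ _ _ _ _ _ h, Unitization.inr_zero]
    · intro i j h a b c e
      apply Unitization.inr_injective (R := F)
      rw [Unitization.inr_mul, hE', hE', Unitization.inr_zero]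
      exact h₃ _ _ (fun heq => h (ε.symm.injective (Subtype.ext heq))) _ _ _ _
    · intro i a b h0
      have := hE' (ε.symm i) a b
      rw [h0, Unitization.inr_zero] at this
      have h1 := hE (ε.symm i) a b
      rw [← this, map_zero] at h1
      exact stdUnit_ne_zero _ _ _ h1.symm

end MatrixUnits

/-! ### The components of a Wedderburn–Malcev decomposition -/

section Decomposition

variable {F : Type u} [Field F] {A : Type v} [NonUnitalRing A] [Module F A]
  [IsScalarTower F A A] [SMulCommClass F A A]

namespace WedderburnDecomposition

variable (W : WedderburnDecomposition F A)

lemma sup_eq_top : radical F A ⊔ ⨆ i, (W.component i).toSubmodule = ⊤ := by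
  rw [← W.isInternal.submodule_iSup_eq_top, iSup_option]
  rfl

lemma disjoint_radical (i : Fin W.q) : Disjoint (W.component i).toSubmodule (radical F A) :=
  W.isInternal.submodule_iSupIndep.pairwiseDisjoint (Option.some_ne_none i)

lemma disjoint_component {i j : Fin W.q} (h : i ≠ j) :
    Disjoint (W.component i).toSubmodule (W.component j).toSubmodule :=
  W.isInternal.submodule_iSupIndep.pairwiseDisjoint fun h' => h (Option.some_injective _ h')

/-- The other components annihilate `x`, so a component together with the radical is an ideal of all
of `A`. -/
lemma mul_mem_component_sup {i : Fin W.q} {x : A} (hx : x ∈ W.component i) (a : A) :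
    a * x ∈ (W.component i).toSubmodule ⊔ radical F A := by
  have hle : radical F A ⊔ ⨆ j, (W.component j).toSubmodule ≤
      ((W.component i).toSubmodule ⊔ radical F A).comap (LinearMap.mulRight F x) := by
    refine sup_le (fun b hb => ?_) (iSup_le fun j b hb => ?_)
    · exact Submodule.mem_sup_right (radical_mul_mem x hb)
    · by_cases hij : j = i
      · subst hij
        exact Submodule.mem_sup_left ((W.component j).mul_mem hb hx)
      · change b * x ∈ (W.component i).toSubmodule ⊔ radical F A
        rw [W.orthogonal j i hij b hb x hx]
        exact Submodule.zero_mem _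
  rw [W.sup_eq_top] at hle
  exact hle trivial

lemma component_mul_mem_sup {i : Fin W.q} {x : A} (hx : x ∈ W.component i) (a : A) :
    x * a ∈ (W.component i).toSubmodule ⊔ radical F A := by
  have hle : radical F A ⊔ ⨆ j, (W.component j).toSubmodule ≤
      ((W.component i).toSubmodule ⊔ radical F A).comap (LinearMap.mulLeft F x) := by
    refine sup_le (fun b hb => ?_) (iSup_le fun j b hb => ?_)
    · exact Submodule.mem_sup_right (mul_mem_radical x hb)
    · by_cases hij : j = i
      · subst hij
        exact Submodule.mem_sup_left ((W.component j).mul_mem hx hb)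
      · change x * b ∈ (W.component i).toSubmodule ⊔ radical F A
        rw [W.orthogonal i j (Ne.symm hij) x hx b hb]
        exact Submodule.zero_mem _
  rw [W.sup_eq_top] at hle
  exact hle trivial

lemma exists_ne_zero (i : Fin W.q) : ∃ x ∈ W.component i, x ≠ 0 := by
  by_contra! h
  have := (W.simple i).simple.toNontrivial
  apply bot_ne_top (α := TwoSidedIdeal (W.component i))
  ext x
  have hx : x = 0 := Subtype.ext (h x x.2)
  simp [hx]

/-- The simple components of a Wedderburn-Malcev decomposition are matrix algebras. -/
theorem exists_matrixUnits [IsAlgClosed F] [FiniteDimensional F A] :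
    ∃ U : MatrixUnits F A W.q, ∀ i, (W.component i).toSubmodule =
      Submodule.span F (Set.range fun p : Fin (U.k i) × Fin (U.k i) => U.E i p.1 p.2) := by
  obtain ⟨r, d, ρ, hd, hρ, hker⟩ := exists_reduction F A
  set L : A →ₗ[F] Π i, Matrix (Fin (d i)) (Fin (d i)) F :=
    ρ.toLinearMap ∘ₗ Unitization.inrHom F F A with hLdef
  have hL : ∀ a, L a = 0 ↔ a ∈ radical F A := fun a => hker _
  have hLmul : ∀ a b, L (a * b) = L a * L b := by
    intro a b
    change ρ (Unitization.inr (a * b)) = ρ (Unitization.inr a) * ρ (Unitization.inr b)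
    rw [Unitization.inr_mul, map_mul]
  have hinj : ∀ i, ∀ x ∈ W.component i, ∀ y ∈ W.component i, L x = L y → x = y := by
    intro i x hx y hy hxy
    rw [← sub_eq_zero]
    refine Submodule.disjoint_def.1 (W.disjoint_radical i) _ (sub_mem (S := NonUnitalSubalgebra F A) hx hy) ?_
    rw [← hL, map_sub, hxy, sub_self]
  have hsup : ∀ i, ∀ z ∈ (W.component i).toSubmodule ⊔ radical F A,
      ∃ y ∈ W.component i, L y = L z := by
    intro i z hz
    obtain ⟨y, hy, n, hn, rfl⟩ := Submodule.mem_sup.1 hz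
    exact ⟨y, hy, by rw [map_add, (hL n).2 hn, add_zero]⟩
  have key : ∀ i, ∃ (l : Fin r) (E : Fin (d l) → Fin (d l) → A), (∀ a b, E a b ∈ W.component i) ∧
      (∀ a b, L (E a b) = stdUnit F d l a b) ∧ ∀ y ∈ W.component i, ∀ l' ≠ l, L y l' = 0 := by
    intro i
    obtain ⟨x, hx, hx0⟩ := W.exists_ne_zero i
    have hLx : L x ≠ 0 := fun h => hx0 (hinj i x hx 0 (zero_mem _) (by rw [h, map_zero]))
    obtain ⟨l, b₀, c₀, hne⟩ : ∃ l b₀ c₀, L x l b₀ c₀ ≠ 0 := by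
      by_contra! h
      exact hLx (by ext l b c; exact h l b c)
    -- Since `W.component i` plus the radical is an ideal, the image of the component under `L` is
    -- stable under multiplication by arbitrary matrices. One nonzero entry in block `l` therefore
    -- yields every standard unit of that block.
    have hex : ∀ a b, ∃ y ∈ W.component i, L y = stdUnit F d l a b := by
      intro a b
      obtain ⟨s, hs⟩ := hρ (stdUnit F d l a b₀)
      obtain ⟨t, ht⟩ := hρ (stdUnit F d l c₀ b)
      have h₁ : s.fst • x + s.snd * x ∈ (W.component i).toSubmodule ⊔ radical F A :=
        add_mem (Submodule.smul_mem _ _ (Submodule.mem_sup_left hx)) (W.mul_mem_component_sup hx _)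
      obtain ⟨y, hy, hLy⟩ := hsup i _ h₁
      have h₂ : t.fst • y + y * t.snd ∈ (W.component i).toSubmodule ⊔ radical F A :=
        add_mem (Submodule.smul_mem _ _ (Submodule.mem_sup_left hy)) (W.component_mul_mem_sup hy _)
      obtain ⟨z, hz, hLz⟩ := hsup i _ h₂
      have hy' : L y = stdUnit F d l a b₀ * L x := by
        rw [hLy, ← hs]
        change ρ (Unitization.inr _) = ρ s * ρ (Unitization.inr x)
        rw [← map_mul, unitization_mul_inr]
      have hz' : L z = L x l b₀ c₀ • stdUnit F d l a b := by
        rw [hLz, ← stdUnit_mul_mul_stdUnit, ← hy', ← ht]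
        change ρ (Unitization.inr _) = ρ (Unitization.inr y) * ρ t
        rw [← map_mul, unitization_inr_mul]
      refine ⟨(L x l b₀ c₀)⁻¹ • z, (W.component i).smul_mem _ hz, ?_⟩
      rw [map_smul, hz', smul_smul, inv_mul_cancel₀ hne, one_smul]
    choose E hEmem hE using hex
    refine ⟨l, E, hEmem, hE, ?_⟩
    -- The elements supported in block `l` form an ideal, nonzero because it contains `E 0 0`. By
    -- simplicity it is the whole component, which thus meets no other block.
    let T : TwoSidedIdeal (W.component i) := TwoSidedIdeal.mk'
      {y | ∀ l' ≠ l, L (y : A) l' = 0} (fun l' _ => by simp)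
      (fun {x y} hx hy l' hl' => by simp [hx l' hl', hy l' hl'])
      (fun {x} hx l' hl' => by simp [hx l' hl'])
      (fun {x y} hy l' hl' => by simp [hLmul, hy l' hl'])
      (fun {x y} hx l' hl' => by simp [hLmul, hx l' hl'])
    have hmemT : ∀ y : W.component i, y ∈ T ↔ ∀ l' ≠ l, L (y : A) l' = 0 := fun y => by
      simp [T, TwoSidedIdeal.mem_mk']
    have hT : T = ⊤ := by
      have := (W.simple i).simple
      refine (eq_bot_or_eq_top T).resolve_left fun h => ?_
      have := hd l
      have h0 : (⟨E 0 0, hEmem 0 0⟩ : W.component i) ∈ T := by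
        rw [hmemT]
        intro l' hl'
        simp [hE, stdUnit, Pi.single_eq_of_ne hl']
      rw [h, TwoSidedIdeal.mem_bot] at h0
      have h1 : E 0 0 = 0 := congrArg Subtype.val h0
      exact stdUnit_ne_zero l 0 0 (by rw [← hE 0 0, h1, map_zero])
    intro y hy
    exact (hmemT ⟨y, hy⟩).1 (by rw [hT]; trivial)
  choose l E hEmem hE hsupp using key
  have hlinj : Function.Injective l := by
    intro i i' h
    by_contra hne
    have h₀ : ∀ l l', l = l' → stdUnit F d l 0 0 * stdUnit F d l' 0 0 ≠ 0 := by
      rintro l _ rfl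
      rw [stdUnit_mul_same]
      exact stdUnit_ne_zero _ _ _
    refine h₀ _ _ h ?_
    rw [← hE, ← hE, ← hLmul, W.orthogonal i i' hne _ (hEmem _ _ _) _ (hEmem _ _ _), map_zero]
  refine ⟨⟨fun i => d (l i), fun i => hd _, E, ?_, ?_⟩, fun i => le_antisymm (fun y hy => ?_) ?_⟩
  · constructor
    · intro i a b c
      refine hinj i _ ((W.component i).mul_mem (hEmem _ _ _) (hEmem _ _ _)) _ (hEmem _ _ _) ?_
      rw [hLmul, hE, hE, hE, stdUnit_mul_same]
    · intro i a b c e h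
      refine hinj i _ ((W.component i).mul_mem (hEmem _ _ _) (hEmem _ _ _)) _ (zero_mem _) ?_
      rw [hLmul, hE, hE, stdUnit_mul_ne _ _ h, map_zero]
    · intro i j h a b c e
      exact W.orthogonal i j h _ (hEmem _ _ _) _ (hEmem _ _ _)
    · intro i a b h
      exact stdUnit_ne_zero (l i) a b (by rw [← hE, h, map_zero])
  · refine isCompl_of_reduction hL hlinj hE fun a l' hl' => ?_
    by_contra hnot
    apply hl'
    have hle : radical F A ⊔ ⨆ j, (W.component j).toSubmodule ≤
        LinearMap.ker (LinearMap.proj l' ∘ₗ L) := by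
      refine sup_le (fun b hb => ?_) (iSup_le fun j b hb => ?_)
      · simp [(hL b).2 hb]
      · exact hsupp j b hb l' fun h => hnot ⟨j, h.symm⟩
    rw [W.sup_eq_top] at hle
    exact hle trivial
  · have : ∑ a, ∑ b, L y (l i) a b • E i a b = y := by
      refine hinj i _ ?_ y hy ?_
      · exact sum_mem fun a _ => sum_mem fun b _ => (W.component i).smul_mem _ (hEmem _ _ _)
      · conv_rhs => rw [eq_sum_stdUnit (L y)]
        rw [Finset.sum_eq_single (l i)]
        · simp [hE]
        · intro l' _ hl'
          simp [hsupp i y hy l' hl']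
        · simp
    rw [← this]
    exact Submodule.sum_mem _ fun a _ => Submodule.sum_mem _ fun b _ =>
      Submodule.smul_mem _ _ (Submodule.subset_span ⟨(a, b), rfl⟩)
  · rw [Submodule.span_le]
    rintro _ ⟨p, rfl⟩
    exact hEmem i _ _

end WedderburnDecomposition

end Decomposition

end PIAlg

namespace PIAlg

open TensorProduct

/-! ### Subalgebras given by a spanning set -/

section Subalgebras

variable {F : Type u} [Field F] {A : Type v} [NonUnitalRing A] [Module F A]
  [IsScalarTower F A A] [SMulCommClass F A A]

lemma mul_mem_of_span {S T : Set A} {P : Submodule F A} (h : ∀ s ∈ S, ∀ t ∈ T, s * t ∈ P) {x y : A}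
    (hx : x ∈ Submodule.span F S) (hy : y ∈ Submodule.span F T) : x * y ∈ P := by
  have h₁ : ∀ s ∈ S, s * y ∈ P := fun s hs =>
    (Submodule.span_le (p := P.comap (LinearMap.mulLeft F s))).2 (fun t ht => h s hs t ht) hy
  exact (Submodule.span_le (p := P.comap (LinearMap.mulRight F y))).2 (fun s hs => h₁ s hs) hx

/-- The subalgebra `C + I` for a subalgebra `C` and an ideal `I`, spanned by given sets. -/
def spanSubalgebra (S T : Set A) (hSS : ∀ a ∈ S, ∀ b ∈ S, a * b ∈ Submodule.span F S)
    (hST : ∀ a ∈ S, ∀ b ∈ T, a * b ∈ Submodule.span F T)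
    (hTS : ∀ a ∈ T, ∀ b ∈ S, a * b ∈ Submodule.span F T)
    (hTT : ∀ a ∈ T, ∀ b ∈ T, a * b ∈ Submodule.span F T) : NonUnitalSubalgebra F A where
  __ := Submodule.span F (S ∪ T)
  mul_mem' := by
    intro a b ha hb
    refine mul_mem_of_span (P := Submodule.span F (S ∪ T)) ?_ ha hb
    have h₁ : Submodule.span F S ≤ Submodule.span F (S ∪ T) :=
      Submodule.span_mono Set.subset_union_left
    have h₂ : Submodule.span F T ≤ Submodule.span F (S ∪ T) :=
      Submodule.span_mono Set.subset_union_right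
    rintro s (hs | hs) t (ht | ht)
    · exact h₁ (hSS s hs t ht)
    · exact h₂ (hST s hs t ht)
    · exact h₂ (hTS s hs t ht)
    · exact h₂ (hTT s hs t ht)

variable {S T : Set A} {hSS : ∀ a ∈ S, ∀ b ∈ S, a * b ∈ Submodule.span F S}
    {hST : ∀ a ∈ S, ∀ b ∈ T, a * b ∈ Submodule.span F T}
    {hTS : ∀ a ∈ T, ∀ b ∈ S, a * b ∈ Submodule.span F T}
    {hTT : ∀ a ∈ T, ∀ b ∈ T, a * b ∈ Submodule.span F T}

lemma mem_spanSubalgebra {a : A} :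
    a ∈ spanSubalgebra S T hSS hST hTS hTT ↔ a ∈ Submodule.span F (S ∪ T) := Iff.rfl

lemma isNilpotentIdeal_spanSubalgebra {m : ℕ}
    (h : ∀ l : List A, l.length = m → (∀ a ∈ l, a ∈ Submodule.span F T) →
      (l.map (Unitization.inr : A → Unitization F A)).prod = 0) :
    IsNilpotentIdeal (spanSubalgebra S T hSS hST hTS hTT) (Submodule.span F T) m where
  le a ha := Submodule.span_mono Set.subset_union_right ha
  mul_left b hb a ha := by
    refine mul_mem_of_span ?_ (mem_spanSubalgebra.1 hb) ha
    rintro s (hs | hs) t ht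
    · exact hST s hs t ht
    · exact hTT s hs t ht
  mul_right b hb a ha := by
    refine mul_mem_of_span ?_ ha (mem_spanSubalgebra.1 hb)
    rintro s hs t (ht | ht)
    · exact hTS s hs t ht
    · exact hTT s hs t ht
  prod_eq_zero := h

/-- The identities of a spanned subalgebra, tested on the spanning set. -/
lemma IsMultilinear.mem_identities_spanSubalgebra {f : FreeAlg F} (hf : IsMultilinear f) :
    f ∈ identities F (spanSubalgebra S T hSS hST hTS hTT) ↔
      ∀ e : ℕ → A, (∀ x ∈ vars f, e x ∈ S ∪ T) → (∀ x ∉ vars f, e x = 0) → eval e f = 0 := by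
  rw [mem_identities_subalgebra]
  constructor
  · intro h e he he0
    refine h e fun x => ?_
    by_cases hx : x ∈ vars f
    · exact Submodule.subset_span (he x hx)
    · rw [he0 x hx]
      exact zero_mem _
  · intro h e he
    by_contra hne
    obtain ⟨e', h₁, h₂, h₃⟩ := hf.exists_eval_ne_zero (fun x => mem_spanSubalgebra.1 (he x)) hne
    exact h₃ (h e' h₁ h₂)

end Subalgebras

/-! ### Transport to a copy in the universe of the field -/

section Transport

variable {F : Type u} [Field F] {A : Type v} [NonUnitalRing A] [Module F A]
  [IsScalarTower F A A] [SMulCommClass F A A] {B : Type w} [NonUnitalRing B] [Module F B]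
  [IsScalarTower F B B] [SMulCommClass F B B]

lemma identities_eq_of_range {P : NonUnitalSubalgebra F A} {ψ : B →ₙₐ[F] A}
    (hψ : Function.Injective ψ) (hP : ∀ a, a ∈ P ↔ ∃ b, ψ b = a) :
    identities F B = identities F P := by
  ext f
  rw [mem_identities_subalgebra, mem_identities]
  constructor
  · intro h e he
    choose b hb using fun x => (hP _).1 (he x)
    rw [← funext hb, ← algHom_eval ψ, h, map_zero]
  · intro h e
    apply hψ
    rw [algHom_eval, map_zero]
    exact h _ fun x => (hP _).2 ⟨_, rfl⟩

lemma isNilpotentIdeal_comap {P : NonUnitalSubalgebra F A} {I : Submodule F A} {m : ℕ}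
    (h : IsNilpotentIdeal P I m) {ψ : B →ₙₐ[F] A}
    (hψ : Function.Injective ψ) (hP : ∀ a, a ∈ P ↔ ∃ b, ψ b = a) :
    IsNilpotentIdeal (⊤ : NonUnitalSubalgebra F B) (I.comap (ψ : B →ₗ[F] A)) m where
  le _ _ := trivial
  mul_left b _ a ha := by
    change ψ (b * a) ∈ I
    rw [map_mul]
    exact h.mul_left _ ((hP _).2 ⟨b, rfl⟩) _ ha
  mul_right b _ a ha := by
    change ψ (a * b) ∈ I
    rw [map_mul]
    exact h.mul_right _ ((hP _).2 ⟨b, rfl⟩) _ ha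
  prod_eq_zero l hl hI := by
    -- Products of lists are taken in the unitization, so `ψ` is extended to an injective map of
    -- unitizations.
    set Ψ : Unitization F B →ₐ[F] Unitization F A :=
      Unitization.lift ((Unitization.inrNonUnitalAlgHom F A).comp ψ) with hΨdef
    have hΨ : ∀ b : B, Ψ (Unitization.inr b) = Unitization.inr (ψ b) := fun b => by simp [hΨdef]
    have hinj : Function.Injective Ψ := by
      rw [injective_iff_map_eq_zero]
      intro x hx
      have hx' : Ψ x = Unitization.inl x.fst + Unitization.inr (ψ x.snd) := by
        conv_lhs => rw [← Unitization.inl_fst_add_inr_snd_eq x]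
        rw [map_add, hΨ]
        congr 1
        exact Ψ.commutes x.fst
      rw [hx'] at hx
      have h₁ : x.fst = 0 := by simpa using congrArg (fun z : Unitization F A => z.fst) hx
      have h₂ : ψ x.snd = 0 := by simpa using congrArg (fun z : Unitization F A => z.snd) hx
      have h₃ : x.snd = 0 := hψ (by rw [h₂, map_zero])
      exact Unitization.ext h₁ h₃
    apply hinj
    rw [map_list_prod, map_zero, List.map_map]
    have := h.prod_eq_zero (l.map ψ) (by simpa using hl) (by
      intro a ha
      obtain ⟨b, hb, rfl⟩ := List.mem_map.1 ha
      exact hI b hb)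
    rw [← this, List.map_map]
    congr 1
    exact List.map_congr_left fun b _ => hΨ b

/-- A finite dimensional algebra, bundled. -/
structure FDAlgebra (F : Type u) [Field F] where
  carrier : Type u
  [ring : NonUnitalRing carrier]
  [module : Module F carrier]
  [isScalarTower : IsScalarTower F carrier carrier]
  [smulCommClass : SMulCommClass F carrier carrier]
  [finiteDimensional : FiniteDimensional F carrier]

attribute [instance] FDAlgebra.ring FDAlgebra.module FDAlgebra.isScalarTower
  FDAlgebra.smulCommClass FDAlgebra.finiteDimensional

/-- A finite dimensional subalgebra has a copy in the universe of the field, and its parameter is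
bounded by a decomposition into a semisimple part and a nilpotent ideal. -/
lemma exists_fdAlgebra [FiniteDimensional F A] {P : NonUnitalSubalgebra F A} {I : Submodule F A}
    {m : ℕ} (h : IsNilpotentIdeal P I m) {C : Finset A} (hC : ∀ c ∈ C, c ∈ P)
    (hP : ∀ a ∈ P, a ∈ Submodule.span F (C : Set A) ⊔ I) :
    ∃ b : FDAlgebra F, identities F b.carrier = identities F P ∧
      semisimpleDim F b.carrier ≤ C.card ∧
      (semisimpleDim F b.carrier = C.card → nilpotencyIndex F b.carrier ≤ m) := by
  classical
  have hPfd : FiniteDimensional F P :=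
    inferInstanceAs (FiniteDimensional F P.toSubmodule)
  -- A finite-dimensional space is in bijection with tuples over `F`, so it has a copy in the
  -- universe over which `IsBasic` quantifies.
  have hsmall : Small.{u} P :=
    ⟨_, ⟨(Module.finBasis F P).equivFun.toEquiv⟩⟩
  let φ : Shrink.{u} P ≃ₗ[F] P := Shrink.linearEquiv F P
  have hmul : ∀ x y : Shrink.{u} P, φ (x * y) = φ x * φ y := fun x y => equivShrink_symm_mul x y
  have : IsScalarTower F (Shrink.{u} P) (Shrink.{u} P) := ⟨fun c x y => by
    apply φ.injective
    simp only [smul_eq_mul, hmul, map_smul, smul_mul_assoc]⟩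
  have : SMulCommClass F (Shrink.{u} P) (Shrink.{u} P) := ⟨fun c x y => by
    apply φ.injective
    simp only [smul_eq_mul, hmul, map_smul, mul_smul_comm]⟩
  have : FiniteDimensional F (Shrink.{u} P) := Module.Finite.equiv φ.symm
  let ψ : Shrink.{u} P →ₙₐ[F] A :=
    { toFun := fun x => (φ x : A)
      map_smul' := fun c x => by simp
      map_zero' := by simp
      map_add' := fun x y => by simp
      map_mul' := fun x y => by simp [hmul] }
  have hψ : Function.Injective ψ := fun x y hxy => φ.injective (Subtype.ext hxy)
  have hrange : ∀ a, a ∈ P ↔ ∃ b, ψ b = a := by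
    intro a
    constructor
    · intro ha
      exact ⟨φ.symm ⟨a, ha⟩, by change ((φ (φ.symm ⟨a, ha⟩) : P) : A) = a; simp⟩
    · rintro ⟨b, rfl⟩
      exact (φ b).2
  refine ⟨⟨Shrink.{u} P⟩, identities_eq_of_range hψ hrange, ?_⟩
  have hcard : (C.preimage ψ hψ.injOn).card = C.card := by
    rw [Finset.card_preimage]
    congr 1
    refine Finset.filter_true_of_mem fun c hc => ?_
    obtain ⟨b, hb⟩ := (hrange c).1 (hC c hc)
    exact ⟨b, hb⟩
  rw [← hcard]
  refine (isNilpotentIdeal_comap h hψ hrange).semisimpleDim_le fun b _ => ?_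
  obtain ⟨c, hc, n, hn, hcn⟩ := Submodule.mem_sup.1 (hP (ψ b) ((hrange _).2 ⟨b, rfl⟩))
  have himg : (ψ : Shrink.{u} P →ₗ[F] A) '' (C.preimage ψ hψ.injOn : Set (Shrink.{u} P)) =
      (C : Set A) := by
    ext a
    constructor
    · rintro ⟨b, hb, rfl⟩
      exact Finset.mem_preimage.1 hb
    · intro ha
      obtain ⟨b, rfl⟩ := (hrange a).1 (hC a ha)
      exact ⟨b, Finset.mem_preimage.2 ha, rfl⟩
  rw [← himg, ← Submodule.map_span] at hc
  obtain ⟨c', hc', rfl⟩ := hc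
  rw [← add_sub_cancel c' b]
  refine Submodule.add_mem_sup hc' ?_
  change ψ (b - c') ∈ I
  rw [map_sub, ← hcn]
  simpa using hn

end Transport

end PIAlg

namespace PIAlg

open TensorProduct

/-! ### The algebras that test fullness and property `K` -/

namespace MatrixUnits

variable {F : Type u} [Field F] {A : Type v} [NonUnitalRing A] [Module F A]
  [IsScalarTower F A A] [SMulCommClass F A A] {q : ℕ} (U : MatrixUnits F A q)

instance (i : Fin q) : NeZero (U.k i) := U.neZero i

/-- The matrix unit at a position. -/
def unit (m : UnitIndex U.k) : A := U.E m.1 m.2.1 m.2.2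

lemma unit_mul_unit (m m' : UnitIndex U.k) :
    U.unit m * U.unit m' = 0 ∨ ∃ m'' : UnitIndex U.k, m''.1 = m.1 ∧
      U.unit m * U.unit m' = U.unit m'' := by
  obtain ⟨i, a, b⟩ := m
  obtain ⟨j, c, e⟩ := m'
  by_cases hij : i = j
  · subst hij
    by_cases hbc : b = c
    · subst hbc
      exact Or.inr ⟨⟨i, a, e⟩, rfl, U.isMatrixUnits.mul_same i a b e⟩
    · exact Or.inl (U.isMatrixUnits.mul_ne i a b c e hbc)
  · exact Or.inl (U.isMatrixUnits.mul_orth i j hij a b c e)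

lemma unit_mul_unit_mem {s : Set (Fin q)} (m m' : UnitIndex U.k) (hm : m.1 ∈ s) :
    U.unit m * U.unit m' ∈ Submodule.span F (U.unit '' {m | m.1 ∈ s}) := by
  obtain h | ⟨m'', h₁, h₂⟩ := U.unit_mul_unit m m'
  · rw [h]
    exact zero_mem _
  · rw [h₂]
    exact Submodule.subset_span ⟨m'', by rwa [Set.mem_ofPred_eq, h₁], rfl⟩

lemma linearIndependent : LinearIndependent F U.unit := U.isMatrixUnits.linearIndependent F

lemma isCompl' : IsCompl (Submodule.span F (Set.range U.unit)) (radical F A) := U.isCompl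

lemma semisimpleDim_eq [FiniteDimensional F A] :
    semisimpleDim F A = Fintype.card (UnitIndex U.k) := by
  rw [semisimpleDim, (Submodule.quotientEquivOfIsCompl _ _ U.isCompl'.symm).finrank_eq,
    finrank_span_eq_card U.linearIndependent]

/-- The subalgebra spanned by the radical and all simple components but the `i`-th. -/
def without (i : Fin q) : NonUnitalSubalgebra F A :=
  spanSubalgebra (U.unit '' {m | m.1 ∈ ({i}ᶜ : Set (Fin q))}) (radical F A)
    (by
      rintro _ ⟨m, hm, rfl⟩ _ ⟨m', -, rfl⟩
      exact U.unit_mul_unit_mem m m' hm)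
    (fun a _ b hb => Submodule.subset_span (mul_mem_radical a hb))
    (fun a ha b _ => Submodule.subset_span (radical_mul_mem b ha))
    (fun a _ b hb => Submodule.subset_span (mul_mem_radical a hb))

lemma isNilpotentIdeal_without [FiniteDimensional F A] (i : Fin q) :
    IsNilpotentIdeal (U.without i) (radical F A) (nilpotencyIndex F A) := by
  have := isNilpotentIdeal_spanSubalgebra
    (hSS := by
      rintro _ ⟨m, hm, rfl⟩ _ ⟨m', -, rfl⟩
      exact U.unit_mul_unit_mem m m' hm)
    (hST := fun a _ b hb => Submodule.subset_span (mul_mem_radical a hb))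
    (hTS := fun a ha b _ => Submodule.subset_span (radical_mul_mem b ha))
    (hTT := fun a _ b hb => Submodule.subset_span (mul_mem_radical a hb))
    (S := U.unit '' {m | m.1 ∈ ({i}ᶜ : Set (Fin q))}) (T := (radical F A : Set A))
    (m := nilpotencyIndex F A) (by
      rw [Submodule.span_eq]
      exact (isNilpotentIdeal_radical F A).prod_eq_zero)
  rwa [Submodule.span_eq] at this

open Classical in
/-- The matrix units outside the `i`-th component. -/
noncomputable def unitsWithout (i : Fin q) : Finset A :=
  (Finset.univ.filter fun m : UnitIndex U.k => m.1 ≠ i).image U.unit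

lemma coe_unitsWithout (i : Fin q) :
    (U.unitsWithout i : Set A) = U.unit '' {m | m.1 ∈ ({i}ᶜ : Set (Fin q))} := by
  simp [unitsWithout]

lemma card_unitsWithout_lt (i : Fin q) :
    (U.unitsWithout i).card < Fintype.card (UnitIndex U.k) := by
  classical
  refine lt_of_le_of_lt Finset.card_image_le ?_
  rw [← Finset.card_univ]
  refine Finset.card_lt_card ((Finset.filter_ssubset).2 ⟨⟨i, 0, 0⟩, by simp⟩)

lemma mem_without {i : Fin q} {a : A} :
    a ∈ U.without i ↔ a ∈ Submodule.span F (U.unitsWithout i : Set A) ⊔ radical F A := by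
  rw [coe_unitsWithout]
  change a ∈ Submodule.span F (_ ∪ _) ↔ _
  rw [Submodule.span_union, Submodule.span_eq]

/-! ### Truncation -/

variable (F) in
/-- The polynomials in one variable modulo the `m`-th power of the variable. -/
abbrev Truncated (m : ℕ) : Type u := AdjoinRoot ((Polynomial.X : Polynomial F) ^ m)

variable (F) in
lemma root_pow_eq_zero (m : ℕ) : (AdjoinRoot.root ((Polynomial.X : Polynomial F) ^ m)) ^ m = 0 := by
  rw [← AdjoinRoot.mk_X, ← map_pow, AdjoinRoot.mk_self]

variable (F) in
lemma root_pow_ne_zero {m k : ℕ} (h : k < m) :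
    (AdjoinRoot.root ((Polynomial.X : Polynomial F) ^ m)) ^ k ≠ 0 := by
  rw [← AdjoinRoot.mk_X, ← map_pow, Ne, AdjoinRoot.mk_eq_zero, Polynomial.X_pow_dvd_iff]
  intro h'
  simpa using h' k h

instance (m : ℕ) : FiniteDimensional F (Truncated F m) :=
  (Polynomial.monic_X_pow m).finite_adjoinRoot

/-- `J ⊗ t`, in the tensor product with the truncated polynomials. -/
def truncRadicalSet (F : Type u) [Field F] (A : Type v) [NonUnitalRing A] [Module F A]
    [IsScalarTower F A A] [SMulCommClass F A A] (m : ℕ) : Set (A ⊗[F] Truncated F m) :=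
  {y | ∃ a ∈ radical F A, ∃ z, y = a ⊗ₜ (AdjoinRoot.root _ * z)}

/-- The semisimple part together with `J ⊗ t`. -/
noncomputable def trunc (m : ℕ) : NonUnitalSubalgebra F (A ⊗[F] Truncated F m) :=
  spanSubalgebra (Set.range fun i => U.unit i ⊗ₜ 1) (truncRadicalSet F A m)
    (by
      rintro _ ⟨m, rfl⟩ _ ⟨m', rfl⟩
      dsimp only
      rw [Algebra.TensorProduct.tmul_mul_tmul, one_mul]
      obtain h | ⟨m'', -, h⟩ := U.unit_mul_unit m m'
      · rw [h, zero_tmul]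
        exact zero_mem _
      · rw [h]
        exact Submodule.subset_span ⟨m'', rfl⟩)
    (by
      rintro _ ⟨m, rfl⟩ _ ⟨a, ha, z, rfl⟩
      rw [Algebra.TensorProduct.tmul_mul_tmul, one_mul]
      exact Submodule.subset_span ⟨_, mul_mem_radical _ ha, z, rfl⟩)
    (by
      rintro _ ⟨a, ha, z, rfl⟩ _ ⟨m, rfl⟩
      dsimp only
      rw [Algebra.TensorProduct.tmul_mul_tmul, mul_one]
      exact Submodule.subset_span ⟨_, radical_mul_mem _ ha, z, rfl⟩)
    (by
      rintro _ ⟨a, ha, z, rfl⟩ _ ⟨b, hb, z', rfl⟩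
      rw [Algebra.TensorProduct.tmul_mul_tmul, mul_assoc]
      exact Submodule.subset_span ⟨_, radical_mul_mem _ ha, _, rfl⟩)

/-- Each factor contributes one power of `t`. The empty list is excluded because its product is the
adjoined unit. -/
lemma exists_prod_eq_of_truncRadicalSet (m : ℕ) (l : List (A ⊗[F] Truncated F m)) (hl : l ≠ [])
    (h : ∀ a ∈ l, a ∈ Submodule.span F (truncRadicalSet F A m)) :
    ∃ y ∈ Submodule.span F {y : A ⊗[F] Truncated F m |
        ∃ a z, y = a ⊗ₜ (AdjoinRoot.root _ ^ l.length * z)},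
      (l.map (Unitization.inr : A ⊗[F] Truncated F m → Unitization F _)).prod =
        Unitization.inr y := by
  induction l with
  | nil => exact absurd rfl hl
  | cons x l ih =>
    have hx := h x (by simp)
    by_cases hl0 : l = []
    · subst hl0
      refine ⟨x, Submodule.span_mono ?_ hx, by simp⟩
      rintro _ ⟨a, -, z, rfl⟩
      exact ⟨a, z, by simp⟩
    · obtain ⟨y, hy, hly⟩ := ih hl0 fun a ha => h a (by simp [ha])
      refine ⟨x * y, mul_mem_of_span ?_ hx hy, by simp [hly]⟩
      rintro _ ⟨a, -, z, rfl⟩ _ ⟨b, z', rfl⟩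
      refine Submodule.subset_span ⟨a * b, z * z', ?_⟩
      rw [Algebra.TensorProduct.tmul_mul_tmul, List.length_cons, pow_succ']
      congr 1
      ring

/-- A product of `m` factors carries `t ^ m = 0`. For `m = 0` the empty product would have to
vanish, hence `hm`. -/
lemma isNilpotentIdeal_trunc {m : ℕ} (hm : 1 ≤ m) :
    IsNilpotentIdeal (U.trunc m) (Submodule.span F (truncRadicalSet F A m)) m := by
  refine isNilpotentIdeal_spanSubalgebra fun l hl h => ?_
  obtain ⟨y, hy, hly⟩ := exists_prod_eq_of_truncRadicalSet m l
    (by rintro rfl; simp at hl; omega) h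
  have : Submodule.span F {y : A ⊗[F] Truncated F m |
      ∃ a z, y = a ⊗ₜ (AdjoinRoot.root _ ^ l.length * z)} ≤ ⊥ := by
    rw [Submodule.span_le]
    rintro _ ⟨a, z, rfl⟩
    rw [hl, root_pow_eq_zero, zero_mul, tmul_zero]
    exact zero_mem _
  rw [hly, (Submodule.mem_bot F).1 (this hy), Unitization.inr_zero]

open Classical in
/-- The matrix units, in the tensor product with the truncated polynomials. -/
noncomputable def truncUnits (m : ℕ) : Finset (A ⊗[F] Truncated F m) :=
  Finset.univ.image fun i => U.unit i ⊗ₜ 1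

lemma coe_truncUnits (m : ℕ) : (U.truncUnits m : Set (A ⊗[F] Truncated F m)) =
    Set.range fun i => U.unit i ⊗ₜ 1 := by
  simp [truncUnits]

open Classical in
lemma card_truncUnits_le (m : ℕ) : (U.truncUnits m).card ≤ Fintype.card (UnitIndex U.k) :=
  Finset.card_image_le

lemma mem_trunc {m : ℕ} {a : A ⊗[F] Truncated F m} :
    a ∈ U.trunc m ↔ a ∈ Submodule.span F (U.truncUnits m : Set (A ⊗[F] Truncated F m)) ⊔
      Submodule.span F (truncRadicalSet F A m) := by
  rw [coe_truncUnits, ← Submodule.span_union]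
  rfl

/-! ### Evaluation on pure tensors -/

section Tensor

variable {R : Type*} [CommRing R] [Algebra F R]

lemma lift_tmul (e : ℕ → A) (z : ℕ → R) (w : FreeSemigroup ℕ) :
    FreeSemigroup.lift (fun x => e x ⊗ₜ[F] z x) w =
      FreeSemigroup.lift e w ⊗ₜ ((letters w).map z).prod := by
  induction w using FreeSemigroup.recOnMul with
  | ih1 x => simp [letters_of]
  | ih2 x y hx hy =>
    rw [map_mul, map_mul, hx, hy, Algebra.TensorProduct.tmul_mul_tmul, letters_mul, List.map_append,
      List.prod_append]

lemma eval_tmul {f : FreeAlg F} (hf : IsMultilinear f) (e : ℕ → A) (z : ℕ → R) :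
    eval (fun x => e x ⊗ₜ[F] z x) f = eval e f ⊗ₜ ∏ x ∈ vars f, z x := by
  have key : ∀ w ∈ monomials f, eval (fun x => e x ⊗ₜ[F] z x) (MonoidAlgebra.single w (f.coeff w)) =
      eval e (MonoidAlgebra.single w (f.coeff w)) ⊗ₜ ∏ x ∈ vars f, z x := by
    intro w hw
    rw [eval_single, eval_single, lift_tmul, smul_tmul']
    congr 2
    have := mem_multihomogeneous.1 hf.mem_multihomogeneous w hw
    rw [Finset.prod, ← this, Multiset.map_coe, Multiset.prod_coe]
  conv_lhs => rw [eq_sum_single f]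
  conv_rhs => rw [eq_sum_single f]
  rw [map_sum, map_sum, sum_tmul, ← eq_sum_single f]
  exact Finset.sum_congr rfl key

lemma eq_zero_of_tmul_eq_zero {a : A} {z : R} (hz : z ≠ 0) (h : a ⊗ₜ[F] z = 0) : a = 0 := by
  obtain ⟨φ, hφ⟩ : ∃ φ : Module.Dual F R, φ z ≠ 0 := by
    by_contra! h'
    exact hz ((Module.forall_dual_apply_eq_zero_iff F z).1 h')
  have := congrArg (fun y => TensorProduct.rid F A (LinearMap.lTensor A φ y)) h
  simp only [LinearMap.lTensor_tmul, TensorProduct.rid_tmul, map_zero] at this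
  exact (smul_eq_zero.1 this).resolve_left hφ

/-- By multilinearity it suffices to test pure tensors, and on those the commutative factors split
off. -/
lemma identities_le_tensor {f : FreeAlg F} (hf : IsMultilinear f) (h : f ∈ identities F A) :
    f ∈ identities F (A ⊗[F] R) := by
  intro e
  by_contra hne
  obtain ⟨e', h₁, h₂, h₃⟩ := hf.exists_eval_ne_zero (T := {y | ∃ (a : A) (z : R), a ⊗ₜ z = y})
    (e := e) (fun x => by
      rw [TensorProduct.span_tmul_eq_top]
      trivial) hne
  have : ∀ x, ∃ (a : A) (z : R), a ⊗ₜ z = e' x := by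
    intro x
    by_cases hx : x ∈ vars f
    · exact h₁ x hx
    · exact ⟨0, 0, by rw [h₂ x hx, zero_tmul]⟩
  choose a z haz using this
  apply h₃
  rw [← funext haz, eval_tmul hf, h, zero_tmul]

end Tensor

/-- An identity of the truncation vanishes on all evaluations with fewer than `m` radical values. -/
lemma eval_eq_zero_of_mem_trunc {m : ℕ} {f : FreeAlg F} (hf : IsMultilinear f)
    (h : f ∈ identities F (U.trunc m)) {e : ℕ → A} {R : Finset ℕ} (hR : R ⊆ vars f)
    (hcard : R.card < m) (he : ∀ x ∈ vars f, x ∉ R → e x ∈ Submodule.span F (Set.range U.unit))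
    (heR : ∀ x ∈ R, e x ∈ radical F A) : eval e f = 0 := by
  classical
  rw [mem_identities_subalgebra] at h
  set e' : ℕ → A := fun x => if x ∈ vars f then e x else 0 with he'
  -- Marking the radical variables by `t` places the evaluation in the truncation; its value is
  -- `eval e f ⊗ t ^ |R|`, and `t ^ |R| ≠ 0` because `|R| < m`.
  set z : ℕ → Truncated F m := fun x => if x ∈ R then AdjoinRoot.root _ else 1 with hz
  have h₁ := h (fun x => e' x ⊗ₜ[F] z x) (fun x => by
    by_cases hxR : x ∈ R
    · simp only [he', hz, hR hxR, hxR, if_true]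
      exact Submodule.subset_span (Or.inr ⟨e x, heR x hxR, 1, by rw [mul_one]⟩)
    · by_cases hx : x ∈ vars f
      · simp only [he', hz, hx, hxR, if_true, if_false]
        have hle : Submodule.span F (Set.range U.unit) ≤
            ((U.trunc m).toSubmodule).comap ((TensorProduct.mk F A (Truncated F m)).flip 1) := by
          rw [Submodule.span_le]
          rintro _ ⟨i, rfl⟩
          exact Submodule.subset_span (Or.inl ⟨i, rfl⟩)
        exact hle (he x hx hxR)
      · simp only [he', hx, if_false, zero_tmul]
        exact zero_mem _)
  rw [eval_tmul hf] at h₁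
  have hprod : ∏ x ∈ vars f, z x = AdjoinRoot.root _ ^ R.card := by
    rw [← Finset.prod_subset hR fun x _ hx => by simp [hz, hx]]
    rw [← Finset.prod_const]
    exact Finset.prod_congr rfl fun x hx => by simp only [hz, hx, if_true]
  rw [hprod] at h₁
  rw [← eq_zero_of_tmul_eq_zero (root_pow_ne_zero F hcard) h₁]
  exact eval_congr fun x hx => by simp [he', hx]

end MatrixUnits

end PIAlg

namespace PIAlg

open TensorProduct

/-! ### Fullness and property `K` as membership in `T`-ideals -/

section Characterization

variable {F : Type u} [Field F] {A : Type v} [NonUnitalRing A] [Module F A]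
  [IsScalarTower F A A] [SMulCommClass F A A]

namespace WedderburnDecomposition

variable {W : WedderburnDecomposition F A} {U : MatrixUnits F A W.q}

lemma unit_mem_component (hU : ∀ i, (W.component i).toSubmodule =
    Submodule.span F (Set.range fun p : Fin (U.k i) × Fin (U.k i) => U.E i p.1 p.2))
    (m : UnitIndex U.k) : U.unit m ∈ W.component m.1 := by
  change _ ∈ (W.component m.1).toSubmodule
  rw [hU]
  exact Submodule.subset_span ⟨m.2, rfl⟩

lemma component_le_span (hU : ∀ i, (W.component i).toSubmodule =
    Submodule.span F (Set.range fun p : Fin (U.k i) × Fin (U.k i) => U.E i p.1 p.2))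
    {i : Fin W.q} {s : Set (Fin W.q)} (hi : i ∈ s) {a : A} (ha : a ∈ W.component i) :
    a ∈ Submodule.span F (U.unit '' {m | m.1 ∈ s}) := by
  change a ∈ (W.component i).toSubmodule at ha
  rw [hU] at ha
  refine Submodule.span_mono ?_ ha
  rintro _ ⟨p, rfl⟩
  exact ⟨⟨i, p⟩, hi, rfl⟩

/-- Fullness means that `f` vanishes on the subalgebras that miss a simple component. -/
lemma isFullFor_iff (hU : ∀ i, (W.component i).toSubmodule =
    Submodule.span F (Set.range fun p : Fin (U.k i) × Fin (U.k i) => U.E i p.1 p.2))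
    {f : FreeAlg F} (hf : IsMultilinear f) :
    W.IsFullFor f ↔ ∀ i, f ∈ identities F (U.without i) := by
  constructor
  · intro h i
    rw [MatrixUnits.without, hf.mem_identities_spanSubalgebra]
    intro e he he0
    by_contra hne
    have hpure : W.IsPure e := by
      intro x
      by_cases hx : x ∈ vars f
      · rcases he x hx with ⟨m, -, hm⟩ | hr
        · exact Or.inr ⟨m.1, hm ▸ unit_mem_component hU m⟩
        · exact Or.inl hr
      · exact Or.inl (by rw [he0 x hx]; exact zero_mem _)
    obtain ⟨x, hx, hxi⟩ := h e hpure hne i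
    -- The value at `x` lies in the `i`-th component and also in another component or in the
    -- radical, hence is zero.
    refine hne (hf.eval_eq_zero_of_eq_zero hx ?_)
    rcases he x hx with ⟨m, hm, hmx⟩ | hr
    · have hmem := unit_mem_component hU m
      rw [hmx] at hmem
      exact Submodule.disjoint_def.1 (W.disjoint_component (i := i) (j := m.1) (Ne.symm hm)) _ hxi
        hmem
    · exact Submodule.disjoint_def.1 (W.disjoint_radical i) _ hxi hr
  · intro h e he hne i
    by_contra! hall
    classical
    have := mem_identities_subalgebra.1 (h i) (fun x => if x ∈ vars f then e x else 0) fun x => by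
      split_ifs with hx
      · rcases he x with hr | ⟨j, hj⟩
        · exact Submodule.subset_span (Or.inr hr)
        · refine Submodule.span_mono Set.subset_union_left (component_le_span hU (i := j) ?_ hj)
          rintro rfl
          exact hall x hx hj
      · exact zero_mem _
    exact hne ((eval_congr fun x hx => by simp [hx]).trans this)

/-- Property `K` means that `f` is an identity of the truncation. -/
lemma hasPropertyK_iff (hU : ∀ i, (W.component i).toSubmodule =
    Submodule.span F (Set.range fun p : Fin (U.k i) × Fin (U.k i) => U.E i p.1 p.2))
    {f : FreeAlg F} (hf : IsMultilinear f) :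
    W.HasPropertyK f ↔ f ∈ identities F (U.trunc (nilpotencyIndex F A - 1)) := by
  classical
  set m := nilpotencyIndex F A - 1
  constructor
  · intro h
    rw [MatrixUnits.trunc, hf.mem_identities_spanSubalgebra]
    intro e he he0
    by_contra hne
    -- On the spanning set every value is a pure tensor, with second factor divisible by `t` in the
    -- radical case and equal to `1` in the semisimple case.
    have hex : ∀ x, ∃ (a : A) (z : MatrixUnits.Truncated F m), a ⊗ₜ z = e x ∧
        ((a ∈ radical F A ∧ AdjoinRoot.root _ ∣ z) ∨ ((∃ i, a ∈ W.component i) ∧ z = 1)) := by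
      intro x
      by_cases hx : x ∈ vars f
      · rcases he x hx with ⟨i, hi⟩ | ⟨a, ha, z, hz⟩
        · exact ⟨U.unit i, 1, hi, Or.inr ⟨⟨i.1, unit_mem_component hU i⟩, rfl⟩⟩
        · exact ⟨a, _, hz.symm, Or.inl ⟨ha, dvd_mul_right _ _⟩⟩
      · exact ⟨0, 0, by rw [he0 x hx, zero_tmul], Or.inl ⟨zero_mem _, dvd_zero _⟩⟩
    choose a z haz h' using hex
    rw [← funext haz, MatrixUnits.eval_tmul hf] at hne
    have ha : eval a f ≠ 0 := fun h0 => hne (by rw [h0, zero_tmul])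
    have hpure : W.IsPure a := fun x => (h' x).imp (fun h => h.1) fun h => h.1
    have hcard : m ≤ ((vars f).filter fun x => a x ∈ radical F A).card := by
      have := not_lt.1 fun hlt => ha (h a hpure hlt)
      rwa [show {x | x ∈ vars f ∧ a x ∈ radical F A} =
        (((vars f).filter fun x => a x ∈ radical F A : Finset ℕ) : Set ℕ) by ext; simp,
        Set.ncard_coe_finset] at this
    -- A first factor that is both radical and semisimple is zero, which is impossible for a
    -- variable of `f` in a nonzero evaluation. So every radical variable contributes a factor `t`.
    have hdvd : (AdjoinRoot.root ((Polynomial.X : Polynomial F) ^ m)) ^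
        ((vars f).filter (fun x => a x ∈ radical F A)).card ∣ ∏ x ∈ vars f, z x := by
      rw [← Finset.prod_const]
      refine (Finset.prod_dvd_prod_of_dvd _ z fun x hx => ?_).trans
        (Finset.prod_dvd_prod_of_subset _ _ z (Finset.filter_subset _ _))
      rw [Finset.mem_filter] at hx
      rcases h' x with hr | ⟨⟨i, hi⟩, -⟩
      · exact hr.2
      · exact absurd (hf.eval_eq_zero_of_eq_zero hx.1
          (Submodule.disjoint_def.1 (W.disjoint_radical i) _ hi hx.2)) ha
    have hzero := (pow_dvd_pow _ hcard).trans hdvd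
    rw [MatrixUnits.root_pow_eq_zero, zero_dvd_iff] at hzero
    exact hne (by rw [hzero, tmul_zero])
  · intro h e he hlt
    rw [show {x | x ∈ vars f ∧ e x ∈ radical F A} =
        (((vars f).filter fun x => e x ∈ radical F A : Finset ℕ) : Set ℕ) by ext; simp,
        Set.ncard_coe_finset] at hlt
    refine U.eval_eq_zero_of_mem_trunc hf h (Finset.filter_subset _ _) hlt (fun x hx hxR => ?_)
      fun x hx => (Finset.mem_filter.1 hx).2
    rcases he x with hr | ⟨i, hi⟩
    · exact absurd (Finset.mem_filter.2 ⟨hx, hr⟩) hxR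
    · exact Submodule.span_mono (Set.image_subset_range _ _)
        (component_le_span hU (Set.mem_univ i) hi)

end WedderburnDecomposition

end Characterization

/-! ### Consequences of alternation, and the use of basicness -/

section Kemer

variable {F : Type u} [Field F] {A : Type v} [NonUnitalRing A] [Module F A]
  [IsScalarTower F A A] [SMulCommClass F A A] [FiniteDimensional F A]
  {q : ℕ} (U : MatrixUnits F A q)

namespace MatrixUnits

/-- A nonidentity alternates on fewer than `n` sets that are larger than the semisimple part. -/
lemma card_lt_of_alternating (U : MatrixUnits F A q) {f : FreeAlg F} (hf : IsMultilinear f) (hfA : f ∉ identities F A)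
    {T : Type*} [Fintype T] {S : T → Finset ℕ} (hdisj : Pairwise fun i j => Disjoint (S i) (S j))
    (hcard : ∀ t, semisimpleDim F A < (S t).card) (halt : ∀ t, IsAlternatingOn (S t) f) :
    Fintype.card T < nilpotencyIndex F A := by
  classical
  by_contra! hn
  refine hfA fun e => (isNilpotentIdeal_radical F A).eval_eq_zero_of_alternating
    (C := Finset.univ.image U.unit) ?_ (fun _ _ => trivial) hf hn hdisj (fun t => ?_) halt
    fun _ => trivial
  · rw [Finset.coe_image, Finset.coe_univ, Set.image_univ, U.isCompl'.sup_eq_top]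
    exact le_top
  · refine lt_of_le_of_lt ?_ (hcard t)
    rw [U.semisimpleDim_eq]
    exact Finset.card_image_le

/-- Deleting a component leaves fewer than `d(A)` matrix units, so already sets of size `d(A)` force
radical values, and `n_A` of these give zero. -/
lemma mem_identities_without {f : FreeAlg F} (hf : IsMultilinear f) {T : Type*} [Fintype T]
    {S : T → Finset ℕ} (hdisj : Pairwise fun i j => Disjoint (S i) (S j))
    (hT : nilpotencyIndex F A ≤ Fintype.card T) (hcard : ∀ t, semisimpleDim F A ≤ (S t).card)
    (halt : ∀ t, IsAlternatingOn (S t) f) (i : Fin q) : f ∈ identities F (U.without i) := by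
  rw [mem_identities_subalgebra]
  intro e he
  refine (U.isNilpotentIdeal_without i).eval_eq_zero_of_alternating (C := U.unitsWithout i)
    (fun a ha => U.mem_without.1 ha) (fun a ha => U.mem_without.2 (Submodule.mem_sup_left
      (Submodule.subset_span ha))) hf hT hdisj (fun t => ?_) halt he
  refine (U.card_unitsWithout_lt i).trans_le ?_
  rw [← U.semisimpleDim_eq]
  exact hcard t

/-- For exponent zero the coefficient ring is the zero ring, in agreement with property `K` being
vacuous when `n_A = 1`. -/
lemma mem_identities_trunc_zero (f : FreeAlg F) : f ∈ identities F (U.trunc 0) := by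
  have h0 : (1 : Truncated F 0) = 0 := by
    have := root_pow_eq_zero F 0
    rwa [pow_zero] at this
  have hz : ∀ y : A ⊗[F] Truncated F 0, y = 0 := by
    intro y
    induction y using TensorProduct.induction_on with
    | zero => rfl
    | tmul a z => rw [← mul_one z, h0, mul_zero, tmul_zero]
    | add y z hy hz => rw [hy, hz, add_zero]
  rw [mem_identities_subalgebra]
  exact fun e _ => hz _

/-- In the truncation already `m` radical values give zero, and each set larger than `d(A)` forces
one. -/
lemma mem_identities_trunc {f : FreeAlg F} (hf : IsMultilinear f) {T : Type*} [Fintype T]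
    {S : T → Finset ℕ} (hdisj : Pairwise fun i j => Disjoint (S i) (S j)) {m : ℕ}
    (hT : m ≤ Fintype.card T) (hcard : ∀ t, semisimpleDim F A < (S t).card)
    (halt : ∀ t, IsAlternatingOn (S t) f) : f ∈ identities F (U.trunc m) := by
  rcases Nat.eq_zero_or_pos m with rfl | hm
  · exact U.mem_identities_trunc_zero f
  rw [mem_identities_subalgebra]
  intro e he
  refine (U.isNilpotentIdeal_trunc hm).eval_eq_zero_of_alternating (C := U.truncUnits m)
    (fun a ha => U.mem_trunc.1 ha) (fun a ha => U.mem_trunc.2 (Submodule.mem_sup_left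
      (Submodule.subset_span ha))) hf hT hdisj (fun t => ?_) halt he
  refine (U.card_truncUnits_le m).trans_lt ?_
  rw [← U.semisimpleDim_eq]
  exact hcard t

lemma exists_fdAlgebra_without (i : Fin q) : ∃ b : FDAlgebra F,
    identities F b.carrier = identities F (U.without i) ∧ par F b.carrier < par F A := by
  obtain ⟨b, h₁, h₂, -⟩ := exists_fdAlgebra (U.isNilpotentIdeal_without i)
    (C := U.unitsWithout i) (fun a ha => U.mem_without.2 (Submodule.mem_sup_left
      (Submodule.subset_span ha))) fun a ha => U.mem_without.1 ha
  refine ⟨b, h₁, ?_⟩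
  have := U.card_unitsWithout_lt i
  rw [← U.semisimpleDim_eq] at this
  rw [par, par, Prod.Lex.toLex_lt_toLex]
  exact Or.inl (h₂.trans_lt this)

/-- If the semisimple dimension does not drop, then the nilpotency index does, from `n_A` to at most
`n_A - 1`. -/
lemma exists_fdAlgebra_trunc (h : 1 ≤ nilpotencyIndex F A - 1) : ∃ b : FDAlgebra F,
    identities F b.carrier = identities F (U.trunc (nilpotencyIndex F A - 1)) ∧
      par F b.carrier < par F A := by
  obtain ⟨b, h₁, h₂, h₃⟩ := exists_fdAlgebra (U.isNilpotentIdeal_trunc h)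
    (C := U.truncUnits _) (fun a ha => U.mem_trunc.2 (Submodule.mem_sup_left
      (Submodule.subset_span ha))) fun a ha => U.mem_trunc.1 ha
  refine ⟨b, h₁, ?_⟩
  have h₄ := U.card_truncUnits_le (nilpotencyIndex F A - 1)
  rw [← U.semisimpleDim_eq] at h₄
  rw [par, par, Prod.Lex.toLex_lt_toLex]
  rcases lt_or_eq_of_le (h₂.trans h₄) with hlt | heq
  · exact Or.inl hlt
  · have := h₃ (by omega)
    exact Or.inr ⟨heq, by change _ - 1 < _ - 1; omega⟩

end MatrixUnits

lemma mem_identities_pi {ι : Type*} {B : ι → Type w} [∀ i, NonUnitalRing (B i)]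
    [∀ i, Module F (B i)] [∀ i, IsScalarTower F (B i) (B i)] [∀ i, SMulCommClass F (B i) (B i)]
    {f : FreeAlg F} : f ∈ identities F (∀ i, B i) ↔ ∀ i, f ∈ identities F (B i) := by
  classical
  let π : ∀ i, (∀ i, B i) →ₙₐ[F] B i := fun i =>
    { toFun := fun x => x i
      map_smul' := fun _ _ => rfl
      map_zero' := rfl
      map_add' := fun _ _ => rfl
      map_mul' := fun _ _ => rfl }
  constructor
  · intro h i e
    have := congrArg (π i) (h fun x => Pi.single i (e x))
    rw [algHom_eval] at this
    simpa [π] using this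
  · intro h e
    funext i
    change π i (eval e f) = 0
    rw [algHom_eval]
    exact h i _

/-- A nontrivial basic algebra has a multilinear nonidentity that is full and has property `K`. -/
theorem IsBasic.exists_full_propertyK [CharZero F] [Nontrivial A] (hA : IsBasic F A) :
    ∃ f : FreeAlg F, IsMultilinear f ∧ f ∉ identities F A ∧
      (∀ i, f ∈ identities F (U.without i)) ∧
        f ∈ identities F (U.trunc (nilpotencyIndex F A - 1)) := by
  set m := nilpotencyIndex F A - 1 with hm
  -- The index `none` stands for the truncation. It is omitted for `m = 0`, where the parameter
  -- could not drop and membership is automatic.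
  let ι := {o : Option (Fin q) // o = none → 1 ≤ m}
  have hb : ∀ o : ι, ∃ b : FDAlgebra F, identities F b.carrier =
      o.1.elim (identities F (U.trunc m)) (fun i => identities F (U.without i)) ∧
        par F b.carrier < par F A := by
    rintro ⟨_ | i, h⟩
    · exact U.exists_fdAlgebra_trunc (h rfl)
    · exact U.exists_fdAlgebra_without i
  choose b hid hpar using hb
  -- Basicness only excludes products with at least one factor. With no components and `m = 0` the
  -- algebra would equal its radical, and that radical would be zero.
  have hne : Nonempty ι := by
    by_contra hempty
    rw [not_nonempty_iff] at hempty
    have hm0 : ¬ 1 ≤ m := fun h => hempty.false ⟨none, fun _ => h⟩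
    have hq : IsEmpty (Fin q) := ⟨fun i => hempty.false ⟨some i, by simp⟩⟩
    have htop := U.isCompl'.sup_eq_top
    rw [Set.range_eq_empty, Submodule.span_empty, bot_sup_eq] at htop
    obtain ⟨a, ha⟩ := exists_ne (0 : A)
    have hn : nilpotencyIndex F A = 1 := by
      have := one_le_nilpotencyIndex (F := F) (A := A)
      omega
    have := (isNilpotentIdeal_radical F A).prod_eq_zero [a] (by simp [hn])
      (by simp [htop])
    exact ha (Unitization.inr_injective (R := F) (by simpa using this))
  obtain ⟨r, ⟨ε⟩⟩ := Finite.exists_equiv_fin ι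
  have hr : 1 ≤ r := by
    obtain ⟨o⟩ := hne
    exact Nat.one_le_iff_ne_zero.2 (by rintro rfl; exact (ε o).elim0)
  have hneq := hA r (fun j => (b (ε.symm j)).carrier) hr fun j => hpar _
  have hmem : ∀ f, f ∈ identities F (∀ j, (b (ε.symm j)).carrier) ↔
      ∀ o : ι, f ∈ o.1.elim (identities F (U.trunc m)) (fun i => identities F (U.without i)) := by
    intro f
    rw [mem_identities_pi]
    constructor
    · intro h o
      rw [← hid]
      obtain ⟨j, rfl⟩ := ε.symm.surjective o
      exact h j
    · intro h j
      rw [hid]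
      exact h _
  have hle : identities F A ≤ identities F (∀ j, (b (ε.symm j)).carrier) := by
    intro f hf
    rw [hmem]
    rintro ⟨_ | i, h⟩
    -- Only multilinear identities are known to survive extension of scalars, so a multilinear
    -- counterexample is extracted first.
    · by_contra hnot
      obtain ⟨g, hg, hgm, hgn⟩ := exists_multilinear_notMem isTIdeal_identities
        (isTIdeal_identities (A := A)) hf hnot
      exact hgn (mem_identities_subalgebra.2 fun e _ => MatrixUnits.identities_le_tensor hgm hg e)
    · exact mem_identities_subalgebra.2 fun e _ => hf e
  obtain ⟨f, hf, hfA⟩ : ∃ f ∈ identities F (∀ j, (b (ε.symm j)).carrier), f ∉ identities F A := by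
    by_contra! h
    exact hneq (le_antisymm hle h)
  obtain ⟨g, hg, hgm, hgA⟩ := exists_multilinear_notMem (isTIdeal_identities (A := A))
    isTIdeal_identities hf hfA
  rw [hmem] at hg
  refine ⟨g, hgm, hgA, fun i => hg ⟨some i, by simp⟩, ?_⟩
  by_cases h1 : 1 ≤ m
  · exact hg ⟨none, fun _ => h1⟩
  · have h0 : m = 0 := by omega
    rw [h0]
    exact U.mem_identities_trunc_zero g

end Kemer

end PIAlg

namespace PIAlg

/-! ### A nonzero evaluation adapted to the Peirce decomposition -/

section Framing

variable {F : Type u} [Field F] {A : Type v} [NonUnitalRing A] [Module F A]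
  [IsScalarTower F A A] [SMulCommClass F A A] {q : ℕ}

namespace MatrixUnits

variable (U : MatrixUnits F A q)

/-- The identity element of a simple component. -/
def one (i : Fin q) : A := ∑ a, U.E i a a

lemma one_mul_unit (i : Fin q) (m : UnitIndex U.k) :
    U.one i * U.unit m = if m.1 = i then U.unit m else 0 := by
  obtain ⟨j, a, b⟩ := m
  rw [one, Finset.sum_mul]
  split_ifs with h
  · change j = i at h
    subst h
    rw [Finset.sum_eq_single a]
    · exact U.isMatrixUnits.mul_same j a a b
    · exact fun c _ hc => U.isMatrixUnits.mul_ne j c c a b hc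
    · simp
  · exact Finset.sum_eq_zero fun c _ => U.isMatrixUnits.mul_orth i j (Ne.symm h) c c a b

lemma unit_mul_one (i : Fin q) (m : UnitIndex U.k) :
    U.unit m * U.one i = if m.1 = i then U.unit m else 0 := by
  obtain ⟨j, a, b⟩ := m
  rw [one, Finset.mul_sum]
  split_ifs with h
  · change j = i at h
    subst h
    rw [Finset.sum_eq_single b]
    · exact U.isMatrixUnits.mul_same j a b b
    · exact fun c _ hc => U.isMatrixUnits.mul_ne j a b c c (Ne.symm hc)
    · simp
  · exact Finset.sum_eq_zero fun c _ => U.isMatrixUnits.mul_orth j i h a b c c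

lemma one_mul_one (i : Fin q) : U.one i * U.one i = U.one i := by
  conv_lhs => rw [one, Finset.sum_mul]
  refine Finset.sum_congr rfl fun a _ => ?_
  exact (U.unit_mul_one i ⟨i, a, a⟩).trans (if_pos rfl)

/-- The positions of the primitive idempotents. -/
abbrev DiagIndex : Type := Σ i, Fin (U.k i)

/-- The primitive idempotents. -/
def diag (p : U.DiagIndex) : A := U.E p.1 p.2 p.2

lemma diag_mul_diag (p p' : U.DiagIndex) :
    U.diag p * U.diag p' = if p = p' then U.diag p else 0 := by
  obtain ⟨i, a⟩ := p
  obtain ⟨j, b⟩ := p'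
  split_ifs with h
  · cases h
    exact U.isMatrixUnits.mul_same i a a a
  · by_cases hij : i = j
    · subst hij
      exact U.isMatrixUnits.mul_ne i a a b b fun hab => h (by rw [hab])
    · exact U.isMatrixUnits.mul_orth i j hij a a b b

/-- An element is left homogeneous if each primitive idempotent fixes or annihilates it. -/
def LeftHomogeneous (v : A) : Prop := ∀ p, U.diag p * v = v ∨ U.diag p * v = 0

/-- An element is right homogeneous if each primitive idempotent fixes or annihilates it. -/
def RightHomogeneous (v : A) : Prop := ∀ p, v * U.diag p = v ∨ v * U.diag p = 0

/-- Left Peirce decomposition. As `A` need not be unital, a remainder `v - ∑ p, U.diag p * v`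
appears; every primitive idempotent annihilates it. -/
lemma radical_le_span_leftHomogeneous {v : A} (hv : v ∈ radical F A) :
    v ∈ Submodule.span F {w | w ∈ radical F A ∧ U.LeftHomogeneous w} := by
  rw [← add_sub_cancel (∑ p, U.diag p * v) v]
  refine Submodule.add_mem _ (Submodule.sum_mem _ fun p _ => Submodule.subset_span
    ⟨mul_mem_radical _ hv, fun p' => ?_⟩) (Submodule.subset_span ⟨sub_mem hv (sum_mem fun p _ =>
      mul_mem_radical _ hv), fun p' => Or.inr ?_⟩)
  · rw [← mul_assoc, diag_mul_diag]
    split_ifs with h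
    · exact Or.inl (by rw [h])
    · exact Or.inr (zero_mul _)
  · rw [mul_sub, Finset.mul_sum, Finset.sum_eq_single p']
    · rw [← mul_assoc, diag_mul_diag, if_pos rfl, sub_self]
    · intro p _ hp
      rw [← mul_assoc, diag_mul_diag, if_neg (Ne.symm hp), zero_mul]
    · simp

lemma LeftHomogeneous.mem_span {v : A} (hl : U.LeftHomogeneous v) (hv : v ∈ radical F A) :
    v ∈ Submodule.span F
      {w | w ∈ radical F A ∧ U.LeftHomogeneous w ∧ U.RightHomogeneous w} := by
  rw [← add_sub_cancel (∑ p, v * U.diag p) v]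
  refine Submodule.add_mem _ (Submodule.sum_mem _ fun p _ => Submodule.subset_span
    ⟨radical_mul_mem _ hv, fun p' => ?_, fun p' => ?_⟩) (Submodule.subset_span
      ⟨sub_mem hv (sum_mem fun p _ => radical_mul_mem _ hv), fun p' => ?_, fun p' => Or.inr ?_⟩)
  · rw [← mul_assoc]
    rcases hl p' with h | h
    · exact Or.inl (by rw [h])
    · exact Or.inr (by rw [h, zero_mul])
  · rw [mul_assoc, diag_mul_diag]
    split_ifs with h
    · exact Or.inl rfl
    · exact Or.inr (mul_zero _)
  · rw [mul_sub, Finset.mul_sum]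
    simp only [← mul_assoc]
    rcases hl p' with h | h
    · exact Or.inl (by rw [h])
    · exact Or.inr (by simp [h])
  · rw [sub_mul, Finset.sum_mul, Finset.sum_eq_single p']
    · rw [mul_assoc, diag_mul_diag, if_pos rfl, sub_self]
    · intro p _ hp
      rw [mul_assoc, diag_mul_diag, if_neg hp, mul_zero]
    · simp

/-- The matrix units together with the homogeneous elements of the radical. -/
def homogeneousSet : Set A := Set.range U.unit ∪
  {w | w ∈ radical F A ∧ U.LeftHomogeneous w ∧ U.RightHomogeneous w}

lemma span_homogeneousSet (v : A) : v ∈ Submodule.span F U.homogeneousSet := by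
  have h : v ∈ Submodule.span F (Set.range U.unit) ⊔ radical F A := by
    rw [U.isCompl'.sup_eq_top]
    trivial
  have hle : Submodule.span F (Set.range U.unit) ⊔ radical F A ≤
      Submodule.span F U.homogeneousSet := by
    refine sup_le (Submodule.span_mono Set.subset_union_left) fun w hw => ?_
    refine (Submodule.span_le.2 ?_) (U.radical_le_span_leftHomogeneous hw)
    rintro u ⟨hu, hul⟩
    exact Submodule.span_mono Set.subset_union_right (hul.mem_span U hu)
  exact hle h

/-- If no radical value enters the `i`-th component from outside and the component occurs, then its
identity element fixes the value of `f`. -/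
lemma one_mul_eval {i : Fin q} {f : FreeAlg F} (hf : IsMultilinear f) {e : ℕ → A}
    (h : ∀ x ∈ vars f, e x * U.one i = U.one i * e x * U.one i) {x₀ : ℕ} (hx₀ : x₀ ∈ vars f)
    (h₀ : U.one i * e x₀ = e x₀) : U.one i * eval e f = eval e f := by
  apply Unitization.inr_injective (R := F)
  rw [Unitization.inr_mul, inr_eval, Finset.mul_sum]
  refine Finset.sum_congr rfl fun w hw => ?_
  rw [mul_smul_comm]
  congr 1
  have hidem : (Unitization.inr (U.one i) : Unitization F A) * Unitization.inr (U.one i) =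
      Unitization.inr (U.one i) := by
    rw [← Unitization.inr_mul, one_mul_one]
  -- By `h` each value sends the right ideal of `U.one i` into itself, so `U.one i` standing to the
  -- right of a prefix may be copied to its left end.
  have key : ∀ l : List ℕ, (∀ x ∈ l, x ∈ vars f) →
      wordVal F e l * Unitization.inr (U.one i) =
        Unitization.inr (U.one i) * wordVal F e l * Unitization.inr (U.one i) := by
    intro l
    induction l with
    | nil =>
      intro _
      simp only [wordVal, List.map_nil, List.prod_nil, one_mul, mul_one]
      rw [hidem]
    | cons y l ih =>
      intro hl
      have hy : (Unitization.inr (e y) : Unitization F A) * Unitization.inr (U.one i) =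
          Unitization.inr (U.one i) * Unitization.inr (e y) * Unitization.inr (U.one i) := by
        simp only [← Unitization.inr_mul, h y (hl y (by simp))]
      have ih' := ih fun x hx => hl x (by simp [hx])
      rw [wordVal_cons, mul_assoc, mul_assoc, mul_assoc, ih', mul_assoc, ← mul_assoc, hy]
      simp only [mul_assoc]
      rw [← mul_assoc (Unitization.inr (U.one i)) (Unitization.inr (U.one i)), hidem]
  obtain ⟨l₁, l₂, hl⟩ := List.append_of_mem (List.count_pos_iff.1
    (by rw [hf w hw x₀ hx₀]; exact one_pos) : x₀ ∈ letters w)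
  have hl₁ : ∀ x ∈ l₁, x ∈ vars f := fun x hx => mem_vars.2 ⟨w, hw, by rw [hl]; simp [hx]⟩
  have hx : (Unitization.inr (e x₀) : Unitization F A) =
      Unitization.inr (U.one i) * Unitization.inr (e x₀) := by
    rw [← Unitization.inr_mul, h₀]
  rw [hl, wordVal_append, wordVal_cons, hx]
  have := key l₁ hl₁
  simp only [← mul_assoc]
  rw [← this]

/-- A nonzero evaluation of `f` with a choice, for each simple component, of a radical variable that
enters the component from outside, or else of the left end of `f`. -/
structure Framing (f : FreeAlg F) (s : ℕ) where
  e : ℕ → A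
  w : Fin s → ℕ
  w_injective : Function.Injective w
  w_mem : ∀ j, w j ∈ vars f
  radical_mem : ∀ j, e (w j) ∈ radical F A
  semisimple_mem : ∀ x ∈ vars f, x ∉ Set.range w → e x ∈ Set.range U.unit
  β : ∀ i, Fin (U.k i)
  own : ℕ → Option (Fin q)
  out : Option (Fin q)
  own_mem : ∀ x i, own x = some i → x ∈ Set.range w
  own_left : ∀ x i, own x = some i → U.one i * e x = 0
  own_right : ∀ x i, own x = some i → e x * U.E i (β i) (β i) = e x
  own_injective : ∀ x y i, own x = some i → own y = some i → x = y
  out_ne_own : ∀ x i, out = some i → own x ≠ some i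
  cover : ∀ i, out = some i ∨ ∃ x, own x = some i
  eval_ne : eval e f ≠ 0
  out_ne : ∀ i, out = some i → U.E i (β i) (β i) * eval e f ≠ 0

/-- Fullness makes every component occur in the evaluation. If no radical value leads into the
`i`-th component from outside, everything to the left of an occurrence stays inside it, and `U.one
i` fixes the value of `f`. Identity elements of different components being orthogonal, this happens
for at most one `i`, which becomes `out`. -/
theorem exists_framing [FiniteDimensional F A] {f : FreeAlg F} (hf : IsMultilinear f)
    (hfA : f ∉ identities F A) (hfull : ∀ i, f ∈ identities F (U.without i))
    (hK : f ∈ identities F (U.trunc (nilpotencyIndex F A - 1))) :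
    Nonempty (U.Framing f (nilpotencyIndex F A - 1)) := by
  classical
  obtain ⟨e₀, he₀⟩ : ∃ e₀ : ℕ → A, eval e₀ f ≠ 0 := by
    by_contra! h
    exact hfA h
  obtain ⟨e, he, he0, hne⟩ := hf.exists_eval_ne_zero (fun x => U.span_homogeneousSet (e₀ x)) he₀
  have hx0 : ∀ x ∈ vars f, e x ≠ 0 := fun x hx h => hne (hf.eval_eq_zero_of_eq_zero hx h)
  set R := (vars f).filter fun x => e x ∈ radical F A with hR
  have hRv : R ⊆ vars f := Finset.filter_subset _ _
  have hss : ∀ x ∈ vars f, x ∉ R → e x ∈ Set.range U.unit := fun x hx hxR =>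
    (he x hx).resolve_right fun h => hxR (Finset.mem_filter.2 ⟨hx, h.1⟩)
  have hRhom : ∀ x ∈ R, U.LeftHomogeneous (e x) ∧ U.RightHomogeneous (e x) := by
    intro x hx
    obtain ⟨hxv, hxr⟩ := Finset.mem_filter.1 hx
    refine ((he x hxv).resolve_left fun h => hx0 x hxv ?_).2
    exact Submodule.disjoint_def.1 U.isCompl'.disjoint _ (Submodule.subset_span h) hxr
  -- Fewer radical values are excluded by property `K`, more by nilpotency.
  have hcard : R.card = nilpotencyIndex F A - 1 := by
    have h₁ : ¬ R.card < nilpotencyIndex F A - 1 := fun hlt =>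
      hne (U.eval_eq_zero_of_mem_trunc hf hK hRv hlt
        (fun x hx hxR => Submodule.subset_span (hss x hx hxR))
        fun x hx => (Finset.mem_filter.1 hx).2)
    have h₂ : ¬ nilpotencyIndex F A ≤ R.card := fun hle =>
      hne ((isNilpotentIdeal_radical F A).eval_eq_zero hf (fun _ _ => trivial) hRv hle
        fun x hx => (Finset.mem_filter.1 hx).2)
    omega
  -- The radical variable `x` enters component `i` from outside: nothing of the component on its
  -- left, one of the primitive idempotents on its right.
  let P : Fin q → ℕ → Prop := fun i x => x ∈ R ∧ U.one i * e x = 0 ∧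
    ∃ b, e x * U.E i b b = e x
  have hPinj : ∀ x i j, P i x → P j x → i = j := by
    intro x i j hi hj
    by_contra hij
    obtain ⟨hxR, -, b, hb⟩ := hi
    obtain ⟨-, -, c, hc⟩ := hj
    apply hx0 x (hRv hxR)
    rw [← hc, ← hb, mul_assoc, U.isMatrixUnits.mul_orth i j hij, mul_zero]
  have hone : ∀ i, (¬ ∃ x, P i x) → U.one i * eval e f = eval e f := by
    intro i hi
    obtain ⟨x₀, hx₀, m, hm, hmi⟩ : ∃ x ∈ vars f, ∃ m, U.unit m = e x ∧ m.1 = i := by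
      by_contra! hall
      refine hne (mem_identities_subalgebra.1 (hfull i) e fun x => ?_)
      by_cases hx : x ∈ vars f
      · by_cases hxR : x ∈ R
        · exact Submodule.subset_span (Or.inr (Finset.mem_filter.1 hxR).2)
        · obtain ⟨m, hm⟩ := hss x hx hxR
          exact Submodule.subset_span (Or.inl ⟨m, hall x hx m hm, hm⟩)
      · rw [he0 x hx]
        exact zero_mem _
    -- A homogeneous radical value is either annihilated by `U.one i` on the right, or fixed there
    -- by some `E i b b`. In the latter case, since `P i x` fails, some `E i a a` fixes it on the
    -- left, and so does `U.one i`.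
    refine U.one_mul_eval hf (fun x hx => ?_) hx₀ (by rw [← hm, one_mul_unit, if_pos hmi])
    by_cases hxR : x ∈ R
    · by_cases hb : ∃ b, e x * U.E i b b = e x
      · obtain ⟨hl, -⟩ := hRhom x hxR
        have h1 : U.one i * e x ≠ 0 := fun h => hi ⟨x, hxR, h, hb⟩
        obtain ⟨a, ha⟩ : ∃ a, U.E i a a * e x ≠ 0 := by
          by_contra! h
          refine h1 ?_
          rw [one, Finset.sum_mul]
          exact Finset.sum_eq_zero fun a _ => h a
        have ha' : U.E i a a * e x = e x := (hl ⟨i, a⟩).resolve_right ha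
        have : U.one i * e x = e x := by
          rw [← ha', ← mul_assoc]
          congr 1
          exact (U.one_mul_unit i ⟨i, a, a⟩).trans (if_pos rfl)
        rw [this]
      · have : e x * U.one i = 0 := by
          rw [one, Finset.mul_sum]
          refine Finset.sum_eq_zero fun b _ => ?_
          exact ((hRhom x hxR).2 ⟨i, b⟩).resolve_left fun h => hb ⟨b, h⟩
        rw [mul_assoc, this, mul_zero]
    · obtain ⟨m', hm'⟩ := hss x hx hxR
      rw [← hm', one_mul_unit, unit_mul_one]
      split_ifs with h
      · rw [unit_mul_one, if_pos h]
      · rw [zero_mul]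
  -- The frame at component `i` starts and ends at the index `b` where it is inserted: the right end
  -- of an entering value, or a left index at which the value of `f` is nonzero.
  have hβ : ∀ i, ∃ b, (∀ x, P i x → ∃ x, P i x ∧ e x * U.E i b b = e x) ∧
      ((¬ ∃ x, P i x) → U.E i b b * eval e f ≠ 0) := by
    intro i
    by_cases hi : ∃ x, P i x
    · obtain ⟨x, hx⟩ := hi
      obtain ⟨b, hb⟩ := hx.2.2
      exact ⟨b, fun _ _ => ⟨x, hx, hb⟩, fun h => absurd ⟨x, hx⟩ h⟩
    · obtain ⟨b, hb⟩ : ∃ b, U.E i b b * eval e f ≠ 0 := by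
        by_contra! h
        refine hne ?_
        rw [← hone i hi, one, Finset.sum_mul]
        exact Finset.sum_eq_zero fun a _ => h a
      exact ⟨b, fun x hx => absurd ⟨x, hx⟩ hi, fun _ => hb⟩
  choose β hβ₁ hβ₂ using hβ
  have hchoice : ∀ i, ∃ x, (∃ x, P i x) → P i x ∧ e x * U.E i (β i) (β i) = e x := by
    intro i
    by_cases hi : ∃ x, P i x
    · obtain ⟨x, hx⟩ := hi
      obtain ⟨y, hy⟩ := hβ₁ i x hx
      exact ⟨y, fun _ => hy⟩
    · exact ⟨0, fun h => absurd h hi⟩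
  choose Y hY using hchoice
  let own : ℕ → Option (Fin q) := fun x =>
    if h : ∃ i, (∃ x, P i x) ∧ Y i = x then some h.choose else none
  have hown : ∀ x i, own x = some i ↔ (∃ x, P i x) ∧ Y i = x := by
    intro x i
    constructor
    · intro h
      by_cases hx : ∃ i, (∃ x, P i x) ∧ Y i = x
      · simp only [own, hx, dif_pos, Option.some.injEq] at h
        exact h ▸ hx.choose_spec
      · simp [own, hx] at h
    · intro h
      have hx : ∃ i, (∃ x, P i x) ∧ Y i = x := ⟨i, h⟩
      simp only [own, hx, dif_pos, Option.some.injEq]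
      have h' := hx.choose_spec
      have h₁ := (hY _ h'.1).1
      have h₂ := (hY _ h.1).1
      rw [h'.2] at h₁
      rw [h.2] at h₂
      exact hPinj x _ _ h₁ h₂
  let out : Option (Fin q) := if h : ∃ i, ¬ ∃ x, P i x then some h.choose else none
  have hout : ∀ i, out = some i ↔ ¬ ∃ x, P i x := by
    intro i
    constructor
    · intro h
      by_cases hx : ∃ i, ¬ ∃ x, P i x
      · rw [show out = some hx.choose from dif_pos hx, Option.some.injEq] at h
        exact h ▸ hx.choose_spec
      · rw [show out = none from dif_neg hx] at h
        cases h
    · intro h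
      have hx : ∃ i, ¬ ∃ x, P i x := ⟨i, h⟩
      rw [show out = some hx.choose from dif_pos hx, Option.some.injEq]
      -- Two such components would both have identity elements fixing the nonzero value of `f` from
      -- the left, although the product of these elements is zero.
      by_contra hij
      refine hne ?_
      rw [← hone i h, ← hone _ hx.choose_spec, ← mul_assoc]
      have : U.one i * U.one hx.choose = 0 := by
        conv_lhs => rw [one, one, Finset.sum_mul_sum]
        exact Finset.sum_eq_zero fun a _ => Finset.sum_eq_zero fun b _ =>
          U.isMatrixUnits.mul_orth _ _ (Ne.symm hij) _ _ _ _
      rw [this, zero_mul]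
  refine ⟨⟨e, R.orderEmbOfFin hcard, (R.orderEmbOfFin hcard).injective,
    fun j => hRv (R.orderEmbOfFin_mem hcard j),
    fun j => (Finset.mem_filter.1 (R.orderEmbOfFin_mem hcard j)).2, fun x hx hxR => ?_, β, own, out,
    fun x i h => ?_, fun x i h => ?_, fun x i h => ?_, fun x y i h h' => ?_, fun x i h h' => ?_,
    fun i => ?_, hne, fun i h => hβ₂ i ((hout i).1 h)⟩⟩
  · rw [Finset.range_orderEmbOfFin] at hxR
    exact hss x hx hxR
  · rw [hown] at h
    rw [Finset.range_orderEmbOfFin, ← h.2]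
    exact (hY i h.1).1.1
  · rw [hown] at h
    rw [← h.2]
    exact (hY i h.1).1.2.1
  · rw [hown] at h
    rw [← h.2]
    exact (hY i h.1).2
  · rw [hown] at h h'
    rw [← h.2, ← h'.2]
  · rw [hout] at h
    rw [hown] at h'
    exact h h'.1
  · by_cases hi : ∃ x, P i x
    · exact Or.inr ⟨Y i, (hown _ _).2 ⟨hi, rfl⟩⟩
    · exact Or.inl ((hout i).2 hi)

end MatrixUnits

end Framing

end PIAlg

namespace PIAlg

/-! ### The framed polynomial and its alternation -/

section Framed

open MonoidAlgebra

variable {F : Type u} [Field F] {A : Type v} [NonUnitalRing A] [Module F A]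
  [IsScalarTower F A A] [SMulCommClass F A A] {q : ℕ}

lemma single_one_mul_mem_multihomogeneous (w : FreeSemigroup ℕ) {μ : Multiset ℕ} {g : FreeAlg F}
    (hg : g ∈ multihomogeneous F μ) :
    (single w 1 : FreeAlg F) * g ∈ multihomogeneous F ((letters w : Multiset ℕ) + μ) := by
  rw [eq_sum_single g, Finset.mul_sum]
  refine Submodule.sum_mem _ fun v hv => ?_
  rw [single_mul_single]
  refine single_mem_multihomogeneous _ ?_
  rw [letters_mul, ← Multiset.coe_add, mem_multihomogeneous.1 hg v hv]

namespace MatrixUnits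

variable (U : MatrixUnits F A q)

/-- Names for the variables of `f`, for an idempotent and the identity element of each component,
and for a product of matrix units, in three factors, for each block and each matrix unit. -/
abbrev FrameName (τ : Type) : Type :=
  ℕ ⊕ Σ i : Fin q, (Fin 2 ⊕ (τ × Fin (U.k i) × Fin (U.k i)) × Fin 3)

/-- The positions in which the framed polynomial is alternated. -/
abbrev FramePos (ν s : ℕ) : Type := ((Fin ν ⊕ Fin s) × UnitIndex U.k) ⊕ Fin s

/-- The block of a position. -/
def frameBlock (ν s : ℕ) : U.FramePos ν s → Fin ν ⊕ Fin s := Sum.elim Prod.fst Sum.inr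

lemma card_frameBlock_inl {ν s : ℕ} (t : Fin ν) [DecidableEq (Fin ν ⊕ Fin s)] :
    (Finset.univ.filter fun a => U.frameBlock ν s a = Sum.inl t).card =
      Fintype.card (UnitIndex U.k) := by
  rw [Finset.card_filter, Fintype.sum_sum_type, Fintype.sum_prod_type]
  simp [frameBlock]

lemma card_frameBlock_inr {ν s : ℕ} (j : Fin s) [DecidableEq (Fin ν ⊕ Fin s)] :
    (Finset.univ.filter fun a => U.frameBlock ν s a = Sum.inr j).card =
      Fintype.card (UnitIndex U.k) + 1 := by
  rw [Finset.card_filter, Fintype.sum_sum_type, Fintype.sum_prod_type]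
  simp [frameBlock]

section Lists

variable (τ : Type) [Fintype τ]

/-- The names in the product that frames the `i`-th component. -/
noncomputable def frameList (i : Fin q) : List (U.FrameName τ) :=
  Sum.inr ⟨i, Sum.inl 0⟩ :: (Finset.univ : Finset (τ × Fin (U.k i) × Fin (U.k i))).toList.flatMap
    fun m => [Sum.inr ⟨i, Sum.inr (m, 0)⟩, Sum.inr ⟨i, Sum.inr (m, 1)⟩, Sum.inr ⟨i, Sum.inr (m, 2)⟩]

lemma exists_of_mem_frameList {i : Fin q} {n : U.FrameName τ} (h : n ∈ U.frameList τ i) :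
    ∃ r, n = Sum.inr ⟨i, r⟩ ∧ r ≠ Sum.inl 1 := by
  simp only [frameList, List.mem_cons, List.mem_flatMap, List.not_mem_nil, or_false] at h
  rcases h with h | ⟨m, -, h | h | h⟩
  · exact ⟨_, h, by simp⟩
  all_goals exact ⟨_, h, by simp⟩

lemma mem_frameList (i : Fin q) (m : τ × Fin (U.k i) × Fin (U.k i)) :
    (Sum.inr ⟨i, Sum.inr (m, 1)⟩ : U.FrameName τ) ∈ U.frameList τ i := by
  simp only [frameList, List.mem_cons, List.mem_flatMap]
  exact Or.inr ⟨m, by simp, by simp⟩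

lemma nodup_frameList (i : Fin q) : (U.frameList τ i).Nodup := by
  refine List.nodup_cons.2 ⟨by simp, List.nodup_flatMap.2 ⟨fun m _ => by simp, ?_⟩⟩
  refine (Finset.nodup_toList _).imp fun {m m'} h => ?_
  simp [Function.onFun, List.disjoint_left, h]

/-- The product of the values of the names that frame the `i`-th component. -/
lemma prod_frameList (i : Fin q) (v : U.FrameName τ → A) :
    ((U.frameList τ i).map fun n => (Unitization.inr (v n) : Unitization F A)).prod =
      Unitization.inr (v (Sum.inr ⟨i, Sum.inl 0⟩)) *
        ((Finset.univ : Finset (τ × Fin (U.k i) × Fin (U.k i))).toList.map fun m =>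
          (Unitization.inr (v (Sum.inr ⟨i, Sum.inr (m, 0)⟩) * v (Sum.inr ⟨i, Sum.inr (m, 1)⟩) *
            v (Sum.inr ⟨i, Sum.inr (m, 2)⟩)) : Unitization F A)).prod := by
  rw [frameList, List.map_cons, List.prod_cons, List.map_flatMap]
  congr 1
  induction (Finset.univ : Finset (τ × Fin (U.k i) × Fin (U.k i))).toList with
  | nil => rfl
  | cons m l ih =>
    rw [List.flatMap_cons, List.prod_append, ih, List.map_cons, List.prod_cons]
    simp [mul_assoc]

end Lists

namespace Framing

variable {U} {f : FreeAlg F} {s : ℕ} (Φ : U.Framing f s)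

/-- The names at the positions. -/
def posName (ν : ℕ) : U.FramePos ν s ↪ U.FrameName (Fin ν ⊕ Fin s) where
  toFun := Sum.elim (fun a => Sum.inr ⟨a.2.1, Sum.inr ((a.1, a.2.2), 1)⟩) fun j => Sum.inl (Φ.w j)
  inj' := by
    rintro (⟨t, i, a⟩ | j) (⟨t', i', a'⟩ | j') h
    · simp only [Sum.elim_inl, Sum.inr.injEq, Sigma.mk.injEq] at h
      obtain ⟨rfl, h⟩ := h
      simp only [heq_eq_eq, Sum.inr.injEq, Prod.mk.injEq, and_true] at h
      rw [h.1, h.2]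
    · simp at h
    · simp at h
    · simp only [Sum.elim_inr, Sum.inl.injEq] at h
      rw [Φ.w_injective h]

lemma posName_inl (ν : ℕ) (t : Fin ν ⊕ Fin s) (m : UnitIndex U.k) :
    Φ.posName ν (Sum.inl (t, m)) = Sum.inr ⟨m.1, Sum.inr ((t, m.2), 1)⟩ := rfl

lemma posName_inr (ν : ℕ) (j : Fin s) : Φ.posName ν (Sum.inr j) = Sum.inl (Φ.w j) := rfl

/-- The values of the names. -/
def val (τ : Type) : U.FrameName τ → A :=
  Sum.elim Φ.e fun n => Sum.elim ![U.E n.1 (Φ.β n.1) (Φ.β n.1), U.one n.1]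
    (fun m => ![U.E n.1 (Φ.β n.1) m.1.2.1, U.E n.1 m.1.2.1 m.1.2.2, U.E n.1 m.1.2.2 (Φ.β n.1)] m.2)
    n.2

variable {ν : ℕ} (ι : U.FrameName (Fin ν ⊕ Fin s) → ℕ)

/-- The word that frames the `i`-th component. -/
noncomputable def frameWord (ι : U.FrameName (Fin ν ⊕ Fin s) → ℕ) (i : Fin q) : FreeSemigroup ℕ :=
  ⟨ι (Sum.inr ⟨i, Sum.inl 0⟩), ((U.frameList (Fin ν ⊕ Fin s) i).map ι).tail⟩

lemma letters_frameWord (i : Fin q) :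
    letters (frameWord ι i) = (U.frameList (Fin ν ⊕ Fin s) i).map ι := rfl

/-- The polynomial that is substituted for the variable `x` of `f`. -/
noncomputable def subst (x : ℕ) : FreeAlg F :=
  -- The variable named `⟨i, Sum.inl 1⟩` takes the value `U.one i`, so the difference evaluates to
  -- `(1 - U.one i) * x * frame`. The radical value at `x` is unaffected, as `U.one i` annihilates
  -- it from the left, while every matrix unit in place of `x` gives zero.
  (Φ.own x).elim (single (FreeSemigroup.of (ι (Sum.inl x))) 1) fun i =>
    single (FreeSemigroup.of (ι (Sum.inl x)) * frameWord ι i) 1 -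
      single (FreeSemigroup.of (ι (Sum.inr ⟨i, Sum.inl 1⟩)) *
        (FreeSemigroup.of (ι (Sum.inl x)) * frameWord ι i)) 1

/-- The framing from the left. -/
noncomputable def prepend : FreeAlg F →ₗ[F] FreeAlg F :=
  Φ.out.elim LinearMap.id fun i => LinearMap.mulLeft F (single (frameWord ι i) 1)

/-- The monomials that occur in the polynomial substituted for `x`. -/
def substSet (x : ℕ) : Set (FreeAlg F) :=
  {g | ∃ w : FreeSemigroup ℕ, g = single w 1 ∧ ∃ l : List (U.FrameName (Fin ν ⊕ Fin s)),
    letters w = l.map ι ∧ l.Nodup ∧ Sum.inl x ∈ l ∧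
    (∀ n ∈ l, n = Sum.inl x ∨ ∃ i r, Φ.own x = some i ∧ n = Sum.inr ⟨i, r⟩) ∧
    ∀ i, Φ.own x = some i → U.frameList (Fin ν ⊕ Fin s) i ⊆ l}

lemma subst_mem_span (x : ℕ) : Φ.subst ι x ∈ Submodule.span F (Φ.substSet ι x) := by
  unfold subst
  rcases h : Φ.own x with _ | i
  · refine Submodule.subset_span ⟨_, rfl, [Sum.inl x], rfl, by simp, by simp, by simp, by simp [h]⟩
  · have hnd : (Sum.inl x :: U.frameList (Fin ν ⊕ Fin s) i).Nodup := by
      refine List.nodup_cons.2 ⟨fun hx => ?_, U.nodup_frameList _ i⟩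
      obtain ⟨r, hr, -⟩ := U.exists_of_mem_frameList _ hx
      cases hr
    have hmem : ∀ n ∈ Sum.inl x :: U.frameList (Fin ν ⊕ Fin s) i,
        n = Sum.inl x ∨ ∃ i r, Φ.own x = some i ∧ n = Sum.inr ⟨i, r⟩ := by
      intro n hn
      rcases List.mem_cons.1 hn with hn | hn
      · exact Or.inl hn
      · obtain ⟨r, hr, -⟩ := U.exists_of_mem_frameList _ hn
        exact Or.inr ⟨i, r, h, hr⟩
    refine sub_mem (Submodule.subset_span ⟨_, rfl, Sum.inl x :: U.frameList (Fin ν ⊕ Fin s) i,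
      ?_, hnd, by simp, hmem, ?_⟩) (Submodule.subset_span ⟨_, rfl, Sum.inr ⟨i, Sum.inl 1⟩ ::
        Sum.inl x :: U.frameList (Fin ν ⊕ Fin s) i, ?_, ?_, by simp, ?_, ?_⟩)
    · rw [letters_mul, letters_of, letters_frameWord]
      rfl
    · intro j hj n hn
      obtain rfl : i = j := Option.some.inj (h.symm.trans hj)
      exact List.mem_cons_of_mem _ hn
    · rw [letters_mul, letters_mul, letters_of, letters_of, letters_frameWord]
      rfl
    · refine List.nodup_cons.2 ⟨fun hx => ?_, hnd⟩
      rcases List.mem_cons.1 hx with hx | hx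
      · cases hx
      · obtain ⟨r, hr, hr'⟩ := U.exists_of_mem_frameList _ hx
        simp only [Sum.inr.injEq, Sigma.mk.injEq, heq_eq_eq, true_and] at hr
        exact hr' hr.symm
    · intro n hn
      rcases List.mem_cons.1 hn with hn | hn
      · exact Or.inr ⟨i, _, h, hn⟩
      · exact hmem n hn
    · intro j hj n hn
      obtain rfl : i = j := Option.some.inj (h.symm.trans hj)
      exact List.mem_cons_of_mem _ (List.mem_cons_of_mem _ hn)

/-- A valuation of the names in which the values at the positions are permuted. -/
structure IsPermVal (e : ℕ → A) (σ : Equiv.Perm (U.FramePos ν s)) : Prop where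
  pos : ∀ a, e (ι (Φ.posName ν a)) = Φ.val _ (Φ.posName ν (σ a))
  other : ∀ n, n ∉ Set.range (Φ.posName ν) → e (ι n) = Φ.val _ n

section Values

variable {Φ ι} {e : ℕ → A} {σ : Equiv.Perm (U.FramePos ν s)}

lemma IsPermVal.inl_zero (he : Φ.IsPermVal ι e σ) (i : Fin q) :
    e (ι (Sum.inr ⟨i, Sum.inl 0⟩)) = U.E i (Φ.β i) (Φ.β i) :=
  he.other _ (by
    rintro ⟨⟨t, j, a⟩ | _, h⟩
    · simp only [posName_inl, Sum.inr.injEq, Sigma.mk.injEq] at h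
      obtain ⟨rfl, h⟩ := h
      simp at h
    · simp [posName_inr] at h)

lemma IsPermVal.inl_one (he : Φ.IsPermVal ι e σ) (i : Fin q) : e (ι (Sum.inr ⟨i, Sum.inl 1⟩)) = U.one i :=
  he.other _ (by
    rintro ⟨⟨t, j, a⟩ | _, h⟩
    · simp only [posName_inl, Sum.inr.injEq, Sigma.mk.injEq] at h
      obtain ⟨rfl, h⟩ := h
      simp at h
    · simp [posName_inr] at h)

lemma IsPermVal.inr_zero (he : Φ.IsPermVal ι e σ) (i : Fin q) (m : (Fin ν ⊕ Fin s) × Fin (U.k i) × Fin (U.k i)) :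
    e (ι (Sum.inr ⟨i, Sum.inr (m, 0)⟩)) = U.E i (Φ.β i) m.2.1 :=
  he.other _ (by
    rintro ⟨⟨t, j, a⟩ | _, h⟩
    · simp only [posName_inl, Sum.inr.injEq, Sigma.mk.injEq] at h
      obtain ⟨rfl, h⟩ := h
      simp at h
    · simp [posName_inr] at h)

lemma IsPermVal.inr_two (he : Φ.IsPermVal ι e σ) (i : Fin q) (m : (Fin ν ⊕ Fin s) × Fin (U.k i) × Fin (U.k i)) :
    e (ι (Sum.inr ⟨i, Sum.inr (m, 2)⟩)) = U.E i m.2.2 (Φ.β i) :=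
  he.other _ (by
    rintro ⟨⟨t, j, a⟩ | _, h⟩
    · simp only [posName_inl, Sum.inr.injEq, Sigma.mk.injEq] at h
      obtain ⟨rfl, h⟩ := h
      simp at h
    · simp [posName_inr] at h)

lemma IsPermVal.inr_one (he : Φ.IsPermVal ι e σ) (i : Fin q) (m : (Fin ν ⊕ Fin s) × Fin (U.k i) × Fin (U.k i)) :
    e (ι (Sum.inr ⟨i, Sum.inr (m, 1)⟩)) =
      Φ.val _ (Φ.posName ν (σ (Sum.inl (m.1, ⟨i, m.2⟩)))) :=
  he.pos (Sum.inl (m.1, ⟨i, m.2⟩))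

lemma IsPermVal.inl_of_notMem (he : Φ.IsPermVal ι e σ) {x : ℕ} (hx : x ∉ Set.range Φ.w) : e (ι (Sum.inl x)) = Φ.e x :=
  he.other _ (by
    rintro ⟨⟨_, _⟩ | j, h⟩
    · simp [posName_inl] at h
    · exact hx ⟨j, by simpa [posName_inr] using h⟩)

lemma IsPermVal.inl_w (he : Φ.IsPermVal ι e σ) (j : Fin s) :
    e (ι (Sum.inl (Φ.w j))) = Φ.val _ (Φ.posName ν (σ (Sum.inr j))) := he.pos (Sum.inr j)

lemma val_posName_inl (t : Fin ν ⊕ Fin s) (m : UnitIndex U.k) :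
    Φ.val _ (Φ.posName ν (Sum.inl (t, m))) = U.unit m := rfl

lemma IsPermVal.inr_lift_frameWord (he : Φ.IsPermVal ι e σ) (i : Fin q) :
    (Unitization.inr (FreeSemigroup.lift e (frameWord ι i)) : Unitization F A) =
      Unitization.inr (U.E i (Φ.β i) (Φ.β i)) *
        ((Finset.univ : Finset ((Fin ν ⊕ Fin s) × Fin (U.k i) × Fin (U.k i))).toList.map fun m =>
          (Unitization.inr (U.E i (Φ.β i) m.2.1 *
            Φ.val _ (Φ.posName ν (σ (Sum.inl (m.1, ⟨i, m.2⟩)))) *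
              U.E i m.2.2 (Φ.β i)) : Unitization F A)).prod := by
  rw [inr_lift, letters_frameWord, wordVal, List.map_map]
  have := U.prod_frameList (F := F) (Fin ν ⊕ Fin s) i fun n => e (ι n)
  simp only [he.inl_zero, he.inr_zero, he.inr_one, he.inr_two] at this
  exact this

lemma IsPermVal.diag_mul_lift (he : Φ.IsPermVal ι e σ) (i : Fin q) :
    U.E i (Φ.β i) (Φ.β i) * FreeSemigroup.lift e (frameWord ι i) =
      FreeSemigroup.lift e (frameWord ι i) := by
  apply Unitization.inr_injective (R := F)
  rw [Unitization.inr_mul, he.inr_lift_frameWord, ← mul_assoc, ← Unitization.inr_mul,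
    U.isMatrixUnits.mul_same]

lemma IsPermVal.lift_eq_diag (he : Φ.IsPermVal ι e σ) (i : Fin q)
    (h : ∀ t m, σ (Sum.inl (t, ⟨i, m⟩)) = Sum.inl (t, ⟨i, m⟩)) :
    FreeSemigroup.lift e (frameWord ι i) = U.E i (Φ.β i) (Φ.β i) := by
  apply Unitization.inr_injective (R := F)
  rw [he.inr_lift_frameWord]
  simp only [h, val_posName_inl, unit, U.isMatrixUnits.mul_mul_same]
  induction (Finset.univ : Finset ((Fin ν ⊕ Fin s) × Fin (U.k i) × Fin (U.k i))).toList with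
  | nil => simp
  | cons m l ih =>
    rw [List.map_cons, List.prod_cons, ← mul_assoc, ← Unitization.inr_mul,
      U.isMatrixUnits.mul_same, ih]

/-- Between `E β a` and `E b β` only the matrix unit `E a b` itself survives. -/
lemma IsPermVal.lift_eq_zero (he : Φ.IsPermVal ι e σ) (i : Fin q) (t t' : Fin ν ⊕ Fin s) (a : Fin (U.k i) × Fin (U.k i))
    (m : UnitIndex U.k) (hm : m ≠ ⟨i, a⟩) (h : σ (Sum.inl (t, ⟨i, a⟩)) = Sum.inl (t', m)) :
    FreeSemigroup.lift e (frameWord ι i) = 0 := by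
  apply Unitization.inr_injective (R := F)
  rw [he.inr_lift_frameWord, List.prod_eq_zero, mul_zero, Unitization.inr_zero]
  refine List.mem_map.2 ⟨(t, a), by simp, ?_⟩
  rw [h, val_posName_inl, unit, U.isMatrixUnits.mul_mul_ne _ _ _ _ _ _ hm, Unitization.inr_zero]

lemma eval_subst (e : ℕ → A) (x : ℕ) : eval e (Φ.subst ι x) =
    (Φ.own x).elim (e (ι (Sum.inl x))) fun i => (e (ι (Sum.inl x)) -
      e (ι (Sum.inr ⟨i, Sum.inl 1⟩)) * e (ι (Sum.inl x))) * FreeSemigroup.lift e (frameWord ι i) := by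
  unfold subst
  rcases Φ.own x with _ | i
  · simp [eval_single]
  · simp [eval_single, sub_mul, mul_assoc]

lemma eval_prepend (e : ℕ → A) (g : FreeAlg F) : eval e (Φ.prepend ι g) =
    Φ.out.elim (eval e g) fun i => FreeSemigroup.lift e (frameWord ι i) * eval e g := by
  unfold prepend
  rcases Φ.out with _ | i
  · rfl
  · simp [eval_single]

/-- A matrix unit of the `i`-th component is killed by `1 - U.one i` on the left, any other one by
the frame on the right. -/
lemma IsPermVal.eval_subst_of_own (he : Φ.IsPermVal ι e σ) {j : Fin s} {t : Fin ν ⊕ Fin s}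
    {m : UnitIndex U.k} (hj : σ (Sum.inr j) = Sum.inl (t, m)) {i : Fin q}
    (hi : Φ.own (Φ.w j) = some i) : eval e (Φ.subst ι (Φ.w j)) = 0 := by
  rw [eval_subst, hi, Option.elim_some, he.inl_one, he.inl_w, hj, val_posName_inl, one_mul_unit]
  split_ifs with h
  · rw [sub_self, zero_mul]
  · rw [sub_zero, ← he.diag_mul_lift, ← mul_assoc]
    have : U.unit m * U.E i (Φ.β i) (Φ.β i) = 0 := by
      obtain ⟨i', a, b⟩ := m
      exact U.isMatrixUnits.mul_orth i' i h a b _ _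
    rw [this, zero_mul]

/-- Permutations within blocks can only send a radical position to itself or to a matrix unit. Each
moved one thus costs a radical value of `f`, its substitute being semisimple or zero, and property
`K` applies. Where the displaced radical value ends up does not matter. -/
lemma IsPermVal.eval_eq_zero_of_moved (he : Φ.IsPermVal ι e σ) (hf : IsMultilinear f)
    (hK : f ∈ identities F (U.trunc s)) (hσ : σ ∈ blockPerms (U.frameBlock ν s)) {j : Fin s}
    (hj : σ (Sum.inr j) ≠ Sum.inr j) : eval e (eval (Φ.subst ι) f) = 0 := by
  classical
  have hmoved : ∀ j, σ (Sum.inr j) ≠ Sum.inr j → ∃ t m, σ (Sum.inr j) = Sum.inl (t, m) := by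
    intro j hj
    rcases h : σ (Sum.inr j) with ⟨t, m⟩ | j'
    · exact ⟨t, m, rfl⟩
    · have := mem_blockPerms.1 hσ (Sum.inr j)
      rw [h] at this
      obtain rfl : j' = j := Sum.inr.inj this
      exact absurd h hj
  rw [eval_eval]
  refine U.eval_eq_zero_of_mem_trunc hf hK
    (R := (Finset.univ.filter fun j => σ (Sum.inr j) = Sum.inr j).image Φ.w) ?_ ?_ ?_ ?_
  · intro x hx
    obtain ⟨j, -, rfl⟩ := Finset.mem_image.1 hx
    exact Φ.w_mem j
  · refine lt_of_le_of_lt Finset.card_image_le ?_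
    conv_rhs => rw [← Fintype.card_fin s, ← Finset.card_univ]
    exact Finset.card_lt_card (Finset.filter_ssubset.2 ⟨j, Finset.mem_univ _, hj⟩)
  · intro x hx hxR
    by_cases hxw : x ∈ Set.range Φ.w
    · obtain ⟨j', rfl⟩ := hxw
      obtain ⟨t, m, hm⟩ := hmoved j' fun h => hxR (Finset.mem_image_of_mem _ (by simpa using h))
      rcases hi : Φ.own (Φ.w j') with _ | i
      · rw [eval_subst, hi, Option.elim_none, he.inl_w, hm]
        exact Submodule.subset_span ⟨m, rfl⟩
      · rw [he.eval_subst_of_own hm hi]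
        exact zero_mem _
    · have hi : Φ.own x = none := by
        rcases hi : Φ.own x with _ | i
        · rfl
        · exact absurd (Φ.own_mem x i hi) hxw
      rw [eval_subst, hi, Option.elim_none, he.inl_of_notMem hxw]
      exact Submodule.subset_span (Φ.semisimple_mem x hx hxw)
  · intro x hx
    obtain ⟨j', hj', rfl⟩ := Finset.mem_image.1 hx
    rw [Finset.mem_filter] at hj'
    have hr : e (ι (Sum.inl (Φ.w j'))) ∈ radical F A := by
      rw [he.inl_w, hj'.2]
      exact Φ.radical_mem j'
    rw [eval_subst]
    rcases Φ.own (Φ.w j') with _ | i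
    · exact hr
    · exact radical_mul_mem _ (sub_mem hr (mul_mem_radical _ hr))

/-- If all radical positions are fixed, some matrix unit is replaced by a different one and its
frame vanishes. Each frame is used, either on the left of `f` or behind the variable that owns it.
-/
lemma IsPermVal.eval_prepend_eq_zero (he : Φ.IsPermVal ι e σ) (hf : IsMultilinear f)
    (hK : f ∈ identities F (U.trunc s)) (hσ : σ ∈ blockPerms (U.frameBlock ν s)) (h1 : σ ≠ 1) :
    eval e (Φ.prepend ι (eval (Φ.subst ι) f)) = 0 := by
  rw [eval_prepend]
  by_cases hw : ∀ j, σ (Sum.inr j) = Sum.inr j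
  · obtain ⟨a, ha⟩ : ∃ a, σ a ≠ a := by
      by_contra! h
      exact h1 (Equiv.ext h)
    rcases a with ⟨t, i, a⟩ | j
    · rcases h : σ (Sum.inl (t, ⟨i, a⟩)) with ⟨t', m⟩ | j
      · have ht := mem_blockPerms.1 hσ (Sum.inl (t, ⟨i, a⟩))
        rw [h] at ht
        obtain rfl : t' = t := ht
        have hz := he.lift_eq_zero i t' t' a m (fun hm => ha (by rw [h, hm])) h
        rcases Φ.cover i with hi | ⟨x, hx⟩
        · rw [hi, Option.elim_some, hz, zero_mul]
        · have hx0 : eval e (eval (Φ.subst ι) f) = 0 := by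
            rw [eval_eval]
            obtain ⟨j, rfl⟩ := Φ.own_mem x i hx
            refine hf.eval_eq_zero_of_eq_zero (Φ.w_mem j) ?_
            rw [eval_subst, hx, Option.elim_some, hz, mul_zero]
          rw [hx0]
          rcases Φ.out with _ | i
          · rfl
          · exact mul_zero _
      · rw [← hw j] at h
        cases σ.injective h
    · exact absurd (hw j) ha
  · push Not at hw
    obtain ⟨j, hj⟩ := hw
    rw [he.eval_eq_zero_of_moved hf hK hσ hj]
    rcases Φ.out with _ | i
    · rfl
    · exact mul_zero _

/-- Unpermuted frames evaluate to `E β β`, which fixes the owning radical values on the right, so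
`f` is evaluated as in `Φ`. -/
lemma IsPermVal.eval_prepend_ne_zero (he : Φ.IsPermVal ι e 1) :
    eval e (Φ.prepend ι (eval (Φ.subst ι) f)) ≠ 0 := by
  have hlift : ∀ i, FreeSemigroup.lift e (frameWord ι i) = U.E i (Φ.β i) (Φ.β i) :=
    fun i => he.lift_eq_diag i fun _ _ => rfl
  have hval : ∀ x, e (ι (Sum.inl x)) = Φ.e x := by
    intro x
    by_cases hx : x ∈ Set.range Φ.w
    · obtain ⟨j, rfl⟩ := hx
      exact he.inl_w j
    · exact he.inl_of_notMem hx
  have hsub : (fun x => eval e (Φ.subst ι x)) = Φ.e := by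
    funext x
    rw [eval_subst, hval]
    rcases h : Φ.own x with _ | i
    · rfl
    · rw [Option.elim_some, he.inl_one, Φ.own_left x i h, sub_zero, hlift, Φ.own_right x i h]
  rw [eval_prepend, eval_eval, hsub]
  rcases h : Φ.out with _ | i
  · exact Φ.eval_ne
  · rw [Option.elim_some, hlift]
    exact Φ.out_ne i h

end Values

/-- A framed multilinear polynomial with property `K` regenerates alternations. -/
theorem exists_hasAlternatingSets [CharZero F] (Φ : U.Framing f s) (hf : IsMultilinear f)
    (hK : f ∈ identities F (U.trunc s)) (ν : ℕ) :
    ∃ g ∈ tIdealSpan f, IsMultilinear g ∧ g ∉ identities F A ∧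
      HasAlternatingSets g ν (Fintype.card (UnitIndex U.k)) s (Fintype.card (UnitIndex U.k) + 1) := by
  classical
  obtain ⟨ι, hι⟩ := exists_injective_nat (U.FrameName (Fin ν ⊕ Fin s))
  let p : U.FramePos ν s ↪ ℕ := (Φ.posName ν).trans ⟨ι, hι⟩
  set e : ℕ → A := Function.extend ι (Φ.val _) 0 with he
  have hval : ∀ n, e (ι n) = Φ.val _ n := fun n => hι.extend_apply _ _ n
  have hperm : ∀ σ : Equiv.Perm (U.FramePos ν s),
      Φ.IsPermVal ι (fun x => e (σ.viaFintypeEmbedding p x)) σ := by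
    intro σ
    constructor
    · intro a
      change e (σ.viaFintypeEmbedding p (p a)) = _
      rw [Equiv.Perm.viaFintypeEmbedding_apply_image]
      exact hval _
    · intro n hn
      rw [Equiv.Perm.viaFintypeEmbedding_apply_notMem_range, hval]
      rintro ⟨a, ha⟩
      exact hn ⟨a, hι ha⟩
  -- The two words in `Φ.subst` have different variables, so the framed polynomial is not
  -- multilinear. But the alternated value is linear in each substituted polynomial; hence some
  -- choice of one word for each variable is still nonzero.
  let Ψ : (ℕ → FreeAlg F) → A := fun Q =>
    eval e (alternator (U.frameBlock ν s) p (Φ.prepend ι (eval Q f)))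
  have hlin : ∀ x ∈ vars f, ∀ Q, IsLinearMap F fun g => Ψ (Function.update Q x g) := by
    intro x hx Q
    have := isLinearMap_eval_update hf hx Q
    simp only [Ψ, eval_alternator]
    constructor
    · intro g h
      simp only [this.map_add, map_add, smul_add, Finset.sum_add_distrib]
    · intro c g
      simp only [this.map_smul, map_smul, Finset.smul_sum, smul_comm c]
  have hΨ : Ψ (Φ.subst ι) ≠ 0 := by
    simp only [Ψ, eval_alternator]
    rw [Finset.sum_eq_single 1]
    · simpa using (hperm 1).eval_prepend_ne_zero
    · intro σ hσ h1
      rw [(hperm σ).eval_prepend_eq_zero hf hK hσ h1, smul_zero]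
    · intro h
      exact absurd (mem_blockPerms.2 fun _ => rfl) h
  obtain ⟨Q, hQ, -, hne⟩ := exists_ne_zero_of_mem_span (vars f) hlin (Φ.substSet ι)
    (fun x _ => Φ.subst_mem_span ι x) hΨ
  choose! θ hθ l hl hnd hself hmem hframe using hQ
  set h : FreeAlg F := Φ.prepend ι (eval (fun x => single (θ x) 1) f) with hh
  have hQh : Φ.prepend ι (eval Q f) = h := by
    rw [hh, eval_congr hθ]
  have hmemI : h ∈ tIdealSpan f := by
    have hI := isTIdeal_tIdealSpan f
    have := hI.map_mem (eval fun x => single (θ x) 1) f (mem_tIdealSpan_self f)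
    rw [hh, prepend]
    rcases Φ.out with _ | i
    · exact this
    · exact hI.mul_left _ _ this
  let L : List (U.FrameName (Fin ν ⊕ Fin s)) := Φ.out.elim [] (U.frameList _)
  let μ : Multiset (U.FrameName (Fin ν ⊕ Fin s)) :=
    (L : Multiset _) + (vars f).val.bind fun x => (l x : Multiset _)
  have hL : ∀ n ∈ L, ∃ i r, Φ.out = some i ∧ n = Sum.inr ⟨i, r⟩ := by
    intro n hn
    rcases ho : Φ.out with _ | i
    · simp [L, ho] at hn
    · simp only [L, ho, Option.elim_some] at hn
      obtain ⟨r, hr, -⟩ := U.exists_of_mem_frameList _ hn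
      exact ⟨i, r, rfl, hr⟩
  -- No name is repeated: the words of distinct variables carry frames of distinct components, and
  -- the component framed on the left is owned by no variable.
  have hμ : μ.Nodup := by
    refine Multiset.nodup_add.2 ⟨?_, Multiset.nodup_bind.2 ⟨fun x hx => hnd x hx, ?_⟩, ?_⟩
    · simp only [L]
      rcases Φ.out with _ | i
      · simp
      · exact U.nodup_frameList _ i
    · refine Multiset.Nodup.pairwise (fun x hx y hy hxy => ?_) (vars f).nodup
      refine Multiset.disjoint_left.2 fun {n} hn hn' => ?_
      rcases hmem x hx n hn with h | ⟨i, r, hi, h⟩ <;>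
        rcases hmem y hy n hn' with h' | ⟨i', r', hi', h'⟩
      · exact hxy (Sum.inl.inj (h.symm.trans h'))
      · cases h.symm.trans h'
      · cases h.symm.trans h'
      · cases h.symm.trans h'
        exact hxy (Φ.own_injective x y i hi hi')
    · refine Multiset.disjoint_left.2 fun {n} hn hn' => ?_
      obtain ⟨i, r, hi, rfl⟩ := hL n hn
      obtain ⟨x, hx, hxn⟩ := Multiset.mem_bind.1 hn'
      rcases hmem x hx _ hxn with h | ⟨j, r', hj, h⟩
      · cases h
      · cases h
        exact Φ.out_ne_own x i hi hj
  have hhomog : h ∈ multihomogeneous F (μ.map ι) := by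
    have := eval_single_one_mem_multihomogeneous θ hf.mem_multihomogeneous
    rw [Multiset.bind_congr (g := fun x => (l x : Multiset _).map ι) fun x hx => by
      rw [hl x hx, Multiset.map_coe], ← Multiset.map_bind] at this
    rw [Multiset.map_add, hh, prepend]
    simp only [L]
    rcases Φ.out with _ | i
    · simpa using this
    · rw [Option.elim_some, Option.elim_some, LinearMap.mulLeft_apply, Multiset.map_coe,
        ← letters_frameWord]
      exact single_one_mul_mem_multihomogeneous _ this
  set V : Finset ℕ := ⟨μ.map ι, hμ.map hι⟩ with hV
  -- All alternated variables do occur, since by `Φ.cover` every component is framed and both words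
  -- of a difference contain the frame.
  have hp : ∀ a, p a ∈ V := by
    have hw : ∀ x ∈ vars f, ∀ n ∈ l x, n ∈ μ := fun x hx n hn =>
      Multiset.mem_add.2 (Or.inr (Multiset.mem_bind.2 ⟨x, hx, hn⟩))
    rintro (⟨t, i, a⟩ | j)
    · refine Multiset.mem_map_of_mem ι ?_
      rcases Φ.cover i with hi | ⟨x, hx⟩
      · refine Multiset.mem_add.2 (Or.inl ?_)
        simp only [L, hi, Option.elim_some]
        exact U.mem_frameList _ i (t, a)
      · obtain ⟨j, rfl⟩ := Φ.own_mem x i hx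
        exact hw _ (Φ.w_mem j) _ (hframe _ (Φ.w_mem j) i hx (U.mem_frameList _ i (t, a)))
    · exact Multiset.mem_map_of_mem ι (hw _ (Φ.w_mem j) _ (hself _ (Φ.w_mem j)))
  refine ⟨alternator (U.frameBlock ν s) p h, alternator_mem (isTIdeal_tIdealSpan f) hmemI,
    isMultilinear_of_mem V.nodup (alternator_mem_multihomogeneous hhomog hp), ?_,
    fun t => (Finset.univ.filter fun a => U.frameBlock ν s a = t).map p, ?_, ?_, ?_,
    fun t => isAlternatingOn_alternator hhomog hp t⟩
  · intro hA
    apply hne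
    simp only [Ψ, hQh]
    exact hA e
  · intro t t' htt
    refine (Finset.disjoint_map p).2 (Finset.disjoint_left.2 fun a ha ha' => htt ?_)
    rw [Finset.mem_filter] at ha ha'
    exact ha.2.symm.trans ha'.2
  · intro t
    rw [Finset.card_map, card_frameBlock_inl]
  · intro j
    rw [Finset.card_map, card_frameBlock_inr]

end Framing
end MatrixUnits
end Framed
end PIAlg

namespace PIAlg

/-! ### The Kemer index of a basic algebra -/

section Index

variable {F : Type u} [Field F]

lemma HasAlternatingSets.mono {f : FreeAlg F} {m a k b : ℕ} (h : HasAlternatingSets f m a k b) :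
    HasAlternatingSets f m a 0 0 := by
  obtain ⟨S, hS, ha, -, halt⟩ := h
  refine ⟨Sum.elim (fun i => S (Sum.inl i)) fun j => j.elim0, ?_, ha, fun j => j.elim0, ?_⟩
  · rintro (i | j) (i' | j') hij
    · exact hS fun h => hij (by rw [Sum.inl.inj h])
    · exact j'.elim0
    · exact j.elim0
    · exact j.elim0
  · rintro (i | j)
    · exact halt _
    · exact j.elim0

lemma IsKemerStage.unique {Γ : Submodule F (FreeAlg F)} {d s μ d' s' μ' : ℕ}
    (h : IsKemerStage Γ d s μ) (h' : IsKemerStage Γ d' s' μ') : d = d' ∧ s = s' := by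
  have hd : d = d' := by
    rw [← h.small_eq (max μ μ') (le_max_left _ _), h'.small_eq (max μ μ') (le_max_right _ _)]
  subst hd
  exact ⟨rfl, by
    rw [← h.big_eq (max μ μ') (le_max_left _ _), h'.big_eq (max μ μ') (le_max_right _ _)]⟩

variable {A : Type v} [NonUnitalRing A] [Module F A] [IsScalarTower F A A] [SMulCommClass F A A]
  [FiniteDimensional F A] {q : ℕ} (U : MatrixUnits F A q)

namespace MatrixUnits

lemma exists_kemer [CharZero F] {f : FreeAlg F} (hf : IsMultilinear f) (hfA : f ∉ identities F A)
    (hfull : ∀ i, f ∈ identities F (U.without i))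
    (hK : f ∈ identities F (U.trunc (nilpotencyIndex F A - 1))) (ν : ℕ) :
    ∃ g ∈ tIdealSpan f, IsMultilinear g ∧ g ∉ identities F A ∧
      HasAlternatingSets g ν (semisimpleDim F A) (nilpotencyIndex F A - 1)
        (semisimpleDim F A + 1) := by
  obtain ⟨Φ⟩ := U.exists_framing hf hfA hfull hK
  rw [U.semisimpleDim_eq]
  exact Φ.exists_hasAlternatingSets hf hK ν

/-- For `ν ≥ n_A` a nonidentity cannot alternate on `ν` sets larger than `d(A)`, and never on `n_A`
of them; this gives the upper bounds. The regenerated polynomials attain both. -/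
lemma isKemerStage [CharZero F] (U : MatrixUnits F A q) (hA : IsBasic F A) :
    IsKemerStage (identities F A) (semisimpleDim F A) (nilpotencyIndex F A - 1)
      (nilpotencyIndex F A) := by
  have hsmall : ∀ ν ≥ nilpotencyIndex F A,
      semisimpleDim F A ∈ upperBounds (smallSizes (identities F A) ν) := by
    rintro ν hν r ⟨f, hf, hfA, S, hS, hr, -, halt⟩
    by_contra! hlt
    have := U.card_lt_of_alternating hf hfA (T := Fin ν) (S := fun i => S (Sum.inl i))
      (fun i j hij => hS fun h => hij (Sum.inl.inj h)) (fun t => by rwa [hr]) fun t => halt _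
    rw [Fintype.card_fin] at this
    omega
  have hbig : ∀ ν, nilpotencyIndex F A - 1 ∈
      upperBounds (bigCounts (identities F A) (semisimpleDim F A) ν) := by
    rintro ν j ⟨f, hf, hfA, S, hS, -, hr, halt⟩
    have := U.card_lt_of_alternating hf hfA (T := Fin j) (S := fun i => S (Sum.inr i))
      (fun i j hij => hS fun h => hij (Sum.inr.inj h)) (fun t => by rw [hr]; omega) fun t => halt _
    rw [Fintype.card_fin] at this
    omega
  have hle : ∀ ν ≥ nilpotencyIndex F A,
      semisimpleDim F A ≤ sSup (smallSizes (identities F A) ν) ∧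
      nilpotencyIndex F A - 1 ≤ sSup (bigCounts (identities F A) (semisimpleDim F A) ν) := by
    intro ν hν
    -- The zero algebra has no nonidentities, but there both lower bounds are zero.
    rcases subsingleton_or_nontrivial A with h | h
    · have h1 : nilpotencyIndex F A ≤ 1 := by
        refine Nat.sInf_le fun l hl _ => ?_
        obtain ⟨a, rfl⟩ := List.length_eq_one_iff.1 hl
        rw [Subsingleton.elim a 0]
        simp
      have h0 : semisimpleDim F A = 0 := Module.finrank_zero_of_subsingleton
      omega
    · obtain ⟨f, hf, hfA, hfull, hK⟩ := hA.exists_full_propertyK U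
      obtain ⟨g, -, hg, hgA, halt⟩ := U.exists_kemer hf hfA hfull hK ν
      exact ⟨le_csSup ⟨_, hsmall ν hν⟩ ⟨g, hg, hgA, halt.mono⟩,
        le_csSup ⟨_, hbig ν⟩ ⟨g, hg, hgA, halt⟩⟩
  exact ⟨one_le_nilpotencyIndex, fun ν hν => ⟨_, hsmall ν hν⟩,
    fun ν hν => le_antisymm (csSup_le' (hsmall ν hν)) (hle ν hν).1,
    fun ν _ => ⟨_, hbig ν⟩, fun ν hν => le_antisymm (csSup_le' (hbig ν)) (hle ν hν).2⟩

/-- For fullness, one small set besides the `n_A - 1` big ones makes up the required `n_A` sets,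
hence `hν`. The big sets alone give property `K`. -/
lemma mem_identities_of_hasAlternatingSets {f : FreeAlg F} (hf : IsMultilinear f) {ν : ℕ}
    (hν : 1 ≤ ν) (h : HasAlternatingSets f ν (semisimpleDim F A) (nilpotencyIndex F A - 1)
      (semisimpleDim F A + 1)) :
    (∀ i, f ∈ identities F (U.without i)) ∧
      f ∈ identities F (U.trunc (nilpotencyIndex F A - 1)) := by
  obtain ⟨S, hS, hsmall, hbig, halt⟩ := h
  constructor
  · refine U.mem_identities_without hf hS ?_ ?_ halt
    · rw [Fintype.card_sum, Fintype.card_fin, Fintype.card_fin]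
      omega
    · rintro (t | t)
      · rw [hsmall]
      · rw [hbig]
        omega
  · exact U.mem_identities_trunc hf (T := Fin (nilpotencyIndex F A - 1))
      (S := fun j => S (Sum.inr j)) (fun i j hij => hS fun h => hij (Sum.inr.inj h))
      (by rw [Fintype.card_fin]) (fun t => by rw [hbig]; omega) fun t => halt _

end MatrixUnits

end Index

end PIAlg

theorem mainTheorem11 {F : Type u} [Field F] [IsAlgClosed F] [CharZero F]
    {A : Type v} [NonUnitalRing A] [Module F A] [IsScalarTower F A A] [SMulCommClass F A A]
    [FiniteDimensional F A] (hA : PIAlg.IsBasic F A) :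
    -- The index of `A` exists and equals its parameter.
    PIAlg.HasKemerIndex (PIAlg.identities F A)
      (PIAlg.semisimpleDim F A) (PIAlg.nilpotencyIndex F A - 1) ∧
    -- Kemer polynomials have the Phoenix property.
    (∀ d s μ : ℕ, PIAlg.IsKemerStage (PIAlg.identities F A) d s μ →
      PIAlg.IsPhoenix (PIAlg.identities F A)
        (PIAlg.IsKemerPolynomial (PIAlg.identities F A) d s μ)) ∧
    ∀ W : PIAlg.WedderburnDecomposition F A,
      -- Fullness and property `K` pass to the multilinear nonidentities in `⟨f⟩`.
      PIAlg.IsStrictlyPhoenix (PIAlg.identities F A) W.IsFullFor ∧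
      PIAlg.IsStrictlyPhoenix (PIAlg.identities F A) W.HasPropertyK ∧
      ∀ d s μ : ℕ, PIAlg.IsKemerStage (PIAlg.identities F A) d s μ →
        -- Kemer polynomials satisfy both.
        (∀ f, PIAlg.IsKemerPolynomial (PIAlg.identities F A) d s μ f →
          W.IsFullFor f ∧ W.HasPropertyK f) ∧
        -- Both together regenerate a Kemer polynomial.
        (∀ f, PIAlg.IsMultilinear f → f ∉ PIAlg.identities F A →
          W.IsFullFor f → W.HasPropertyK f →
          ∃ f' ∈ PIAlg.tIdealSpan f,
            PIAlg.IsKemerPolynomial (PIAlg.identities F A) d s μ f') := by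
  have hkemer : ∀ {q : ℕ} (U : PIAlg.MatrixUnits F A q) (d s μ : ℕ),
      PIAlg.IsKemerStage (PIAlg.identities F A) d s μ → ∀ f, PIAlg.IsMultilinear f →
      f ∉ PIAlg.identities F A → (∀ i, f ∈ PIAlg.identities F (U.without i)) →
      f ∈ PIAlg.identities F (U.trunc (PIAlg.nilpotencyIndex F A - 1)) →
      ∃ f' ∈ PIAlg.tIdealSpan f,
        PIAlg.IsKemerPolynomial (PIAlg.identities F A) d s μ f' := by
    intro q U d s μ hμ f hf hfA hfull hK
    obtain ⟨rfl, rfl⟩ := hμ.unique (U.isKemerStage hA)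
    obtain ⟨g, hgf, hg, hgA, halt⟩ := U.exists_kemer hf hfA hfull hK μ
    exact ⟨g, hgf, hg, hgA, μ, le_rfl, halt⟩
  have hfullK : ∀ {q : ℕ} (U : PIAlg.MatrixUnits F A q) (d s μ : ℕ),
      PIAlg.IsKemerStage (PIAlg.identities F A) d s μ → ∀ f,
      PIAlg.IsKemerPolynomial (PIAlg.identities F A) d s μ f →
      (∀ i, f ∈ PIAlg.identities F (U.without i)) ∧
        f ∈ PIAlg.identities F (U.trunc (PIAlg.nilpotencyIndex F A - 1)) := by
    intro q U d s μ hμ f hf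
    obtain ⟨rfl, rfl⟩ := hμ.unique (U.isKemerStage hA)
    obtain ⟨hf, -, ν, hν, halt⟩ := hf
    exact U.mem_identities_of_hasAlternatingSets hf (hμ.one_le.trans hν) halt
  obtain ⟨q, ⟨U⟩⟩ := PIAlg.exists_matrixUnits F A
  refine ⟨⟨_, U.isKemerStage hA⟩, fun d s μ hμ f hf hfP hfA f' hf' hf'A => ?_, fun W => ?_⟩
  -- A Kemer polynomial lies in the `T`-ideals expressing fullness and property `K`, and so does any
  -- consequence. A multilinear nonidentity in `⟨f'⟩` therefore regenerates a Kemer polynomial.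
  · obtain ⟨g, hg, hgm, hgA⟩ := PIAlg.exists_multilinear_notMem PIAlg.isTIdeal_identities
      (PIAlg.isTIdeal_tIdealSpan f') (PIAlg.mem_tIdealSpan_self f') hf'A
    obtain ⟨hfull, hK⟩ := hfullK U d s μ hμ f hfP
    have hgf := PIAlg.tIdealSpan_le (PIAlg.isTIdeal_tIdealSpan f) hf' hg
    obtain ⟨h, hhg, hh⟩ := hkemer U d s μ hμ g hgm hgA
      (fun i => PIAlg.tIdealSpan_le PIAlg.isTIdeal_identities (hfull i) hgf)
      (PIAlg.tIdealSpan_le PIAlg.isTIdeal_identities hK hgf)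
    exact ⟨h, PIAlg.tIdealSpan_le (PIAlg.isTIdeal_tIdealSpan f') hg hhg, hh.1, hh.2.1, hh⟩
  · obtain ⟨U, hU⟩ := W.exists_matrixUnits
    refine ⟨fun f hf hfP _ g hg hgm _ => ?_, fun f hf hfP _ g hg hgm _ => ?_,
      fun d s μ hμ => ⟨fun f hfP => ?_, fun f hf hfA hfull hK => ?_⟩⟩
    · rw [PIAlg.WedderburnDecomposition.isFullFor_iff hU hf] at hfP
      rw [PIAlg.WedderburnDecomposition.isFullFor_iff hU hgm]
      exact fun i => PIAlg.tIdealSpan_le PIAlg.isTIdeal_identities (hfP i) hg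
    · rw [PIAlg.WedderburnDecomposition.hasPropertyK_iff hU hf] at hfP
      rw [PIAlg.WedderburnDecomposition.hasPropertyK_iff hU hgm]
      exact PIAlg.tIdealSpan_le PIAlg.isTIdeal_identities hfP hg
    · rw [PIAlg.WedderburnDecomposition.isFullFor_iff hU hfP.1,
        PIAlg.WedderburnDecomposition.hasPropertyK_iff hU hfP.1]
      exact hfullK U d s μ hμ f hfP
    · rw [PIAlg.WedderburnDecomposition.isFullFor_iff hU hf] at hfull
      rw [PIAlg.WedderburnDecomposition.hasPropertyK_iff hU hf] at hK
      exact hkemer U d s μ hμ f hf hfA hfull hK
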